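/- Let $\mathbb K$ be an algebraically closed field of characteristic $0$, $M$ a lattice of finite rank, $N=\operatorname{Hom}(M,\mathbb Z)$, $\mathbb T=\operatorname{Spec}\mathbb K[M]$, $\sigma\subseteq N_{\mathbb Q}$ a pointed (i.e. containing no line) polyhedral cone, and $X_\sigma=\operatorname{Spec}\mathbb K[\sigma^\vee\cap M]$ the corresponding affine toric variety. Identify a ray of $\sigma$ with its primitive lattice vector, and let $\sigma(1)$ be the set of rays. A vector $e\in M$ is a root of $\sigma$ if there is $\rho_e\in\sigma(1)$ with $\langle e,\rho_e\rangle=-1$ and $\langle e,\rho\rangle\ge 0$ for all $\rho\in\sigma(1)\setminus\{\rho_e\}$; put $\partial_e(\chi^m)=\langle m,\rho_e\rangle\chi^{m+e}$. An $\mathrm{SL}_2$-root is a root $e$ such that $-e$ is also a root. A regular $\mathrm{SL}_2$-action on $X_\sigma$ is compatible if its image in $\operatorname{Aut}(X_\sigma)$ is normalized but not centralized by $\mathbb T$. Let $T\subseteq \mathrm{SL}_2$ be the torus of diagonal matrices $\operatorname{diag}(t,t^{-1})$ and $U_+,U_-$ the groups of matrices $\left(\begin{smallmatrix}1&s\\0&1\end{smallmatrix}\right)$,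 $\left(\begin{smallmatrix}1&0\\s&1\end{smallmatrix}\right)$. Actions are written as actions of $\mathrm{SL}_2$ on $\mathbb K[\sigma^\vee\cap M]$ by algebra automorphisms. **Theorem.** (i) Every compatible $\mathrm{SL}_2$-action on $X_\sigma$ becomes, after composition with an inner automorphism of $\mathrm{SL}_2$, a compatible action for which $T$ acts through $\mathbb T$. (ii) For every $\mathrm{SL}_2$-root $e$ of $\sigma$ there is exactly one $\mathrm{SL}_2$-action $\Phi_e$ on $X_\sigma$ for which the infinitesimal generators of the actions of $U_+$ and $U_-$ are $\partial_e$ and $\partial_{-e}$. It is compatible, and $\operatorname{diag}(t,t^{-1})\cdot\chi^m=t^{\langle m,\rho_{-e}-\rho_e\rangle}\chi^m$, so that $T$ acts through $\mathbb T$. The map $e\mapsto[\Phi_e]$ is a bijection from the set of $\mathrm{SL}_2$-roots of $\sigma$ onto the set of compatible $\mathrm{SL}_2$-actions on $X_\sigma$ for which $T$ acts through $\mathbb T$, modulo conjugation by elements of $\mathbb T$. (iii) The action $\Phi_e$ is effective if and only if the lattice vector $\rho_{-e}-\rho_e\in N$ is primitive. If it is not primitive, then $\tfrac12(\rho_{-e}-\rho_e)$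 is a primitive lattice vector, and $\Phi_e$ induces an effective action of $\mathrm{PSL}_2$ on $X_\sigma$. -/

import Mathlib

namespace ToricSL2

open Matrix

/-! ### Lattices, cones, roots

`M` is a lattice (a finitely generated free abelian group), `N = Hom(M, ℤ)` its dual,
and `N_ℚ = N ⊗ ℚ` is realised as `Hom(M, ℚ)`, so that the duality pairing is evaluation. -/

/-- The dual lattice `N = Hom(M, ℤ)`. -/
abbrev DualLattice (M : Type*) [AddCommGroup M] : Type _ := M →ₗ[ℤ] ℤ

/-- The rational vector space `N_ℚ = Hom(M, ℚ)`. -/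
abbrev RatDual (M : Type*) [AddCommGroup M] : Type _ := M →ₗ[ℤ] ℚ

/-- The inclusion `N ⊆ N_ℚ`. -/
def toRat {M : Type*} [AddCommGroup M] (ν : DualLattice M) : RatDual M :=
  (Algebra.linearMap ℤ ℚ) ∘ₗ ν

/-- A lattice vector is primitive if it is not a proper multiple of a lattice vector
(in particular it is nonzero, as `0 = 0 • 0`). -/
def IsPrimitive {M : Type*} [AddCommGroup M] (ν : DualLattice M) : Prop :=
  ∀ (k : ℤ) (μ : DualLattice M), ν = k • μ → IsUnit k

/-- `ρ ∈ σ(1)`: the primitive vector of a ray (one-dimensional face) of `σ`. -/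
def IsRay {M : Type*} [AddCommGroup M] (σ : PointedCone ℚ (RatDual M))
    (ρ : DualLattice M) : Prop :=
  IsPrimitive ρ ∧ (PointedCone.hull ℚ {toRat ρ}).IsFaceOf σ

/-- `ρ` is a distinguished ray of `e`: `⟨e, ρ⟩ = -1`, and `⟨e, ρ'⟩ ≥ 0` for the other rays. -/
def IsDistinguishedRay {M : Type*} [AddCommGroup M] (σ : PointedCone ℚ (RatDual M))
    (e : M) (ρ : DualLattice M) : Prop :=
  IsRay σ ρ ∧ ρ e = -1 ∧ ∀ ρ' : DualLattice M, IsRay σ ρ' → ρ' ≠ ρ → 0 ≤ ρ' e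

/-- `e ∈ M` is a root of `σ`. -/
def IsRoot {M : Type*} [AddCommGroup M] (σ : PointedCone ℚ (RatDual M)) (e : M) : Prop :=
  ∃ ρ : DualLattice M, IsDistinguishedRay σ e ρ

/-- The distinguished ray is determined by the root. -/
theorem IsDistinguishedRay.unique {M : Type*} [AddCommGroup M]
    {σ : PointedCone ℚ (RatDual M)} {e : M} {ρ ρ' : DualLattice M}
    (h : IsDistinguishedRay σ e ρ) (h' : IsDistinguishedRay σ e ρ') : ρ = ρ' := by
  by_contra hne
  have h1 := h.2.2 ρ' h'.1 (Ne.symm hne)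
  have h2 := h'.2.1
  omega

/-- The distinguished ray `ρ_e` of a root `e`. -/
noncomputable def IsRoot.ray {M : Type*} [AddCommGroup M] {σ : PointedCone ℚ (RatDual M)}
    {e : M} (he : IsRoot σ e) : DualLattice M :=
  he.choose

/-- The set of `SL₂`-roots of `σ`: the roots `e` such that `-e` is a root, too. -/
def SL2Roots {M : Type*} [AddCommGroup M] (σ : PointedCone ℚ (RatDual M)) : Set M :=
  {e | IsRoot σ e ∧ IsRoot σ (-e)}

/-- The lattice vector `ρ_{-e} - ρ_e` of an `SL₂`-root `e`. -/
noncomputable def rayDiff {M : Type*} [AddCommGroup M] {σ : PointedCone ℚ (RatDual M)}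
    (e : SL2Roots σ) : DualLattice M :=
  e.2.2.ray - e.2.1.ray

/-! ### The affine toric variety `X_σ = Spec K[σ^∨ ∩ M]` -/

/-- The monoid `σ^∨ ∩ M`. -/
def dualMonoid {M : Type*} [AddCommGroup M] (σ : PointedCone ℚ (RatDual M)) :
    AddSubmonoid M where
  carrier := {m | ∀ v ∈ σ, 0 ≤ v m}
  zero_mem' := fun v _ => by simp
  add_mem' := fun {a b} ha hb v hv => by
    rw [map_add]
    exact add_nonneg (ha v hv) (hb v hv)

/-- The coordinate ring `K[σ^∨ ∩ M]` of `X_σ`. -/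
abbrev CoordRing (K : Type*) [Field K] {M : Type*} [AddCommGroup M]
    (σ : PointedCone ℚ (RatDual M)) : Type _ :=
  AddMonoidAlgebra K (dualMonoid σ)

/-- The element `χ^m` of the coordinate ring, for `m ∈ σ^∨ ∩ M`. -/
noncomputable def chi (K : Type*) [Field K] {M : Type*} [AddCommGroup M]
    {σ : PointedCone ℚ (RatDual M)} (m : dualMonoid σ) : CoordRing K σ :=
  AddMonoidAlgebra.single m 1

/-- The (closed points of the) torus `𝕋 = Spec K[M]`. -/
abbrev Torus (K : Type*) [Field K] (M : Type*) [AddCommGroup M] : Type _ :=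
  Multiplicative M →* Kˣ

/-- The algebra endomorphism `χ^m ↦ t(m) χ^m` given by `t ∈ 𝕋`. -/
noncomputable def torusHom {K : Type*} [Field K] {M : Type*} [AddCommGroup M]
    (σ : PointedCone ℚ (RatDual M)) (t : Torus K M) : CoordRing K σ →ₐ[K] CoordRing K σ :=
  AddMonoidAlgebra.lift K (CoordRing K σ) (dualMonoid σ)
    { toFun := fun m => AddMonoidAlgebra.single m.toAdd
        ((t (Multiplicative.ofAdd (m.toAdd : M)) : Kˣ) : K)
      map_one' := by
        simp only [toAdd_one, ZeroMemClass.coe_zero, ofAdd_zero, map_one, Units.val_one]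
        rfl
      map_mul' := fun a b => by
        rw [AddMonoidAlgebra.single_mul_single]
        simp }

theorem torusHom_chi {K : Type*} [Field K] {M : Type*} [AddCommGroup M]
    (σ : PointedCone ℚ (RatDual M)) (t : Torus K M) (m : dualMonoid σ) :
    torusHom σ t (chi K m) = ((t (Multiplicative.ofAdd (m : M)) : Kˣ) : K) • chi K m := by
  simp [torusHom, chi]

theorem torusHom_mul {K : Type*} [Field K] {M : Type*} [AddCommGroup M]
    (σ : PointedCone ℚ (RatDual M)) (s t : Torus K M) :
    torusHom σ (s * t) = (torusHom σ s).comp (torusHom σ t) := by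
  apply (AddMonoidAlgebra.lift K (CoordRing K σ) (dualMonoid σ)).symm.injective
  refine MonoidHom.ext fun m => ?_
  induction m using Multiplicative.rec with | _ m
  simp only [AddMonoidAlgebra.lift_symm_apply, toAdd_ofAdd]
  have h := torusHom_chi (K := K) σ
  simp only [chi] at h
  rw [AlgHom.comp_apply, h, h, map_smul, h, smul_smul]
  simp [mul_comm]

theorem torusHom_one {K : Type*} [Field K] {M : Type*} [AddCommGroup M]
    (σ : PointedCone ℚ (RatDual M)) :
    torusHom σ (1 : Torus K M) = AlgHom.id K _ := by
  apply (AddMonoidAlgebra.lift K (CoordRing K σ) (dualMonoid σ)).symm.injective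
  refine MonoidHom.ext fun m => ?_
  induction m using Multiplicative.rec with | _ m
  simp only [AddMonoidAlgebra.lift_symm_apply, toAdd_ofAdd]
  have h := torusHom_chi (K := K) σ
  simp only [chi] at h
  rw [h]
  simp

/-- The action of the torus `𝕋` on `X_σ`, as a group homomorphism to the automorphism group
of the coordinate ring. -/
noncomputable def torusAction (K : Type*) [Field K] {M : Type*} [AddCommGroup M]
    (σ : PointedCone ℚ (RatDual M)) : Torus K M →* (CoordRing K σ ≃ₐ[K] CoordRing K σ) where
  toFun t := AlgEquiv.ofAlgHom (torusHom σ t) (torusHom σ t⁻¹)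
    (by rw [← torusHom_mul, show t * t⁻¹ = 1 from mul_inv_cancel t, torusHom_one])
    (by rw [← torusHom_mul, show t⁻¹ * t = 1 from inv_mul_cancel t, torusHom_one])
  map_one' := by
    ext1 a
    exact congrArg (fun f => f a) (torusHom_one σ)
  map_mul' := fun s t => by
    ext1 a
    exact congrArg (fun f => f a) (torusHom_mul σ s t)

/-! ### Regular `SL₂`-actions on affine varieties -/

/-- A regular action of `SL₂` on the affine variety `X = Spec A` over an algebraically closed
field `K`: an action of the group `SL₂(K)` on `A` by algebra automorphisms which is rational,
that is, for every `a ∈ A` the element `g · a` depends polynomially on the entries of `g`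
(equivalently: `g ↦ g · a` is given by an element of `A ⊗ K[SL₂]`). -/
@[ext]
structure SL2Action (K : Type*) [Field K] (A : Type*) [CommRing A] [Algebra K A] where
  /-- The homomorphism `SL₂ → Aut(X)`. -/
  toHom : SpecialLinearGroup (Fin 2) K →* (A ≃ₐ[K] A)
  rational : ∀ a : A, ∃ P : MvPolynomial (Fin 2 × Fin 2) A,
    ∀ g : SpecialLinearGroup (Fin 2) K,
      toHom g a = MvPolynomial.eval (fun ij => algebraMap K A (g.1 ij.1 ij.2)) P

/-- The element `(1 s; 0 1)` of `U₊`. -/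
def upper {K : Type*} [Field K] (s : K) : SpecialLinearGroup (Fin 2) K :=
  ⟨!![1, s; 0, 1], by simp [Matrix.det_fin_two]⟩

/-- The element `(1 0; s 1)` of `U₋`. -/
def lower {K : Type*} [Field K] (s : K) : SpecialLinearGroup (Fin 2) K :=
  ⟨!![1, 0; s, 1], by simp [Matrix.det_fin_two]⟩

/-- The element `(t 0; 0 t⁻¹)` of the maximal torus `T` of `SL₂`. -/
def diag {K : Type*} [Field K] (t : Kˣ) : SpecialLinearGroup (Fin 2) K :=
  ⟨!![(t : K), 0; 0, ((t⁻¹ : Kˣ) : K)], by simp [Matrix.det_fin_two]⟩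

/-- `D` is the infinitesimal generator `d/ds (γ s · a)` at `s = 0` of the family `γ` of
automorphisms of `A`, which depends polynomially on `s ∈ K`. -/
def IsInfinitesimalGenerator {K : Type*} [Field K] {A : Type*} [CommRing A] [Algebra K A]
    (γ : K → (A ≃ₐ[K] A)) (D : A →ₗ[K] A) : Prop :=
  ∀ a : A, ∃ P : Polynomial A,
    (∀ s : K, γ s a = P.eval (algebraMap K A s)) ∧ D a = P.derivative.eval 0

/-- The operator `∂_e (χ^m) = ⟨m, ρ_e⟩ χ^{m + e}` on `K[σ^∨ ∩ M]`, for a root `e` of `σ`.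
If `m + e ∉ σ^∨`, then `⟨m, ρ_e⟩ = 0`, and the right-hand side is `0`. -/
noncomputable def rootDerivation (K : Type*) [Field K] {M : Type*} [AddCommGroup M]
    {σ : PointedCone ℚ (RatDual M)} {e : M} (he : IsRoot σ e) :
    CoordRing K σ →ₗ[K] CoordRing K σ :=
  open scoped Classical in
  (Finsupp.linearCombination K fun m : dualMonoid σ =>
      if h : (m : M) + e ∈ dualMonoid σ then
        ((he.ray (m : M) : ℤ) : K) • chi K (⟨(m : M) + e, h⟩ : dualMonoid σ)
      else 0) ∘ₗ
    (AddMonoidAlgebra.coeffLinearEquiv K).toLinearMap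

theorem rootDerivation_chi {K : Type*} [Field K] {M : Type*} [AddCommGroup M]
    {σ : PointedCone ℚ (RatDual M)} {e : M} (he : IsRoot σ e) (m : dualMonoid σ)
    (h : (m : M) + e ∈ dualMonoid σ) :
    rootDerivation K he (chi K m) =
      ((he.ray (m : M) : ℤ) : K) • chi K (⟨(m : M) + e, h⟩ : dualMonoid σ) := by
  simp [rootDerivation, chi, h]

/-! ### Compatible actions -/

/-- The action is compatible: its image in `Aut(X_σ)` is normalized but not centralized
by the torus. -/
def IsCompatible {K : Type*} [Field K] {M : Type*} [AddCommGroup M]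
    {σ : PointedCone ℚ (RatDual M)} (φ : SL2Action K (CoordRing K σ)) : Prop :=
  (torusAction K σ).range ≤ Subgroup.normalizer (φ.toHom.range : Set _) ∧
    ¬ (torusAction K σ).range ≤ Subgroup.centralizer (φ.toHom.range : Set _)

/-- The maximal torus `T` of `SL₂` acts through the torus `𝕋`. -/
def IsAdapted {K : Type*} [Field K] {M : Type*} [AddCommGroup M]
    {σ : PointedCone ℚ (RatDual M)} (φ : SL2Action K (CoordRing K σ)) : Prop :=
  ∀ t : Kˣ, φ.toHom (diag t) ∈ (torusAction K σ).range

/-- The compatible actions for which `T ⊆ SL₂` acts through `𝕋`. -/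
abbrev AdaptedAction (K : Type*) [Field K] {M : Type*} [AddCommGroup M]
    (σ : PointedCone ℚ (RatDual M)) : Type _ :=
  {φ : SL2Action K (CoordRing K σ) // IsCompatible φ ∧ IsAdapted φ}

/-- Two such actions are identified if an element of `𝕋` conjugates one to the other. -/
def torusConj (K : Type*) [Field K] {M : Type*} [AddCommGroup M]
    (σ : PointedCone ℚ (RatDual M)) : Setoid (AdaptedAction K σ) where
  r φ ψ := ∃ t : Torus K M, ∀ g : SpecialLinearGroup (Fin 2) K,
    ψ.1.toHom g = torusAction K σ t * φ.1.toHom g * (torusAction K σ t)⁻¹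
  iseqv :=
    { refl := fun φ => ⟨1, fun g => by simp⟩
      symm := by
        rintro φ ψ ⟨t, ht⟩
        refine ⟨t⁻¹, fun g => ?_⟩
        rw [ht, show torusAction K σ t⁻¹ = (torusAction K σ t)⁻¹ from map_inv (torusAction K σ) t]
        group
      trans := by
        rintro φ ψ θ ⟨t, ht⟩ ⟨s, hs⟩
        refine ⟨s * t, fun g => ?_⟩
        rw [hs, ht, map_mul]
        group }

end ToricSL2

namespace ToricSL2

open Matrix

/-! ### Rational polyhedral cones in the dual of a lattice -/

section Cones

variable {M : Type*} [AddCommGroup M]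

/-! The torus `𝕋` acts by conjugation on the linear operators of the coordinate ring, and everything
is read off from the weights of this action.

Part (i). A regular action has a differential `𝔰𝔩₂ → Der`, injective as soon as `U₊` acts
nontrivially. Normalizing the image is a condition on an abstract group, so it has to be transferred
to the Lie algebra: an automorphism conjugate to an element of `U₊` has powers depending
polynomially on the exponent, and the only such elements of the image are unipotent up to sign
(`SL2Action.exists_conjEnd_differential`). Hence the Lie algebra of a compatible action is a
finite-dimensional `𝕋`-stable space and is spanned by homogeneous elements. Those of nonzero weight
are nilpotent, and they exist because `𝕋` does not centralize the image. An inner automorphism moves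
a pair of them to the standard nilpotent matrices, of weights `a` and `-a`; then `𝕋` commutes with
`T`, and an automorphism commuting with `𝕋` is diagonal on characters, so it lies in `𝕋`.

Part (ii). For an `SL₂`-root `e`, every ray other than `ρ_e` and `ρ_{-e}` vanishes on `e`. The
embedding `χ^m ↦ x^⟨m,ρ_e⟩ y^⟨m,ρ_{-e}⟩ z^(m + ⟨m,ρ_e⟩e)` into `K[x, y] ⊗ K[M]` therefore has an
image stable under the linear action on `x, y`, and the restriction is `Φ_e` (`IsSL2Pair.action`).
One-parameter groups are determined by their generators and `U₊`, `U₋` generate `SL₂`, whence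
uniqueness. Conversely, for an adapted action the two nilpotent generators are homogeneous, hence of
the form `χ^m ↦ f(m) χ^(m+a)` with `f` additive. The relations of `𝔰𝔩₂` allow both to be normalized
simultaneously, local nilpotency makes `f` a nonnegative lattice vector, and convexity shows that it
is a distinguished ray (`isDistinguishedRay_of_step`). The normalizing scalar is absorbed by
conjugation with an element of `𝕋`.

Part (iii). The kernel lies in `{1, -1}`, and `-1` acts on `χ^m` by `(-1)^⟨m,δ⟩` for `δ = ρ_{-e} -
ρ_e`. As `⟨e,δ⟩ = 2`, the vector `δ` is primitive or twice a primitive vector. -/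

theorem mem_hull_singleton_iff {v x : RatDual M} :
    x ∈ PointedCone.hull ℚ {v} ↔ ∃ c : ℚ, 0 ≤ c ∧ x = c • v := by
  rw [PointedCone.hull, Submodule.mem_span_singleton]
  constructor
  · rintro ⟨c, rfl⟩
    exact ⟨c.1, c.2, rfl⟩
  · rintro ⟨c, hc, rfl⟩
    exact ⟨⟨c, hc⟩, rfl⟩

theorem mem_hull_insert_iff {v x : RatDual M} {s : Set (RatDual M)} :
    x ∈ PointedCone.hull ℚ (insert v s) ↔
      ∃ c : ℚ, 0 ≤ c ∧ ∃ y ∈ PointedCone.hull ℚ s, x = c • v + y := by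
  rw [PointedCone.hull, Submodule.mem_span_insert]
  constructor
  · rintro ⟨c, y, hy, rfl⟩
    exact ⟨c.1, c.2, y, hy, rfl⟩
  · rintro ⟨c, hc, y, hy, rfl⟩
    exact ⟨⟨c, hc⟩, y, hy, rfl⟩

theorem hull_image_eq_sum {ι : Type*} (s : Finset ι) (a : ι → RatDual M) (b : RatDual M) :
    b ∈ PointedCone.hull ℚ (a '' s) ↔
      ∃ c : ι → ℚ, (∀ i, 0 ≤ c i) ∧ b = ∑ i ∈ s, c i • a i := by
  constructor
  · intro h
    classical
    induction s using Finset.induction_on generalizing b with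
    | empty =>
      simp only [Finset.coe_empty, Set.image_empty] at h
      refine ⟨0, fun _ => le_rfl, ?_⟩
      simpa [PointedCone.hull] using h
    | insert j s hj ih =>
      rw [Finset.coe_insert, Set.image_insert_eq, mem_hull_insert_iff] at h
      obtain ⟨r, hr, y, hy, rfl⟩ := h
      obtain ⟨c, hc, rfl⟩ := ih _ hy
      refine ⟨Function.update c j r, fun i => ?_, ?_⟩
      · by_cases hi : i = j
        · subst hi; simpa
        · simpa [hi] using hc i
      · rw [Finset.sum_insert hj]
        simp only [Function.update_self]
        congr 1
        refine Finset.sum_congr rfl fun i hi => ?_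
        rw [Function.update_of_ne]
        rintro rfl
        exact hj hi
  · rintro ⟨c, hc, rfl⟩
    refine Submodule.sum_mem _ fun i hi => ?_
    exact PointedCone.smul_mem _ (hc i) (Submodule.subset_span ⟨i, hi, rfl⟩)

/-- Farkas' lemma for rational functionals on an abelian group. -/
theorem farkas {ι : Type*} (s : Finset ι) (a : ι → RatDual M) (b : RatDual M)
    (h : ∀ x : M, (∀ i ∈ s, 0 ≤ a i x) → 0 ≤ b x) :
    ∃ c : ι → ℚ, (∀ i, 0 ≤ c i) ∧ b = ∑ i ∈ s, c i • a i := by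
  classical
  induction s using Finset.induction_on generalizing a b with
  | empty =>
    refine ⟨0, fun _ => le_rfl, ?_⟩
    ext x
    have h1 := h x (by simp)
    have h2 := h (-x) (by simp)
    rw [map_neg] at h2
    simp only [Finset.sum_empty, LinearMap.zero_apply]
    linarith
  | insert j s hj ih =>
    by_cases hb : ∀ x : M, (∀ i ∈ s, 0 ≤ a i x) → 0 ≤ b x
    · obtain ⟨c, hc, hbc⟩ := ih a b hb
      refine ⟨Function.update c j 0, fun i => ?_, ?_⟩
      · by_cases hi : i = j
        · subst hi; simp
        · simpa [hi] using hc i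
      · rw [Finset.sum_insert hj, hbc]
        simp only [Function.update_self, zero_smul, zero_add]
        refine Finset.sum_congr rfl fun i hi => ?_
        rw [Function.update_of_ne]
        rintro rfl
        exact hj hi
    · push Not at hb
      obtain ⟨y, hy, hby⟩ := hb
      have hjy : a j y < 0 := by
        by_contra hcon
        push Not at hcon
        refine absurd (h y fun i hi => ?_) (not_le.mpr hby)
        rcases Finset.mem_insert.mp hi with rfl | hi
        · exact hcon
        · exact hy i hi
      set r : ℚ := -(a j y) with hr
      have hr0 : 0 < r := by linarith
      -- Sending `f` to `r • f + f y • a j` is composition with `x ↦ r x + a j x • y`, which is `r`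
      -- times the projection along `y` onto the kernel of `a j`. On that kernel the constraint `a
      -- j` is automatic, so the induction hypothesis applies to the composed functionals.
      obtain ⟨c, hc, hbc⟩ := ih (fun i => r • a i + (a i y) • a j) (r • b + (b y) • a j) (by
        intro x hx
        -- clear denominators in `r • x + a j x • y`
        set n : ℤ := r.den * (a j x).den
        have hn : (0 : ℚ) < n := by
          have h1 := r.den_pos
          have h2 := (a j x).den_pos
          simp only [n]; positivity
        have e1 : ((r.num * (a j x).den : ℤ) : ℚ) = n * r := by
          have := Rat.mul_den_eq_num r
          push_cast [n]
          rw [← this]; ring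
        have e2 : (((a j x).num * r.den : ℤ) : ℚ) = n * a j x := by
          have := Rat.mul_den_eq_num (a j x)
          push_cast [n]
          rw [← this]; ring
        set z : M := (r.num * (a j x).den) • x + ((a j x).num * r.den) • y
        have key : ∀ f : RatDual M, f z = n * (r * f x + a j x * f y) := by
          intro f
          simp only [z, map_add, map_zsmul, zsmul_eq_mul, e1, e2]
          ring
        have hz : ∀ i ∈ insert j s, 0 ≤ a i z := by
          intro i hi
          rw [key]
          refine mul_nonneg hn.le ?_
          rcases Finset.mem_insert.mp hi with rfl | hi
          · rw [hr]; apply le_of_eq; ring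
          · have := hx i hi
            simp only [LinearMap.add_apply, LinearMap.smul_apply, smul_eq_mul] at this
            linarith
        have := h z hz
        rw [key] at this
        have := nonneg_of_mul_nonneg_right this hn
        simp only [LinearMap.add_apply, LinearMap.smul_apply, smul_eq_mul]
        linarith)
      -- Solving the identity of the induction hypothesis for `b` leaves this coefficient at `a j`;
      -- it is nonnegative because `a i y ≥ 0` on `s` while `b y < 0`.
      set d : ℚ := (∑ i ∈ s, c i * a i y - b y) / r
      refine ⟨Function.update c j d, fun i => ?_, ?_⟩
      · by_cases hi : i = j
        · subst hi
          simp only [Function.update_self, d]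
          refine div_nonneg ?_ hr0.le
          have : 0 ≤ ∑ k ∈ s, c k * a k y :=
            Finset.sum_nonneg fun k hk => mul_nonneg (hc k) (hy k hk)
          linarith
        · rw [Function.update_of_ne hi]
          exact hc i
      · rw [Finset.sum_insert hj]
        simp only [Function.update_self]
        have h1 : ∑ i ∈ s, Function.update c j d i • a i = ∑ i ∈ s, c i • a i := by
          refine Finset.sum_congr rfl fun i hi => ?_
          rw [Function.update_of_ne]
          rintro rfl
          exact hj hi
        rw [h1]
        ext x
        have h2 := congrArg (fun f => f x) hbc
        simp only [LinearMap.add_apply, LinearMap.smul_apply, smul_eq_mul,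
          LinearMap.sum_apply] at h2 ⊢
        have h3 : ∑ i ∈ s, c i * (r * a i x + a i y * a j x) =
            r * ∑ i ∈ s, c i * a i x + (∑ i ∈ s, c i * a i y) * a j x := by
          rw [Finset.mul_sum, Finset.sum_mul, ← Finset.sum_add_distrib]
          exact Finset.sum_congr rfl fun i _ => by ring
        rw [h3] at h2
        simp only [d]
        field_simp
        linarith

variable {σ : PointedCone ℚ (RatDual M)}

/-- The double dual theorem for finitely generated cones. -/
theorem mem_of_nonneg_on_dualMonoid (hfg : Submodule.FG σ) (f : RatDual M)
    (hf : ∀ m ∈ dualMonoid σ, 0 ≤ f m) : f ∈ σ := by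
  obtain ⟨s, rfl⟩ := hfg
  obtain ⟨c, hc, hf⟩ := farkas s id f (fun x hx => hf x (by
    intro v hv
    have := (hull_image_eq_sum s id v).mp (by simpa [PointedCone.hull] using hv)
    obtain ⟨c, hc, rfl⟩ := this
    simp only [LinearMap.sum_apply, LinearMap.smul_apply, smul_eq_mul]
    exact Finset.sum_nonneg fun i hi => mul_nonneg (hc i) (hx i hi)))
  rw [hf]
  exact Submodule.sum_mem _ fun i hi =>
    PointedCone.smul_mem _ (hc i) (Submodule.subset_span hi)

/-- A nonzero vector of a pointed cone is positive somewhere on the dual monoid. -/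
theorem exists_pos_of_mem (hfg : Submodule.FG σ) (hpointed : ∀ v ∈ σ, -v ∈ σ → v = 0)
    {v : RatDual M} (hv : v ∈ σ) (hv0 : v ≠ 0) : ∃ m ∈ dualMonoid σ, 0 < v m := by
  by_contra hcon
  push Not at hcon
  refine hv0 (hpointed v hv (mem_of_nonneg_on_dualMonoid hfg _ fun m hm => ?_))
  have := hcon m hm
  simp only [LinearMap.neg_apply]
  linarith

/-- The dual monoid of a pointed cone has an interior point. -/
theorem exists_interior (hfg : Submodule.FG σ) (hpointed : ∀ v ∈ σ, -v ∈ σ → v = 0) :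
    ∃ m₀ ∈ dualMonoid σ, ∀ m : M, ∃ k : ℕ, m + k • m₀ ∈ dualMonoid σ := by
  classical
  obtain ⟨s, hs⟩ := id hfg
  have hsub : ∀ v ∈ s, v ∈ σ := fun v hv => hs ▸ Submodule.subset_span hv
  have hpos : ∀ v : RatDual M, ∃ m ∈ dualMonoid σ, v ∈ s → v ≠ 0 → 0 < v m := by
    intro v
    by_cases h : v ∈ s ∧ v ≠ 0
    · obtain ⟨m, hm, hm'⟩ := exists_pos_of_mem hfg hpointed (hsub v h.1) h.2
      exact ⟨m, hm, fun _ _ => hm'⟩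
    · exact ⟨0, zero_mem _, fun h1 h2 => absurd ⟨h1, h2⟩ h⟩
  choose p hp hp' using hpos
  -- One element positive on each nonzero generator is chosen; their sum is positive on all of them
  -- at once, so large multiples outweigh any `m`.
  set m₀ := ∑ v ∈ s, p v
  have hm₀ : m₀ ∈ dualMonoid σ := sum_mem fun v _ => hp v
  have hm₀pos : ∀ v ∈ s, v ≠ 0 → 0 < v m₀ := by
    intro v hv hv0
    simp only [m₀, map_sum]
    exact Finset.sum_pos' (fun w _ => hp w v (hsub v hv)) ⟨v, hv, hp' v hv hv0⟩
  refine ⟨m₀, hm₀, fun m => ?_⟩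
  have hk : ∀ v : RatDual M, ∃ k : ℕ, v ∈ s → ∀ n : ℕ, k ≤ n → 0 ≤ v (m + n • m₀) := by
    intro v
    by_cases hv : v ∈ s
    · by_cases hv0 : v = 0
      · exact ⟨0, fun _ n _ => by simp [hv0]⟩
      · obtain ⟨k, hk⟩ := exists_nat_ge (-(v m) / v m₀)
        refine ⟨k, fun _ n hn => ?_⟩
        have h0 := hm₀pos v hv hv0
        rw [div_le_iff₀ h0] at hk
        have : (k : ℚ) ≤ n := by exact_mod_cast hn
        have h2 := mul_le_mul_of_nonneg_right this h0.le
        rw [map_add, map_nsmul, nsmul_eq_mul]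
        linarith
    · exact ⟨0, fun h => absurd h hv⟩
  choose k hk using hk
  refine ⟨∑ v ∈ s, k v, fun w hw => ?_⟩
  rw [← hs] at hw
  induction hw using Submodule.span_induction with
  | mem v hv => exact hk v hv _ (Finset.single_le_sum (fun _ _ => Nat.zero_le _) hv)
  | zero => simp
  | add x y _ _ hx hy => exact add_nonneg hx hy
  | smul c x _ hx => exact mul_nonneg c.2 hx

/-- Additive functions on the dual monoid of a pointed cone extend to the lattice. -/
theorem exists_extension (hfg : Submodule.FG σ) (hpointed : ∀ v ∈ σ, -v ∈ σ → v = 0)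
    {G : Type*} [AddCommGroup G] (f : dualMonoid σ →+ G) :
    ∃ F : M →+ G, ∀ m : dualMonoid σ, F m = f m := by
  obtain ⟨m₀, hm₀, hk⟩ := exists_interior hfg hpointed
  choose k hk using hk
  -- The value forced on an extension does not depend on how far `m` is pushed into the monoid along
  -- `m₀`.
  have key : ∀ (m : M) (n : ℕ) (h : m + n • m₀ ∈ dualMonoid σ),
      f ⟨m + n • m₀, h⟩ - n • f ⟨m₀, hm₀⟩ = f ⟨m + k m • m₀, hk m⟩ - k m • f ⟨m₀, hm₀⟩ := by
    intro m n h
    rw [sub_eq_sub_iff_add_eq_add, ← map_nsmul, ← map_nsmul, ← map_add, ← map_add]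
    congr 1
    ext
    simp only [AddSubmonoid.coe_add, AddSubmonoidClass.coe_nsmul]
    abel
  refine ⟨AddMonoidHom.mk' (fun m => f ⟨m + k m • m₀, hk m⟩ - k m • f ⟨m₀, hm₀⟩) ?_, ?_⟩
  · intro a b
    have hab : a + b + (k a + k b) • m₀ ∈ dualMonoid σ := by
      have := add_mem (hk a) (hk b)
      rwa [show a + k a • m₀ + (b + k b • m₀) = a + b + (k a + k b) • m₀ by
        rw [add_smul]; abel] at this
    rw [← key (a + b) (k a + k b) hab]
    have : (⟨a + b + (k a + k b) • m₀, hab⟩ : dualMonoid σ) =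
        ⟨a + k a • m₀, hk a⟩ + ⟨b + k b • m₀, hk b⟩ := by
      ext
      simp only [AddSubmonoid.coe_add]
      rw [add_smul]; abel
    rw [this, map_add, add_smul]
    abel
  · intro m
    simp only [AddMonoidHom.mk'_apply]
    have := key (m : M) 0 (by simp)
    rw [← this]
    simp

/-- Two additive functions on the lattice which agree on the dual monoid are equal. -/
theorem addMonoidHom_ext_of_dualMonoid (hfg : Submodule.FG σ)
    (hpointed : ∀ v ∈ σ, -v ∈ σ → v = 0) {G : Type*} [AddCommGroup G] {f g : M →+ G}
    (h : ∀ m : dualMonoid σ, f m = g m) : f = g := by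
  obtain ⟨m₀, hm₀, hk⟩ := exists_interior hfg hpointed
  ext m
  obtain ⟨k, hk⟩ := hk m
  have h1 := h ⟨_, hk⟩
  have h2 := h ⟨_, hm₀⟩
  simp only [map_add, map_nsmul] at h1 h2
  rw [h2] at h1
  exact add_right_cancel h1

/-! ### Primitive vectors and rays. -/

theorem toRat_apply (ν : DualLattice M) (m : M) : toRat ν m = (ν m : ℚ) := rfl

theorem toRat_injective : Function.Injective (toRat (M := M)) := by
  intro a b h
  ext m
  have := congrArg (fun f => f m) h
  simpa [toRat_apply] using this

theorem IsPrimitive.ne_zero {ν : DualLattice M} (h : IsPrimitive ν) : ν ≠ 0 := by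
  rintro rfl
  exact not_isUnit_zero (h 0 0 (by simp))

theorem isPrimitive_of_apply_eq_one {ν : DualLattice M} {m : M} (h : ν m = 1) :
    IsPrimitive ν := by
  rintro k μ rfl
  exact IsUnit.of_mul_eq_one (μ m) (by simpa using h)

theorem isPrimitive_of_apply_eq_neg_one {ν : DualLattice M} {m : M} (h : ν m = -1) :
    IsPrimitive ν :=
  isPrimitive_of_apply_eq_one (m := -m) (by simp [h])

/-- Every nonzero rational functional is a positive multiple of a primitive lattice vector. -/
theorem exists_primitive [Module.Finite ℤ M] {v : RatDual M} (hv : v ≠ 0) :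
    ∃ (ρ : DualLattice M) (c : ℚ), 0 < c ∧ IsPrimitive ρ ∧ v = c • toRat ρ := by
  obtain ⟨s, hs⟩ := (Module.Finite.fg_top : (⊤ : Submodule ℤ M).FG)
  obtain ⟨n, hn0, hn⟩ : ∃ n : ℕ, 0 < n ∧ ∀ m : M, ∃ z : ℤ, n * v m = z := by
    refine ⟨∏ x ∈ s, (v x).den, Finset.prod_pos fun x _ => (v x).den_pos, fun m => ?_⟩
    have hm : m ∈ Submodule.span ℤ (s : Set M) := hs ▸ Submodule.mem_top
    induction hm using Submodule.span_induction with
    | mem x hx =>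
      obtain ⟨d, hd⟩ := Finset.dvd_prod_of_mem (fun x => (v x).den) hx
      refine ⟨d * (v x).num, ?_⟩
      rw [hd]
      push_cast
      rw [← Rat.mul_den_eq_num (v x)]
      ring
    | zero => exact ⟨0, by simp⟩
    | add x y _ _ hx hy =>
      obtain ⟨a, ha⟩ := hx
      obtain ⟨b, hb⟩ := hy
      exact ⟨a + b, by rw [map_add, mul_add, ha, hb]; push_cast; rfl⟩
    | smul k x _ hx =>
      obtain ⟨a, ha⟩ := hx
      refine ⟨k * a, ?_⟩
      rw [map_zsmul, zsmul_eq_mul, Int.cast_mul, ← ha]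
      ring
  choose w hw using hn
  have hwadd : ∀ a b, w (a + b) = w a + w b := fun a b => by
    have : (w (a + b) : ℚ) = w a + w b := by rw [← hw, ← hw, ← hw, map_add]; ring
    exact_mod_cast this
  let W : DualLattice M := (AddMonoidHom.mk' w hwadd).toIntLinearMap
  have hW : ∀ m, (W m : ℚ) = n * v m := fun m => (hw m).symm
  have hn' : (0 : ℚ) < n := by exact_mod_cast hn0
  -- The values of the integral functional `W = n • v` form an ideal `dℤ`. Dividing by `d` gives a
  -- functional attaining `1`, hence primitive.
  obtain ⟨d, hd⟩ := (inferInstance : (LinearMap.range W).IsPrincipal)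
  have hd0 : d ≠ 0 := by
    rintro rfl
    apply hv
    ext m
    have : W m ∈ LinearMap.range W := ⟨m, rfl⟩
    rw [hd] at this
    have h0 : W m = 0 := by simpa using this
    have := hW m
    rw [h0] at this
    simpa [hn'.ne'] using this.symm
  wlog hdpos : 0 < d generalizing d
  · refine this (-d) ?_ (neg_ne_zero.mpr hd0) (by omega)
    rw [hd]
    rw [← Set.neg_singleton, Submodule.span_neg]
  have hdvd : ∀ m, d ∣ W m := fun m => by
    have : W m ∈ LinearMap.range W := ⟨m, rfl⟩
    rw [hd, Submodule.mem_span_singleton] at this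
    obtain ⟨k, hk⟩ := this
    exact ⟨k, by rw [← hk]; simp [mul_comm]⟩
  choose r hr using hdvd
  have hradd : ∀ a b, r (a + b) = r a + r b := fun a b => by
    apply mul_left_cancel₀ hd0
    rw [mul_add, ← hr, ← hr, ← hr, map_add]
  obtain ⟨m, hm⟩ : d ∈ LinearMap.range W := hd ▸ Submodule.mem_span_singleton_self d
  refine ⟨(AddMonoidHom.mk' r hradd).toIntLinearMap, d / n,
    div_pos (by exact_mod_cast hdpos) hn', isPrimitive_of_apply_eq_one (m := m) ?_, ?_⟩
  · have := hr m
    rw [hm] at this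
    exact mul_left_cancel₀ hd0 (by simpa using this.symm)
  · ext m
    have h1 := hW m
    rw [hr m] at h1
    push_cast at h1
    simp only [LinearMap.smul_apply, smul_eq_mul, toRat_apply, AddMonoidHom.coe_toIntLinearMap,
      AddMonoidHom.mk'_apply]
    field_simp
    linarith

theorem IsRay.mem {ρ : DualLattice M} (h : IsRay σ ρ) : toRat ρ ∈ σ :=
  h.2.le (Submodule.mem_span_singleton_self _)

/-- A pointed polyhedral cone is generated by its rays, in terms of the dual monoid. -/
theorem mem_dualMonoid_of_rays [Module.Finite ℤ M] (hfg : Submodule.FG σ)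
    (hpointed : ∀ v ∈ σ, -v ∈ σ → v = 0) {m : M}
    (hm : ∀ ρ : DualLattice M, IsRay σ ρ → 0 ≤ ρ m) : m ∈ dualMonoid σ := by
  classical
  -- A generating set of least cardinality is irredundant; each of its members turns out to span a
  -- ray, so nonnegativity on the rays suffices.
  have hex : ∃ n : ℕ, ∃ s : Finset (RatDual M), PointedCone.hull ℚ (s : Set (RatDual M)) = σ ∧
      s.card = n := by
    obtain ⟨s, hs⟩ := hfg
    exact ⟨_, s, hs, rfl⟩
  obtain ⟨s, hs, hcard⟩ := Nat.find_spec hex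
  have hirr : ∀ v ∈ s, v ∉ PointedCone.hull ℚ ((s.erase v : Finset _) : Set (RatDual M)) := by
    intro v hv hv'
    refine Nat.find_min hex (m := (s.erase v).card) ?_ ⟨s.erase v, ?_, rfl⟩
    · rw [← hcard]; exact Finset.card_erase_lt_of_mem hv
    · rw [← hs]
      apply le_antisymm
      · exact Submodule.span_mono (Finset.coe_subset.mpr (Finset.erase_subset _ _))
      · refine Submodule.span_le.mpr fun w hw => ?_
        by_cases hwv : w = v
        · rw [hwv]; exact hv'
        · exact Submodule.subset_span (Finset.mem_coe.mpr (Finset.mem_erase.mpr ⟨hwv, hw⟩))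
  have hvnonneg : ∀ v ∈ s, 0 ≤ v m := by
    intro v hv
    have hv0 : v ≠ 0 := by
      rintro rfl
      exact hirr 0 hv (zero_mem _)
    have hvσ : v ∈ σ := hs ▸ Submodule.subset_span hv
    have hdec : ∀ x ∈ σ, ∃ c : ℚ, 0 ≤ c ∧
        ∃ y ∈ PointedCone.hull ℚ ((s.erase v : Finset _) : Set (RatDual M)), x = c • v + y := by
      intro x hx
      rw [← hs, ← Finset.insert_erase hv, Finset.coe_insert, mem_hull_insert_iff] at hx
      exact hx
    have hle : PointedCone.hull ℚ ((s.erase v : Finset _) : Set (RatDual M)) ≤ σ := by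
      rw [← hs]
      exact Submodule.span_mono (Finset.coe_subset.mpr (Finset.erase_subset _ _))
    obtain ⟨ρ, c, hc, hρ, hvρ⟩ := exists_primitive hv0
    have hhull : ∀ x, x ∈ PointedCone.hull ℚ {toRat ρ} ↔ ∃ c : ℚ, 0 ≤ c ∧ x = c • v := by
      intro x
      rw [mem_hull_singleton_iff]
      constructor
      · rintro ⟨d, hd, rfl⟩
        refine ⟨d / c, by positivity, ?_⟩
        rw [hvρ, smul_smul, div_mul_cancel₀ _ hc.ne']
      · rintro ⟨d, hd, rfl⟩
        exact ⟨d * c, by positivity, by rw [hvρ, smul_smul]⟩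
    have hray : IsRay σ ρ := by
      refine ⟨hρ, PointedCone.IsFaceOf.of_mem_of_add_mem_left ?_ ?_⟩
      · intro x hx
        obtain ⟨d, hd, rfl⟩ := (hhull x).mp hx
        exact PointedCone.smul_mem _ hd hvσ
      · intro x y hx hy hxy
        obtain ⟨d, hd, hxy⟩ := (hhull _).mp hxy
        obtain ⟨a, ha, x', hx', rfl⟩ := hdec x hx
        obtain ⟨b, hb, y', hy', rfl⟩ := hdec y hy
        -- If the coefficient is positive, `v` lies in the hull of the other generators, against
        -- irredundancy. Otherwise `-x'` is in the cone, so `x' = 0` by pointedness and `x` is a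
        -- multiple of `v`.
        have hsum : x' + y' = (d - a - b) • v := by
          rw [sub_smul, sub_smul, ← hxy]; abel
        rcases lt_or_ge 0 (d - a - b) with h | h
        · refine absurd ?_ (hirr v hv)
          have := PointedCone.smul_mem _ (inv_nonneg.mpr h.le) (add_mem hx' hy')
          rwa [hsum, smul_smul, inv_mul_cancel₀ h.ne', one_smul] at this
        · have hx0 : x' = 0 := by
            refine hpointed x' (hle hx') ?_
            have : -x' = y' + (-(d - a - b)) • v := by
              rw [neg_smul, ← hsum]; abel
            rw [this]
            exact add_mem (hle hy') (PointedCone.smul_mem _ (by linarith) hvσ)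
          rw [hhull, hx0]
          exact ⟨a, ha, by simp⟩
    rw [hvρ, LinearMap.smul_apply, toRat_apply, smul_eq_mul]
    exact mul_nonneg hc.le (by exact_mod_cast hm ρ hray)
  intro w hw
  rw [← hs] at hw
  induction hw using Submodule.span_induction with
  | mem v hv => exact hvnonneg v hv
  | zero => simp
  | add x y _ _ hx hy => exact add_nonneg hx hy
  | smul c x _ hx => exact mul_nonneg c.2 hx

end Cones

/-! ### Elements of `SL₂` -/

section SL2

variable {K : Type*} [Field K]

theorem sl2_ext {g h : SpecialLinearGroup (Fin 2) K} (h00 : g.1 0 0 = h.1 0 0)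
    (h01 : g.1 0 1 = h.1 0 1) (h10 : g.1 1 0 = h.1 1 0) (h11 : g.1 1 1 = h.1 1 1) : g = h := by
  apply Subtype.ext
  ext i j
  fin_cases i <;> fin_cases j <;> assumption

theorem det_eq (g : SpecialLinearGroup (Fin 2) K) :
    g.1 0 0 * g.1 1 1 - g.1 0 1 * g.1 1 0 = 1 := by
  rw [← Matrix.det_fin_two]; exact g.2

theorem val_mul (g h : SpecialLinearGroup (Fin 2) K) : (g * h).1 = g.1 * h.1 := rfl

theorem mul_val_apply (g h : SpecialLinearGroup (Fin 2) K) (i j : Fin 2) :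
    (g * h).1 i j = g.1 i 0 * h.1 0 j + g.1 i 1 * h.1 1 j := by
  rw [val_mul, Matrix.mul_apply, Fin.sum_univ_two]

theorem val_inv (g : SpecialLinearGroup (Fin 2) K) :
    (g⁻¹).1 = !![g.1 1 1, -g.1 0 1; -g.1 1 0, g.1 0 0] := by
  have := Matrix.SpecialLinearGroup.coe_inv g
  rw [Matrix.adjugate_fin_two] at this
  exact this

@[simp] theorem upper_val (s : K) : (upper s).1 = !![1, s; 0, 1] := rfl

@[simp] theorem lower_val (s : K) : (lower s).1 = !![1, 0; s, 1] := rfl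

@[simp] theorem diag_val (t : Kˣ) : (diag t).1 = !![(t : K), 0; 0, ((t⁻¹ : Kˣ) : K)] := rfl

theorem upper_add (s t : K) : upper (s + t) = upper s * upper t := by
  apply sl2_ext <;> simp [mul_val_apply, add_comm]

theorem lower_add (s t : K) : lower (s + t) = lower s * lower t := by
  apply sl2_ext <;> simp [mul_val_apply]

@[simp] theorem upper_zero : upper (0 : K) = 1 := by
  apply sl2_ext <;> simp

@[simp] theorem lower_zero : lower (0 : K) = 1 := by
  apply sl2_ext <;> simp

theorem diag_mul (s t : Kˣ) : diag (s * t) = diag s * diag t := by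
  apply sl2_ext <;> simp [mul_val_apply, mul_comm]

theorem diag_one : diag (1 : Kˣ) = 1 := by
  apply sl2_ext <;> simp

theorem upper_neg (s : K) : upper (-s) = (upper s)⁻¹ :=
  eq_inv_of_mul_eq_one_left (by rw [← upper_add, neg_add_cancel, upper_zero])

theorem lower_neg (s : K) : lower (-s) = (lower s)⁻¹ :=
  eq_inv_of_mul_eq_one_left (by rw [← lower_add, neg_add_cancel, lower_zero])

theorem diag_inv (t : Kˣ) : diag t⁻¹ = (diag t)⁻¹ :=
  eq_inv_of_mul_eq_one_left (by rw [← diag_mul, inv_mul_cancel, diag_one])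

/-- The torus of `SL₂` in terms of `U₊` and `U₋`. -/
theorem diag_eq (t : Kˣ) : diag t =
    upper (t : K) * lower (-((t⁻¹ : Kˣ) : K)) * upper (t : K) *
      (upper (-1) * lower 1 * upper (-1)) := by
  apply sl2_ext <;> simp [mul_val_apply]

/-- `U₊` and `U₋` generate `SL₂`. -/
theorem mem_of_upper_lower {H : Subgroup (SpecialLinearGroup (Fin 2) K)}
    (hu : ∀ s, upper s ∈ H) (hl : ∀ s, lower s ∈ H) (g : SpecialLinearGroup (Fin 2) K) :
    g ∈ H := by
  have key : ∀ g : SpecialLinearGroup (Fin 2) K, g.1 1 0 ≠ 0 → g ∈ H := by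
    intro g hc
    -- Gauss elimination with a nonzero lower left entry. If that entry is zero, left multiplication
    -- by `lower 1` puts the nonzero entry `g 0 0` there.
    have : g = upper ((g.1 0 0 - 1) / g.1 1 0) * lower (g.1 1 0) *
        upper ((g.1 1 1 - 1) / g.1 1 0) := by
      have hd := det_eq g
      apply sl2_ext <;> simp [mul_val_apply]
      · field_simp; ring
      · field_simp; linear_combination -hd
      · field_simp; ring
    rw [this]
    exact H.mul_mem (H.mul_mem (hu _) (hl _)) (hu _)
  by_cases hc : g.1 1 0 = 0
  · have h1 : (lower 1 * g).1 1 0 ≠ 0 := by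
      have hd := det_eq g
      simp only [mul_val_apply, lower_val, hc]
      simp only [Matrix.of_apply, Matrix.cons_val', Matrix.cons_val_zero, Matrix.cons_val_one,
        one_mul, mul_zero, add_zero]
      rintro h
      rw [hc, h] at hd
      simp at hd
    have := H.mul_mem (H.inv_mem (hl 1)) (key _ h1)
    rwa [inv_mul_cancel_left] at this
  · exact key g hc

theorem hom_ext_upper_lower {G : Type*} [Group G] {f f' : SpecialLinearGroup (Fin 2) K →* G}
    (hu : ∀ s, f (upper s) = f' (upper s)) (hl : ∀ s, f (lower s) = f' (lower s)) : f = f' :=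
  MonoidHom.ext fun g => mem_of_upper_lower (H := MonoidHom.eqLocus f f') hu hl g

/-- Serves both for the centre of `SL₂` and for the kernel of an action, where commutation with just
these two elements is what the differential provides. -/
theorem eq_one_or_neg_one_of_commute {g : SpecialLinearGroup (Fin 2) K}
    (hu : g * upper 1 = upper 1 * g) (hl : g * lower 1 = lower 1 * g) :
    g = 1 ∨ g = -1 := by
  have e1 : (g * upper 1).1 0 0 = (upper 1 * g).1 0 0 := by rw [hu]
  have e2 : (g * upper 1).1 0 1 = (upper 1 * g).1 0 1 := by rw [hu]
  have e3 : (g * lower 1).1 0 0 = (lower 1 * g).1 0 0 := by rw [hl]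
  have hd := det_eq g
  simp [mul_val_apply] at e1 e2 e3
  rw [e1, e3] at hd
  have h11 : g.1 0 0 = g.1 1 1 := add_left_cancel ((add_comm _ _).trans e2)
  rw [h11] at hd
  have : (g.1 1 1 - 1) * (g.1 1 1 + 1) = 0 := by linear_combination hd
  rcases mul_eq_zero.mp this with h | h
  · left
    have h' : g.1 1 1 = 1 := sub_eq_zero.mp h
    apply sl2_ext <;> simp [e1, e3, h11, h']
  · right
    have h' : g.1 1 1 = -1 := eq_neg_of_add_eq_zero_left h
    apply sl2_ext <;> simp [e1, e3, h11, h']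

theorem neg_one_mem_center :
    (-1 : SpecialLinearGroup (Fin 2) K) ∈ Subgroup.center (SpecialLinearGroup (Fin 2) K) :=
  Subgroup.mem_center_iff.mpr fun g => by rw [mul_neg, neg_mul, mul_one, one_mul]

theorem mem_center_iff {g : SpecialLinearGroup (Fin 2) K} :
    g ∈ Subgroup.center (SpecialLinearGroup (Fin 2) K) ↔ g = 1 ∨ g = -1 := by
  constructor
  · intro h
    rw [Subgroup.mem_center_iff] at h
    exact eq_one_or_neg_one_of_commute (h _).symm (h _).symm
  · rintro (rfl | rfl)
    · exact one_mem _
    · exact neg_one_mem_center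

theorem neg_one_eq_diag : (-1 : SpecialLinearGroup (Fin 2) K) = diag (-1) := by
  apply sl2_ext <;> simp

/-- Every nonzero vector is the first column of an element of `SL₂`. -/
theorem exists_first_column {a c : K} (h : a ≠ 0 ∨ c ≠ 0) :
    ∃ g : SpecialLinearGroup (Fin 2) K, g.1 0 0 = a ∧ g.1 1 0 = c := by
  rcases eq_or_ne a 0 with rfl | ha
  · have hc : c ≠ 0 := by simpa using h
    exact ⟨⟨!![0, -c⁻¹; c, 0], by simp [Matrix.det_fin_two, hc]⟩, by simp, by simp⟩
  · exact ⟨⟨!![a, 0; c, a⁻¹], by simp [Matrix.det_fin_two, ha]⟩, by simp, by simp⟩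

/-- An element of `SL₂` is conjugate to a regular element of the torus, or its square is
conjugate to an element of `U₊`. -/
theorem exists_conj_diag_or_upper [IsAlgClosed K] (g : SpecialLinearGroup (Fin 2) K) :
    ∃ h : SpecialLinearGroup (Fin 2) K,
      (∃ t : Kˣ, (t : K) ^ 2 ≠ 1 ∧ g = h * diag t * h⁻¹) ∨
      ∃ x : K, g * g = h * upper x * h⁻¹ := by
  obtain ⟨l, hl⟩ := Module.End.exists_eigenvalue (Matrix.toLin' g.1)
  obtain ⟨v, hv⟩ := hl.exists_hasEigenvector
  have hv0 := hv.2
  have hgv : g.1 *ᵥ v = l • v := by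
    have := hv.apply_eq_smul
    rwa [Matrix.toLin'_apply] at this
  have hv' : v 0 ≠ 0 ∨ v 1 ≠ 0 := by
    by_contra hcon
    push Not at hcon
    apply hv0
    ext i
    fin_cases i
    · exact hcon.1
    · exact hcon.2
  obtain ⟨h, h0, h1⟩ := exists_first_column hv'
  set m := h⁻¹ * g * h with hm
  have hg : g = h * m * h⁻¹ := by rw [hm]; group
  have e0 := congrFun hgv 0
  have e1 := congrFun hgv 1
  simp only [Matrix.mulVec, dotProduct, Fin.sum_univ_two, Pi.smul_apply, smul_eq_mul] at e0 e1
  rw [← h0, ← h1] at e0 e1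
  have hdh := det_eq h
  have m00 : m.1 0 0 = l := by
    simp only [hm, mul_val_apply, val_inv]
    simp only [Matrix.of_apply, Matrix.cons_val', Matrix.cons_val_zero, Matrix.cons_val_one]
    linear_combination h.1 1 1 * e0 - h.1 0 1 * e1 + l * hdh
  have m10 : m.1 1 0 = 0 := by
    simp only [hm, mul_val_apply, val_inv]
    simp only [Matrix.of_apply, Matrix.cons_val', Matrix.cons_val_zero, Matrix.cons_val_one]
    linear_combination -h.1 1 0 * e0 + h.1 0 0 * e1
  have hdm := det_eq m
  rw [m00, m10, mul_zero, sub_zero] at hdm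
  have hl0 : l ≠ 0 := left_ne_zero_of_mul_eq_one hdm
  have m11 : m.1 1 1 = l⁻¹ := eq_inv_of_mul_eq_one_right hdm
  -- Here the diagonal of `m` is `1, 1` or `-1, -1`; squaring removes the sign, which is why the
  -- unipotent alternative speaks of `g * g`.
  by_cases hl2 : l ^ 2 = 1
  · refine ⟨h, Or.inr ⟨2 * l * m.1 0 1, ?_⟩⟩
    have hli : l⁻¹ = l := inv_eq_of_mul_eq_one_right (by rw [← sq]; exact hl2)
    have : m * m = upper (2 * l * m.1 0 1) := by
      apply sl2_ext <;> simp [mul_val_apply, m00, m10, m11, hli]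
      · rw [← sq]; exact hl2
      · ring
      · rw [← sq]; exact hl2
    rw [← this, hg]; group
  · have hd : l⁻¹ - l ≠ 0 := by
      intro hcon
      apply hl2
      have : l⁻¹ = l := sub_eq_zero.mp hcon
      rw [sq]; nth_rw 1 [← this]; exact inv_mul_cancel₀ hl0
    -- The parameter is the solution of the linear equation that clears the upper right entry of `m`
    -- by conjugation; it needs `l ≠ l⁻¹`.
    refine ⟨h * upper (m.1 0 1 / (l⁻¹ - l)), Or.inl ⟨Units.mk0 l hl0, hl2, ?_⟩⟩
    have : m * upper (m.1 0 1 / (l⁻¹ - l)) =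
        upper (m.1 0 1 / (l⁻¹ - l)) * diag (Units.mk0 l hl0) := by
      apply sl2_ext <;> simp [mul_val_apply, m00, m10, m11]
      rw [div_mul_eq_mul_div, mul_div_assoc', div_add' _ _ _ hd]
      congr 1
      ring
    rw [hg, eq_mul_inv_iff_mul_eq]
    simp only [mul_assoc, inv_mul_cancel_left, this]

/-! ### Nilpotent matrices -/

/-- The nilpotent elements of `𝔰𝔩₂`. -/
def IsNilp (X : Matrix (Fin 2) (Fin 2) K) : Prop :=
  X 1 1 = -X 0 0 ∧ X 0 0 * X 0 0 + X 0 1 * X 1 0 = 0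

/-- The unipotent one-parameter group of a nilpotent matrix. -/
def unip {X : Matrix (Fin 2) (Fin 2) K} (hX : IsNilp X) (s : K) :
    SpecialLinearGroup (Fin 2) K :=
  ⟨1 + s • X, by
    rw [Matrix.det_fin_two]
    simp [hX.1]
    linear_combination -s ^ 2 * hX.2⟩

theorem unip_val {X : Matrix (Fin 2) (Fin 2) K} (hX : IsNilp X) (s : K) :
    (unip hX s).1 = 1 + s • X := rfl

theorem IsNilp.mul_self {X : Matrix (Fin 2) (Fin 2) K} (hX : IsNilp X) : X * X = 0 := by
  ext i j
  rw [Matrix.mul_apply, Fin.sum_univ_two]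
  have h1 := hX.1
  have h2 := hX.2
  fin_cases i <;> fin_cases j <;> simp [h1]
  · exact h2
  · ring
  · ring
  · linear_combination h2

theorem unip_add {X : Matrix (Fin 2) (Fin 2) K} (hX : IsNilp X) (s t : K) :
    unip hX (s + t) = unip hX s * unip hX t := by
  apply Subtype.ext
  rw [val_mul, unip_val, unip_val, unip_val, add_mul, mul_add, mul_add, one_mul, one_mul, mul_one,
    smul_mul_smul_comm, hX.mul_self, smul_zero, add_zero, add_smul]
  abel

theorem unip_zero {X : Matrix (Fin 2) (Fin 2) K} (hX : IsNilp X) : unip hX 0 = 1 := by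
  apply Subtype.ext
  rw [unip_val, zero_smul, add_zero]
  rfl

theorem unip_neg {X : Matrix (Fin 2) (Fin 2) K} (hX : IsNilp X) (s : K) :
    unip hX (-s) = (unip hX s)⁻¹ :=
  eq_inv_of_mul_eq_one_left (by rw [← unip_add, neg_add_cancel, unip_zero])

/-- The nilpotent matrix `(0 1; 0 0)`. -/
def nilE : Matrix (Fin 2) (Fin 2) K := !![0, 1; 0, 0]

/-- The nilpotent matrix `(0 0; 1 0)`. -/
def nilF : Matrix (Fin 2) (Fin 2) K := !![0, 0; 1, 0]

/-- The nilpotent matrix `(1 -1; 1 -1)`. -/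
def nilG : Matrix (Fin 2) (Fin 2) K := !![1, -1; 1, -1]

theorem isNilp_nilE : IsNilp (nilE : Matrix (Fin 2) (Fin 2) K) := by simp [IsNilp, nilE]

theorem isNilp_nilF : IsNilp (nilF : Matrix (Fin 2) (Fin 2) K) := by simp [IsNilp, nilF]

theorem isNilp_nilG : IsNilp (nilG : Matrix (Fin 2) (Fin 2) K) := by simp [IsNilp, nilG]

theorem unip_nilE (s : K) : unip isNilp_nilE s = upper s := by
  apply sl2_ext <;> simp [unip_val, nilE]

theorem unip_nilF (s : K) : unip isNilp_nilF s = lower s := by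
  apply sl2_ext <;> simp [unip_val, nilF]

/-- Expanded so that claims about conjugates become polynomial identities in the entries of `g`. -/
theorem conj_apply (g : SpecialLinearGroup (Fin 2) K) (X : Matrix (Fin 2) (Fin 2) K) :
    g.1 * X * (g⁻¹).1 = !![
      (g.1 0 0 * X 0 0 + g.1 0 1 * X 1 0) * g.1 1 1 -
        (g.1 0 0 * X 0 1 + g.1 0 1 * X 1 1) * g.1 1 0,
      -(g.1 0 0 * X 0 0 + g.1 0 1 * X 1 0) * g.1 0 1 +
        (g.1 0 0 * X 0 1 + g.1 0 1 * X 1 1) * g.1 0 0;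
      (g.1 1 0 * X 0 0 + g.1 1 1 * X 1 0) * g.1 1 1 -
        (g.1 1 0 * X 0 1 + g.1 1 1 * X 1 1) * g.1 1 0,
      -(g.1 1 0 * X 0 0 + g.1 1 1 * X 1 0) * g.1 0 1 +
        (g.1 1 0 * X 0 1 + g.1 1 1 * X 1 1) * g.1 0 0] := by
  rw [val_inv]
  ext i j
  fin_cases i <;> fin_cases j <;> simp [Matrix.mul_apply, Fin.sum_univ_two] <;> ring

theorem IsNilp.conj {X : Matrix (Fin 2) (Fin 2) K} (hX : IsNilp X)
    (g : SpecialLinearGroup (Fin 2) K) : IsNilp (g.1 * X * (g⁻¹).1) := by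
  rw [conj_apply]
  obtain ⟨h1, h2⟩ := hX
  refine ⟨?_, ?_⟩
  · simp [h1]
    ring
  · simp [h1]
    linear_combination (g.1 0 0 * g.1 1 1 - g.1 0 1 * g.1 1 0) ^ 2 * h2

theorem unip_conj {X : Matrix (Fin 2) (Fin 2) K} (hX : IsNilp X)
    (g : SpecialLinearGroup (Fin 2) K) (s : K) :
    unip (hX.conj g) s = g * unip hX s * g⁻¹ := by
  apply Subtype.ext
  have : g.1 * (g⁻¹).1 = 1 := by rw [← val_mul, mul_inv_cancel]; rfl
  rw [val_mul, val_mul, unip_val, unip_val, mul_add, add_mul, mul_one, this, Matrix.mul_smul,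
    Matrix.smul_mul]

/-- Over an algebraically closed field the nonzero nilpotent matrices are conjugate. -/
theorem IsNilp.exists_conj [IsAlgClosed K] {X : Matrix (Fin 2) (Fin 2) K} (hX : IsNilp X)
    (hX0 : X ≠ 0) : ∃ g : SpecialLinearGroup (Fin 2) K, X = g.1 * nilE * (g⁻¹).1 := by
  obtain ⟨h1, h2⟩ := hX
  -- If `g` has first column `(a, c)`, then `g * nilE * g⁻¹ = (-ac, a²; -c², ac)`. So square roots
  -- of `X 0 1` and `-X 1 0` are needed, with signs matched to `X 0 0 = -ac`.
  obtain ⟨a, ha⟩ := IsAlgClosed.exists_eq_mul_self (X 0 1)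
  obtain ⟨c, hc, hac⟩ : ∃ c, -X 1 0 = c * c ∧ X 0 0 = -(a * c) := by
    obtain ⟨c, hc⟩ := IsAlgClosed.exists_eq_mul_self (-X 1 0)
    have : (X 0 0 - a * c) * (X 0 0 + a * c) = 0 := by
      linear_combination h2 - X 1 0 * ha + a * a * hc
    rcases mul_eq_zero.mp this with h | h
    · exact ⟨-c, by rw [hc]; ring, by linear_combination h⟩
    · exact ⟨c, hc, by linear_combination h⟩
  have hne : a ≠ 0 ∨ c ≠ 0 := by
    by_contra hcon
    push Not at hcon
    obtain ⟨rfl, rfl⟩ := hcon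
    apply hX0
    ext i j
    fin_cases i <;> fin_cases j <;> simp
    · simpa using hac
    · simpa using ha
    · simpa using hc
    · rw [h1, hac]; simp
  obtain ⟨g, g0, g1⟩ := exists_first_column hne
  refine ⟨g, ?_⟩
  rw [conj_apply]
  ext i j
  fin_cases i <;> fin_cases j <;> simp [nilE, g0, g1]
  · rw [hac]
  · exact ha
  · rw [← hc]; ring
  · rw [h1, hac]; ring

end SL2

/-! ### Regular maps on `SL₂` -/

section Regular

variable (K : Type*) [Field K]

/-- The regular functions on `SL₂`. -/
def regularFunctions : Subalgebra K (SpecialLinearGroup (Fin 2) K → K) :=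
  Algebra.adjoin K (Set.range fun ij : Fin 2 × Fin 2 => fun g => g.1 ij.1 ij.2)

/-- The regular maps from `SL₂` to a vector space. -/
def regularMaps (V : Type*) [AddCommGroup V] [Module K V] :
    Submodule K (SpecialLinearGroup (Fin 2) K → V) :=
  Submodule.span K {f | ∃ c ∈ regularFunctions K, ∃ v : V, f = fun g => c g • v}

variable {K}

theorem entry_mem_regularFunctions (i j : Fin 2) :
    (fun g : SpecialLinearGroup (Fin 2) K => g.1 i j) ∈ regularFunctions K :=
  Algebra.subset_adjoin ⟨(i, j), rfl⟩

variable {V W : Type*} [AddCommGroup V] [Module K V] [AddCommGroup W] [Module K W]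

theorem smul_mem_regularMaps {c : SpecialLinearGroup (Fin 2) K → K}
    (hc : c ∈ regularFunctions K) (v : V) : (fun g => c g • v) ∈ regularMaps K V :=
  Submodule.subset_span ⟨c, hc, v, rfl⟩

theorem const_mem_regularMaps (v : V) : (fun _ => v) ∈ regularMaps K V := by
  have := smul_mem_regularMaps (one_mem (regularFunctions K)) v
  simpa using this

theorem add_mem_regularMaps {f f' : SpecialLinearGroup (Fin 2) K → V}
    (hf : f ∈ regularMaps K V) (hf' : f' ∈ regularMaps K V) :
    (fun g => f g + f' g) ∈ regularMaps K V := add_mem hf hf'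

theorem const_smul_mem_regularMaps {f : SpecialLinearGroup (Fin 2) K → V}
    (hf : f ∈ regularMaps K V) (c : K) : (fun g => c • f g) ∈ regularMaps K V :=
  Submodule.smul_mem _ c hf

theorem map_mem_regularMaps {f : SpecialLinearGroup (Fin 2) K → V} (hf : f ∈ regularMaps K V)
    (L : V →ₗ[K] W) : (fun g => L (f g)) ∈ regularMaps K W := by
  induction hf using Submodule.span_induction with
  | mem f hf =>
    obtain ⟨c, hc, v, rfl⟩ := hf
    simpa using smul_mem_regularMaps hc (L v)
  | zero => simpa using const_mem_regularMaps (K := K) (0 : W)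
  | add f f' _ _ hf hf' => simpa using add_mem_regularMaps hf hf'
  | smul c f _ hf => simpa using const_smul_mem_regularMaps hf c

theorem smul_regular_mem_regularMaps {f : SpecialLinearGroup (Fin 2) K → V}
    (hf : f ∈ regularMaps K V) {c : SpecialLinearGroup (Fin 2) K → K}
    (hc : c ∈ regularFunctions K) : (fun g => c g • f g) ∈ regularMaps K V := by
  induction hf using Submodule.span_induction with
  | mem f hf =>
    obtain ⟨c', hc', v, rfl⟩ := hf
    simpa [smul_smul] using smul_mem_regularMaps (mul_mem hc hc') v
  | zero => simpa using const_mem_regularMaps (K := K) (0 : V)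
  | add f f' _ _ hf hf' => simpa using add_mem_regularMaps hf hf'
  | smul c' f _ hf =>
    have := Submodule.smul_mem _ c' hf
    simp only [Pi.smul_apply, smul_comm _ c']
    exact this

theorem mul_mem_regularMaps {A : Type*} [CommRing A] [Algebra K A]
    {f f' : SpecialLinearGroup (Fin 2) K → A} (hf : f ∈ regularMaps K A)
    (hf' : f' ∈ regularMaps K A) : (fun g => f g * f' g) ∈ regularMaps K A := by
  induction hf using Submodule.span_induction with
  | mem f hf =>
    obtain ⟨c, hc, v, rfl⟩ := hf
    have := smul_regular_mem_regularMaps (map_mem_regularMaps hf' (LinearMap.mulLeft K v)) hc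
    simpa using this
  | zero => simpa using const_mem_regularMaps (K := K) (0 : A)
  | add f f' _ _ hf hf' => simpa [add_mul] using add_mem_regularMaps hf hf'
  | smul c f _ hf => simpa using const_smul_mem_regularMaps hf c

theorem pow_mem_regularMaps {A : Type*} [CommRing A] [Algebra K A]
    {f : SpecialLinearGroup (Fin 2) K → A} (hf : f ∈ regularMaps K A) (n : ℕ) :
    (fun g => f g ^ n) ∈ regularMaps K A := by
  induction n with
  | zero => simpa using const_mem_regularMaps (1 : A)
  | succ n ih => simpa [pow_succ] using mul_mem_regularMaps ih hf

theorem conj_mem_regularFunctions {c : SpecialLinearGroup (Fin 2) K → K}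
    (hc : c ∈ regularFunctions K) (h : SpecialLinearGroup (Fin 2) K) :
    (fun g => c (h * g * h⁻¹)) ∈ regularFunctions K := by
  induction hc using Algebra.adjoin_induction with
  | mem f hf =>
    obtain ⟨⟨i, j⟩, rfl⟩ := hf
    have e : (fun g : SpecialLinearGroup (Fin 2) K => (h * g * h⁻¹).1 i j) =
        ∑ k, ∑ l, (h.1 i k * (h⁻¹).1 l j) •
          (fun g : SpecialLinearGroup (Fin 2) K => g.1 k l) := by
      ext g
      simp only [mul_val_apply, Fin.sum_univ_two, Pi.add_apply, Pi.smul_apply, smul_eq_mul]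
      ring
    simp only [e]
    exact sum_mem fun k _ => sum_mem fun l _ =>
      Subalgebra.smul_mem _ (entry_mem_regularFunctions k l) _
  | algebraMap r => exact Subalgebra.algebraMap_mem _ r
  | add f f' _ _ hf hf' => exact add_mem hf hf'
  | mul f f' _ _ hf hf' => exact mul_mem hf hf'

theorem conj_mem_regularMaps {f : SpecialLinearGroup (Fin 2) K → V} (hf : f ∈ regularMaps K V)
    (h : SpecialLinearGroup (Fin 2) K) : (fun g => f (h * g * h⁻¹)) ∈ regularMaps K V := by
  induction hf using Submodule.span_induction with
  | mem f hf =>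
    obtain ⟨c, hc, v, rfl⟩ := hf
    exact smul_mem_regularMaps (conj_mem_regularFunctions hc h) v
  | zero => exact zero_mem (regularMaps K V)
  | add f f' _ _ hf hf' => exact add_mem hf hf'
  | smul c f _ hf => exact Submodule.smul_mem _ c hf

/-- Regular maps to an algebra are given by polynomials in the entries. -/
theorem mem_regularMaps_iff {A : Type*} [CommRing A] [Algebra K A]
    {f : SpecialLinearGroup (Fin 2) K → A} :
    f ∈ regularMaps K A ↔ ∃ P : MvPolynomial (Fin 2 × Fin 2) A,
      ∀ g, f g = MvPolynomial.eval (fun ij => algebraMap K A (g.1 ij.1 ij.2)) P := by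
  constructor
  · intro hf
    induction hf using Submodule.span_induction with
    | mem f hf =>
      obtain ⟨c, hc, v, rfl⟩ := hf
      rw [regularFunctions, Algebra.adjoin_range_eq_range_aeval] at hc
      obtain ⟨p, rfl⟩ := hc
      refine ⟨MvPolynomial.map (algebraMap K A) p * MvPolynomial.C v, fun g => ?_⟩
      rw [map_mul, MvPolynomial.eval_C]
      refine (Algebra.smul_def _ _).trans ?_
      congr 1
      rw [MvPolynomial.eval_map]
      induction p using MvPolynomial.induction_on with
      | C a => simp
      | add p q hp hq =>
        rw [MvPolynomial.eval₂_add, ← hp, ← hq, ← map_add]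
        simp
      | mul_X p i hp =>
        rw [MvPolynomial.eval₂_mul, ← hp, MvPolynomial.eval₂_X, ← map_mul]
        simp
    | zero => exact ⟨0, fun g => by simp⟩
    | add f f' _ _ hf hf' =>
      obtain ⟨P, hP⟩ := hf
      obtain ⟨P', hP'⟩ := hf'
      exact ⟨P + P', fun g => by simp [hP, hP']⟩
    | smul c f _ hf =>
      obtain ⟨P, hP⟩ := hf
      exact ⟨MvPolynomial.C (algebraMap K A c) * P, fun g => by
        simp [hP, Algebra.smul_def]⟩
  · rintro ⟨P, hP⟩
    obtain rfl : f = fun g => MvPolynomial.eval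
      (fun ij => algebraMap K A (g.1 ij.1 ij.2)) P := funext hP
    clear hP
    induction P using MvPolynomial.induction_on with
    | C a => simpa using const_mem_regularMaps a
    | add p q hp hq => simpa using add_mem_regularMaps hp hq
    | mul_X p i hp =>
      simp only [map_mul, MvPolynomial.eval_X]
      refine mul_mem_regularMaps hp ?_
      have := smul_mem_regularMaps (entry_mem_regularFunctions (K := K) i.1 i.2) (1 : A)
      simpa only [Algebra.smul_def, mul_one] using this

/-- Composition of an action with an inner automorphism of `SL₂`. -/
def SL2Action.conj {A : Type*} [CommRing A] [Algebra K A] (φ : SL2Action K A)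
    (h : SpecialLinearGroup (Fin 2) K) : SL2Action K A where
  toHom := φ.toHom.comp (MulAut.conj h).toMonoidHom
  rational := fun a =>
    mem_regularMaps_iff.mp (conj_mem_regularMaps (mem_regularMaps_iff.mpr (φ.rational a)) h)

theorem SL2Action.conj_toHom {A : Type*} [CommRing A] [Algebra K A] (φ : SL2Action K A)
    (h g : SpecialLinearGroup (Fin 2) K) : (φ.conj h).toHom g = φ.toHom (h * g * h⁻¹) := rfl

end Regular

/-! ### Polynomial curves and their first order jets -/

section Jets

variable {K : Type*} [Field K] {A B : Type*} [CommRing A] [Algebra K A] [CommRing B] [Algebra K B]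

/-- The coefficientwise application of a linear map to a polynomial. -/
noncomputable def coeffMap (L : A →ₗ[K] B) : Polynomial A →ₗ[K] Polynomial B :=
  Polynomial.lsum fun n => ((Polynomial.monomial n).restrictScalars K) ∘ₗ L

theorem coeffMap_monomial (L : A →ₗ[K] B) (n : ℕ) (a : A) :
    coeffMap L (Polynomial.monomial n a) = Polynomial.monomial n (L a) := by
  simp [coeffMap, Polynomial.lsum_apply, Polynomial.sum_monomial_index]

theorem coeff_coeffMap (L : A →ₗ[K] B) (P : Polynomial A) (n : ℕ) :
    (coeffMap L P).coeff n = L (P.coeff n) := by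
  induction P using Polynomial.induction_on' with
  | add p q hp hq => simp [hp, hq]
  | monomial k a =>
    rw [coeffMap_monomial, Polynomial.coeff_monomial, Polynomial.coeff_monomial]
    split_ifs <;> simp

theorem eval_coeffMap (L : A →ₗ[K] B) (P : Polynomial A) (s : K) :
    (coeffMap L P).eval (algebraMap K B s) = L (P.eval (algebraMap K A s)) := by
  induction P using Polynomial.induction_on' with
  | add p q hp hq => simp [hp, hq]
  | monomial k a =>
    rw [coeffMap_monomial, Polynomial.eval_monomial, Polynomial.eval_monomial, ← map_pow,
      ← map_pow, mul_comm, ← Algebra.smul_def, mul_comm, ← Algebra.smul_def, map_smul]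

/-- A polynomial with coefficients in an algebra is determined by its values at the natural
numbers. -/
theorem polynomial_eq_of_eval_nat [CharZero K] {P Q : Polynomial A}
    (h : ∀ n : ℕ, P.eval (algebraMap K A n) = Q.eval (algebraMap K A n)) : P = Q := by
  rw [← sub_eq_zero]
  ext n
  -- The algebra need not be a domain, so counting roots is done over `K`, after applying a linear
  -- functional to the coefficients.
  rw [Polynomial.coeff_zero, ← Module.forall_dual_apply_eq_zero_iff K]
  intro l
  have : coeffMap l (P - Q) = 0 := by
    apply Polynomial.eq_zero_of_infinite_isRoot
    refine Set.Infinite.mono ?_ (Set.infinite_range_of_injective (Nat.cast_injective (R := K)))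
    rintro _ ⟨n, rfl⟩
    have := eval_coeffMap l (P - Q) (n : K)
    rw [Algebra.algebraMap_self, RingHom.id_apply] at this
    rw [Set.mem_ofPred_eq, Polynomial.IsRoot, this, Polynomial.eval_sub, h, sub_self, map_zero]
  rw [← coeff_coeffMap, this, Polynomial.coeff_zero]

/-- `f : K → A` is a polynomial curve with constant term `v₀` and linear term `v₁`. -/
def HasJet (f : K → A) (v₀ v₁ : A) : Prop :=
  ∃ P : Polynomial A, (∀ s, f s = P.eval (algebraMap K A s)) ∧ P.coeff 0 = v₀ ∧ P.coeff 1 = v₁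

/-- Agreement at natural numbers is enough, so one-parameter groups can be compared through the
powers of a single element of each. -/
theorem HasJet.unique [CharZero K] {f f' : K → A} {v₀ v₁ w₀ w₁ : A} (h : HasJet f v₀ v₁)
    (h' : HasJet f' w₀ w₁) (hff' : ∀ n : ℕ, f n = f' n) : v₁ = w₁ := by
  obtain ⟨P, hP, -, rfl⟩ := h
  obtain ⟨Q, hQ, -, rfl⟩ := h'
  rw [polynomial_eq_of_eval_nat (K := K) (P := P) (Q := Q) fun n => by rw [← hP, ← hQ, hff']]

theorem HasJet.apply_zero {f : K → A} {v₀ v₁ : A} (h : HasJet f v₀ v₁) : f 0 = v₀ := by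
  obtain ⟨P, hP, rfl, -⟩ := h
  rw [hP, map_zero, Polynomial.coeff_zero_eq_eval_zero]

theorem HasJet.congr {f f' : K → A} {v₀ v₁ : A} (h : HasJet f v₀ v₁) (hff' : ∀ s, f' s = f s) :
    HasJet f' v₀ v₁ := by
  obtain rfl : f' = f := funext hff'
  exact h

theorem HasJet.map {f : K → A} {v₀ v₁ : A} (h : HasJet f v₀ v₁) (L : A →ₗ[K] B) :
    HasJet (fun s => L (f s)) (L v₀) (L v₁) := by
  obtain ⟨P, hP, rfl, rfl⟩ := h
  exact ⟨coeffMap L P, fun s => by simp only [hP, eval_coeffMap], coeff_coeffMap _ _ _,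
    coeff_coeffMap _ _ _⟩

theorem HasJet.add {f f' : K → A} {v₀ v₁ w₀ w₁ : A} (h : HasJet f v₀ v₁)
    (h' : HasJet f' w₀ w₁) : HasJet (fun s => f s + f' s) (v₀ + w₀) (v₁ + w₁) := by
  obtain ⟨P, hP, rfl, rfl⟩ := h
  obtain ⟨Q, hQ, rfl, rfl⟩ := h'
  exact ⟨P + Q, fun s => by simp only [hP, hQ, Polynomial.eval_add], by simp, by simp⟩

theorem HasJet.mul {f f' : K → A} {v₀ v₁ w₀ w₁ : A} (h : HasJet f v₀ v₁)
    (h' : HasJet f' w₀ w₁) : HasJet (fun s => f s * f' s) (v₀ * w₀) (v₀ * w₁ + v₁ * w₀) := by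
  obtain ⟨P, hP, rfl, rfl⟩ := h
  obtain ⟨Q, hQ, rfl, rfl⟩ := h'
  refine ⟨P * Q, fun s => by simp only [hP, hQ, Polynomial.eval_mul], Polynomial.mul_coeff_zero _ _,
    Polynomial.mul_coeff_one _ _⟩

theorem hasJet_affine (v₀ v₁ : A) : HasJet (fun s : K => v₀ + s • v₁) v₀ v₁ :=
  ⟨Polynomial.C v₀ + Polynomial.X * Polynomial.C v₁, fun s => by
      change v₀ + s • v₁ = _; rw [Algebra.smul_def, mul_comm]; simp,
    by simp, by simp [Polynomial.coeff_C]⟩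

theorem hasJet_const (v : A) : HasJet (fun _ : K => v) v 0 :=
  (hasJet_affine v 0).congr (by simp)

theorem HasJet.smul_id {f : K → A} {v₀ v₁ : A} (h : HasJet f v₀ v₁) :
    HasJet (fun s => s • f s) 0 v₀ := by
  have := (hasJet_affine (K := K) (0 : A) 1).mul h
  simp only [zero_mul, zero_add, one_mul] at this
  exact this.congr fun s => by simp

theorem HasJet.comp_mul {f : K → A} {v₀ v₁ : A} (h : HasJet f v₀ v₁) (c : K) :
    HasJet (fun s => f (c * s)) v₀ (c • v₁) := by
  obtain ⟨P, hP, rfl, rfl⟩ := h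
  refine ⟨P.comp (Polynomial.C (algebraMap K A c) * Polynomial.X), fun s => ?_, ?_, ?_⟩
  · simp only [hP, Polynomial.eval_comp]; simp
  · simp [Polynomial.comp_C_mul_X_coeff]
  · rw [Polynomial.comp_C_mul_X_coeff, pow_one, mul_comm, Algebra.smul_def]

theorem isInfinitesimalGenerator_iff {γ : K → (A ≃ₐ[K] A)} {D : A →ₗ[K] A} :
    IsInfinitesimalGenerator γ D ↔ ∀ a, HasJet (fun s => γ s a) (γ 0 a) (D a) := by
  refine forall_congr' fun a => ?_
  have key : ∀ P : Polynomial A, P.derivative.eval 0 = P.coeff 1 := fun P => by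
    rw [← Polynomial.coeff_zero_eq_eval_zero, Polynomial.coeff_derivative]; simp
  constructor
  · rintro ⟨P, hP, hD⟩
    refine ⟨P, hP, ?_, ?_⟩
    · rw [hP, map_zero, Polynomial.coeff_zero_eq_eval_zero]
    · rw [hD, key]
  · rintro ⟨P, hP, -, hD⟩
    exact ⟨P, hP, by rw [key, hD]⟩

theorem exists_generator [CharZero K] {γ : K → (A ≃ₐ[K] A)}
    (h : ∀ a, ∃ v₀ v₁, HasJet (fun s => γ s a) v₀ v₁) :
    ∃ D : A →ₗ[K] A, IsInfinitesimalGenerator γ D := by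
  choose v₀ v₁ h using h
  refine ⟨{ toFun := v₁, map_add' := fun a b => ?_, map_smul' := fun c a => ?_ }, ?_⟩
  · exact (h (a + b)).unique ((h a).add (h b)) fun n => by simp
  · exact (h (c • a)).unique ((h a).map (LinearMap.lsmul K A c)) fun n => map_smul (γ n) c a
  · rw [isInfinitesimalGenerator_iff]
    intro a
    have : γ 0 a = v₀ a := (h a).apply_zero
    rw [this]
    exact h a

theorem IsInfinitesimalGenerator.unique [CharZero K] {γ γ' : K → (A ≃ₐ[K] A)}
    {D D' : A →ₗ[K] A} (h : IsInfinitesimalGenerator γ D) (h' : IsInfinitesimalGenerator γ' D')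
    (hγ : ∀ n : ℕ, γ n = γ' n) : D = D' := by
  ext a
  exact (isInfinitesimalGenerator_iff.mp h a).unique (isInfinitesimalGenerator_iff.mp h' a)
    fun n => by rw [hγ]

theorem IsInfinitesimalGenerator.leibniz [CharZero K] {γ : K → (A ≃ₐ[K] A)}
    {D : A →ₗ[K] A} (h : IsInfinitesimalGenerator γ D) (h0 : γ 0 = 1) (a b : A) :
    D (a * b) = a * D b + D a * b := by
  rw [isInfinitesimalGenerator_iff] at h
  simp only [h0, AlgEquiv.one_apply] at h
  exact (h (a * b)).unique ((h a).mul (h b)) fun n => by rw [map_mul]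

/-- The conjugate of a family of automorphisms is generated by the conjugate derivation. -/
theorem IsInfinitesimalGenerator.conj {γ : K → (A ≃ₐ[K] A)} {D : A →ₗ[K] A}
    (h : IsInfinitesimalGenerator γ D) (u : A ≃ₐ[K] A) :
    IsInfinitesimalGenerator (fun s => u * γ s * u⁻¹)
      (u.toLinearMap ∘ₗ D ∘ₗ (u⁻¹).toLinearMap) := by
  rw [isInfinitesimalGenerator_iff] at h ⊢
  exact fun a => (h (u⁻¹ a)).map u.toLinearMap

theorem IsInfinitesimalGenerator.comp_mul {γ : K → (A ≃ₐ[K] A)} {D : A →ₗ[K] A}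
    (h : IsInfinitesimalGenerator γ D) (c : K) :
    IsInfinitesimalGenerator (fun s => γ (c * s)) (c • D) := by
  rw [isInfinitesimalGenerator_iff] at h ⊢
  intro a
  have := (h a).comp_mul c
  simpa using this

/-- The Taylor coefficients of a one-parameter group. -/
theorem factorial_smul_coeff_eq [CharZero K] {γ : K → (A ≃ₐ[K] A)}
    (hadd : ∀ s t, γ (s + t) = γ s * γ t) {D : A →ₗ[K] A} (hD : IsInfinitesimalGenerator γ D)
    {a : A} {P : Polynomial A} (hP : ∀ s, γ s a = P.eval (algebraMap K A s)) (n : ℕ) :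
    (n.factorial) • P.coeff n = (D ^ n) a := by
  have h0 : γ 0 = 1 := by
    have := hadd 0 0
    rw [add_zero] at this
    exact left_eq_mul.mp this
  rw [isInfinitesimalGenerator_iff] at hD
  -- The linear term in `t` of `γ (t + s) a` is `γ s (D a)` by the group law and `P'(s)` by Taylor
  -- expansion. Iterating and setting `s = 0` gives the Taylor coefficients.
  have hstep : ∀ (a : A) (P : Polynomial A), (∀ s, γ s a = P.eval (algebraMap K A s)) →
      ∀ s, γ s (D a) = P.derivative.eval (algebraMap K A s) := by
    intro a P hP s
    have h1 := (hD a).map (γ s).toLinearMap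
    have h2 : HasJet (fun t => γ (t + s) a)
        ((P.comp (Polynomial.X + Polynomial.C (algebraMap K A s))).coeff 0)
        ((P.comp (Polynomial.X + Polynomial.C (algebraMap K A s))).coeff 1) :=
      ⟨_, fun t => by simp only [hP, Polynomial.eval_comp]; simp, rfl, rfl⟩
    have h3 := h1.unique h2 fun n => by
      rw [add_comm, hadd]; rfl
    rw [← Polynomial.taylor_apply, Polynomial.taylor_coeff_one] at h3
    exact h3
  have hiter : ∀ n : ℕ, ∀ s, γ s ((D ^ n) a) =
      (Polynomial.derivative^[n] P).eval (algebraMap K A s) := by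
    intro n
    induction n with
    | zero => simpa using hP
    | succ n ih =>
      rw [pow_succ', Function.iterate_succ_apply']
      exact hstep _ _ ih
  have h1 := hiter n 0
  rw [h0, map_zero, ← Polynomial.coeff_zero_eq_eval_zero,
    Polynomial.coeff_iterate_derivative] at h1
  simp only [zero_add, Nat.descFactorial_self] at h1
  exact h1.symm

/-- Local nilpotency of the generator: up to factorials, the iterates are the coefficients of a
polynomial, which vanish beyond its degree. -/
theorem iterate_generator_eventually_zero [CharZero K] {γ : K → (A ≃ₐ[K] A)}
    (hadd : ∀ s t, γ (s + t) = γ s * γ t) {D : A →ₗ[K] A} (hD : IsInfinitesimalGenerator γ D)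
    (a : A) : ∃ n, (D ^ n) a = 0 := by
  obtain ⟨P, hP, -⟩ := hD a
  refine ⟨P.natDegree + 1, ?_⟩
  rw [← factorial_smul_coeff_eq hadd hD hP,
    Polynomial.coeff_eq_zero_of_natDegree_lt (Nat.lt_succ_self _), smul_zero]

/-- One-parameter groups with the same generator are equal. -/
theorem eq_of_generator_eq [CharZero K] {γ γ' : K → (A ≃ₐ[K] A)}
    (hadd : ∀ s t, γ (s + t) = γ s * γ t) (hadd' : ∀ s t, γ' (s + t) = γ' s * γ' t)
    {D : A →ₗ[K] A} (hD : IsInfinitesimalGenerator γ D) (hD' : IsInfinitesimalGenerator γ' D)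
    (s : K) : γ s = γ' s := by
  ext1 a
  obtain ⟨P, hP, -⟩ := hD a
  obtain ⟨P', hP', -⟩ := hD' a
  rw [hP, hP']
  congr 1
  ext n
  have h1 := factorial_smul_coeff_eq hadd hD hP n
  have h2 := factorial_smul_coeff_eq hadd' hD' hP' n
  rw [← h2] at h1
  have hn : (n.factorial : K) ≠ 0 := by exact_mod_cast n.factorial_ne_zero
  rw [← Nat.cast_smul_eq_nsmul K, ← Nat.cast_smul_eq_nsmul K] at h1
  exact smul_right_injective A hn h1

end Jets

/-! ### The differential of a regular action of `SL₂` -/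

section Differential

variable {K : Type*} [Field K] {A : Type*} [CommRing A] [Algebra K A]

/-- The line `1 + s • X` is taken in the space of all matrices, where the first-order term at the
identity is linear in `X`. This is the source of the linearity of the differential, although
nilpotent matrices do not form a linear space. -/
theorem exists_linear_jet (P : MvPolynomial (Fin 2 × Fin 2) A) :
    ∃ d : Matrix (Fin 2) (Fin 2) K →ₗ[K] A, ∀ X : Matrix (Fin 2) (Fin 2) K,
      HasJet (fun s : K => MvPolynomial.eval
        (fun ij => algebraMap K A ((1 + s • X) ij.1 ij.2)) P)
        (MvPolynomial.eval (fun ij => algebraMap K A ((1 : Matrix (Fin 2) (Fin 2) K) ij.1 ij.2)) P)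
        (d X) := by
  induction P using MvPolynomial.induction_on with
  | C a =>
    refine ⟨0, fun X => ?_⟩
    simpa using hasJet_const a
  | add p q hp hq =>
    obtain ⟨d, hd⟩ := hp
    obtain ⟨d', hd'⟩ := hq
    refine ⟨d + d', fun X => ?_⟩
    simpa using (hd X).add (hd' X)
  | mul_X p ij hp =>
    obtain ⟨d, hd⟩ := hp
    obtain ⟨i, j⟩ := ij
    let c : A := MvPolynomial.eval
      (fun ij => algebraMap K A ((1 : Matrix (Fin 2) (Fin 2) K) ij.1 ij.2)) p
    let l : Matrix (Fin 2) (Fin 2) K →ₗ[K] A :=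
      LinearMap.mulLeft K c ∘ₗ Algebra.linearMap K A ∘ₗ Matrix.entryLinearMap K K i j
    let l' : Matrix (Fin 2) (Fin 2) K →ₗ[K] A :=
      LinearMap.mulRight K (algebraMap K A ((1 : Matrix (Fin 2) (Fin 2) K) i j)) ∘ₗ d
    refine ⟨l + l', fun X => ?_⟩
    have := (hd X).mul (hasJet_affine (K := K)
      (algebraMap K A ((1 : Matrix (Fin 2) (Fin 2) K) i j)) (algebraMap K A (X i j)))
    simp only [map_mul, MvPolynomial.eval_X]
    refine this.congr fun s => ?_
    rw [Matrix.add_apply, Matrix.smul_apply, map_add, smul_eq_mul, map_mul,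
      Algebra.smul_def s (algebraMap K A (X i j))]

namespace SL2Action

variable (φ : SL2Action K A)

theorem toHom_unip_add {X : Matrix (Fin 2) (Fin 2) K} (hX : IsNilp X) (s t : K) :
    φ.toHom (unip hX (s + t)) = φ.toHom (unip hX s) * φ.toHom (unip hX t) := by
  rw [unip_add, map_mul]

theorem exists_unip_jet (a : A) : ∃ d : Matrix (Fin 2) (Fin 2) K →ₗ[K] A,
    ∀ {X : Matrix (Fin 2) (Fin 2) K} (hX : IsNilp X),
      HasJet (fun s => φ.toHom (unip hX s) a) a (d X) := by
  obtain ⟨P, hP⟩ := φ.rational a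
  obtain ⟨d, hd⟩ := exists_linear_jet (K := K) P
  refine ⟨d, fun {X} hX => ?_⟩
  have h1 : a = MvPolynomial.eval
      (fun ij => algebraMap K A ((1 : Matrix (Fin 2) (Fin 2) K) ij.1 ij.2)) P := by
    have := hP 1
    rw [map_one] at this
    exact this
  have h2 := (hd X).congr (f' := fun s => φ.toHom (unip hX s) a) fun s => hP _
  rwa [← h1] at h2

theorem exists_unip_generator [CharZero K] {X : Matrix (Fin 2) (Fin 2) K} (hX : IsNilp X) :
    ∃ D : A →ₗ[K] A, IsInfinitesimalGenerator (fun s => φ.toHom (unip hX s)) D := by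
  refine exists_generator fun a => ?_
  obtain ⟨d, hd⟩ := φ.exists_unip_jet a
  exact ⟨_, _, hd hX⟩

/-- The differential `𝔰𝔩₂ → Der(A)` of a regular action, extended to all matrices by ignoring the
lower right entry. -/
noncomputable def differential [CharZero K] : Matrix (Fin 2) (Fin 2) K →ₗ[K] (A →ₗ[K] A) :=
  (Matrix.entryLinearMap K K 0 1).smulRight (φ.exists_unip_generator isNilp_nilE).choose +
  (Matrix.entryLinearMap K K 1 0).smulRight (φ.exists_unip_generator isNilp_nilF).choose +
  (Matrix.entryLinearMap K K 0 0).smulRight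
    ((φ.exists_unip_generator isNilp_nilG).choose + (φ.exists_unip_generator isNilp_nilE).choose
      - (φ.exists_unip_generator isNilp_nilF).choose)

/-- For fixed `a`, the first-order term of the action and `differential` are both linear in `X` and
agree on three nilpotent matrices spanning `𝔰𝔩₂`. -/
theorem isInfinitesimalGenerator_differential [CharZero K] {X : Matrix (Fin 2) (Fin 2) K} (hX : IsNilp X) :
    IsInfinitesimalGenerator (fun s => φ.toHom (unip hX s)) (φ.differential X) := by
  rw [isInfinitesimalGenerator_iff]
  intro a
  obtain ⟨d, hd⟩ := φ.exists_unip_jet a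
  have key : ∀ {Y : Matrix (Fin 2) (Fin 2) K} (hY : IsNilp Y),
      (φ.exists_unip_generator hY).choose a = d Y := fun {Y} hY =>
    (isInfinitesimalGenerator_iff.mp (φ.exists_unip_generator hY).choose_spec a).unique (hd hY)
      fun n => rfl
  have h1 : φ.differential X a = d X := by
    -- The matrix `diag(1, -1)` is `nilG + nilE - nilF`, so three nilpotent matrices span the
    -- traceless ones.
    have hXd : X = X 0 1 • nilE + X 1 0 • nilF + X 0 0 • (nilG + nilE - nilF) := by
      ext i j
      have := hX.1
      fin_cases i <;> fin_cases j <;> simp [nilE, nilF, nilG, this]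
    conv_rhs => rw [hXd]
    simp [differential, key]
  rw [h1, unip_zero, map_one]
  exact hd hX

theorem isInfinitesimalGenerator_upper [CharZero K] :
    IsInfinitesimalGenerator (fun s => φ.toHom (upper s)) (φ.differential nilE) := by
  simpa only [unip_nilE] using φ.isInfinitesimalGenerator_differential isNilp_nilE

theorem isInfinitesimalGenerator_lower [CharZero K] :
    IsInfinitesimalGenerator (fun s => φ.toHom (lower s)) (φ.differential nilF) := by
  simpa only [unip_nilF] using φ.isInfinitesimalGenerator_differential isNilp_nilF

theorem toHom_upper_add (s t : K) :
    φ.toHom (upper (s + t)) = φ.toHom (upper s) * φ.toHom (upper t) := by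
  rw [upper_add, map_mul]

theorem toHom_lower_add (s t : K) :
    φ.toHom (lower (s + t)) = φ.toHom (lower s) * φ.toHom (lower t) := by
  rw [lower_add, map_mul]

/-- A linear identity on `𝔰𝔩₂` may be checked on nilpotent matrices. -/
theorem linear_ext_nilp {V : Type*} [AddCommGroup V] [Module K V]
    {f f' : Matrix (Fin 2) (Fin 2) K →ₗ[K] V} (h : ∀ X, IsNilp X → f X = f' X)
    {X : Matrix (Fin 2) (Fin 2) K} (hX : X 1 1 = -X 0 0) : f X = f' X := by
  have hXd : X = X 0 1 • nilE + X 1 0 • nilF + X 0 0 • (nilG + nilE - nilF) := by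
    ext i j
    fin_cases i <;> fin_cases j <;> simp [nilE, nilF, nilG, hX]
  rw [hXd]
  simp [h _ isNilp_nilE, h _ isNilp_nilF, h _ isNilp_nilG]

theorem differential_conj [CharZero K] (g : SpecialLinearGroup (Fin 2) K) {X : Matrix (Fin 2) (Fin 2) K}
    (hX : X 1 1 = -X 0 0) :
    (φ.toHom g).toLinearMap ∘ₗ φ.differential X ∘ₗ ((φ.toHom g)⁻¹).toLinearMap =
      φ.differential (g.1 * X * (g⁻¹).1) := by
  let f : Matrix (Fin 2) (Fin 2) K →ₗ[K] (A →ₗ[K] A) :=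
    { toFun := fun X => (φ.toHom g).toLinearMap ∘ₗ φ.differential X ∘ₗ
        ((φ.toHom g)⁻¹).toLinearMap
      map_add' := fun X Y => by ext; simp
      map_smul' := fun c X => by ext; simp }
  let f' : Matrix (Fin 2) (Fin 2) K →ₗ[K] (A →ₗ[K] A) := φ.differential ∘ₗ
    LinearMap.mulRight K (g⁻¹).1 ∘ₗ LinearMap.mulLeft K g.1
  refine linear_ext_nilp (f := f) (f' := f') (fun X hX => ?_) hX
  refine ((φ.isInfinitesimalGenerator_differential hX).conj (φ.toHom g)).unique
    (φ.isInfinitesimalGenerator_differential (hX.conj g)) fun n => ?_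
  rw [unip_conj, map_mul, map_mul, map_inv]

theorem differential_conj_apply [CharZero K] (g : SpecialLinearGroup (Fin 2) K)
    {X : Matrix (Fin 2) (Fin 2) K} (hX : X 1 1 = -X 0 0) (a : A) :
    φ.toHom g (φ.differential X a) = φ.differential (g.1 * X * (g⁻¹).1) (φ.toHom g a) := by
  rw [← φ.differential_conj g hX]
  have : (φ.toHom g)⁻¹ (φ.toHom g a) = a := (φ.toHom g).symm_apply_apply a
  simp only [LinearMap.comp_apply, AlgEquiv.toLinearMap_apply, this]

/-- The differential is a homomorphism of Lie algebras. -/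
theorem differential_bracket [CharZero K] {X Y : Matrix (Fin 2) (Fin 2) K} (hX : X 1 1 = -X 0 0)
    (hY : Y 1 1 = -Y 0 0) :
    φ.differential X ∘ₗ φ.differential Y - φ.differential Y ∘ₗ φ.differential X =
      φ.differential (X * Y - Y * X) := by
  let f : Matrix (Fin 2) (Fin 2) K →ₗ[K] (A →ₗ[K] A) :=
    { toFun := fun X => φ.differential X ∘ₗ φ.differential Y - φ.differential Y ∘ₗ φ.differential X
      map_add' := fun X X' => by ext; simp; abel
      map_smul' := fun c X => by ext; simp [smul_sub] }
  let f' : Matrix (Fin 2) (Fin 2) K →ₗ[K] (A →ₗ[K] A) := φ.differential ∘ₗ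
    (LinearMap.mulRight K Y - LinearMap.mulLeft K Y)
  refine linear_ext_nilp (f := f) (f' := f') (fun X hX => ?_) hX
  ext a
  have hgen := isInfinitesimalGenerator_iff.mp (φ.isInfinitesimalGenerator_differential hX)
  simp only [unip_zero, map_one, AlgEquiv.one_apply] at hgen
  have h1 := hgen (φ.differential Y a)
  -- Because `X * X = 0`, conjugating `Y` by `1 + sX` gives exactly `Y + s(XY - YX) - s²XYX`. Hence
  -- the linear term of `γ s (D_Y a)` is `D_Y D_X a + D_{[X,Y]} a`, and it also equals `D_X D_Y a`.
  have h2 := (((hgen a).map (φ.differential Y)).add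
    ((hgen a).map (φ.differential (X * Y - Y * X))).smul_id).add
    ((hgen a).map (φ.differential (-(X * Y * X)))).smul_id.smul_id
  have h3 := h1.unique h2 fun n => by
    have hM : (unip hX (n : K)).1 * Y * ((unip hX (n : K))⁻¹).1 =
        Y + (n : K) • (X * Y - Y * X) + (n : K) • (n : K) • (-(X * Y * X)) := by
      rw [← unip_neg, unip_val, unip_val]
      simp only [smul_sub, smul_neg, neg_smul, mul_add, add_mul, one_mul, mul_one, mul_neg,
        Matrix.mul_smul, Matrix.smul_mul]
      abel
    rw [φ.differential_conj_apply _ hY, hM]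
    simp only [map_add, map_smul, LinearMap.add_apply, LinearMap.smul_apply]
  change φ.differential X (φ.differential Y a) - φ.differential Y (φ.differential X a) =
    φ.differential (X * Y - Y * X) a
  rw [h3]
  simp

end SL2Action

end Differential

/-! ### Conjugation of endomorphisms -/

section ConjEnd

variable {K : Type*} [Field K] {A : Type*} [CommRing A] [Algebra K A]

/-- Conjugation of linear endomorphisms by an automorphism. -/
def conjEnd (u : A ≃ₐ[K] A) : (A →ₗ[K] A) →ₗ[K] (A →ₗ[K] A) where
  toFun D := u.toLinearMap ∘ₗ D ∘ₗ (u⁻¹).toLinearMap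
  map_add' D D' := by ext; simp
  map_smul' c D := by ext; simp

theorem conjEnd_apply (u : A ≃ₐ[K] A) (D : A →ₗ[K] A) (a : A) :
    conjEnd u D a = u (D (u⁻¹ a)) := rfl

theorem conjEnd_mul (u v : A ≃ₐ[K] A) (D : A →ₗ[K] A) :
    conjEnd (u * v) D = conjEnd u (conjEnd v D) := by
  ext a
  simp only [conjEnd_apply, _root_.mul_inv_rev, AlgEquiv.mul_apply]

theorem conjEnd_one (D : A →ₗ[K] A) : conjEnd (1 : A ≃ₐ[K] A) D = D := rfl

theorem conjEnd_comp (u : A ≃ₐ[K] A) (D D' : A →ₗ[K] A) :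
    conjEnd u (D ∘ₗ D') = conjEnd u D ∘ₗ conjEnd u D' := by
  ext a
  simp only [conjEnd_apply, LinearMap.comp_apply]
  rw [show u⁻¹ (u (D' (u⁻¹ a))) = D' (u⁻¹ a) from u.symm_apply_apply _]

end ConjEnd

/-! ### Automorphisms whose powers are polynomial -/

section PolyPowers

variable {K : Type*} [Field K] {A : Type*} [CommRing A] [Algebra K A]

/-- The integral powers `ψⁿ` depend polynomially on `n`. -/
def PolyPowers (ψ : A ≃ₐ[K] A) : Prop :=
  ∀ a, ∃ P : Polynomial A, ∀ n : ℤ, (ψ ^ n) a = P.eval (algebraMap K A n)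

theorem PolyPowers.conj {ψ : A ≃ₐ[K] A} (h : PolyPowers ψ) (u : A ≃ₐ[K] A) :
    PolyPowers (u * ψ * u⁻¹) := by
  intro a
  obtain ⟨P, hP⟩ := h (u⁻¹ a)
  refine ⟨coeffMap u.toLinearMap P, fun n => ?_⟩
  rw [conj_zpow, eval_coeffMap, ← hP]
  rfl

theorem upper_zpow (s : K) (n : ℤ) : upper s ^ n = upper (n * s) := by
  let f : Multiplicative K →* SpecialLinearGroup (Fin 2) K :=
    { toFun := fun s => upper s.toAdd, map_one' := upper_zero, map_mul' := fun s t => upper_add _ _ }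
  have := map_zpow f (Multiplicative.ofAdd s) n
  rw [← ofAdd_zsmul, zsmul_eq_mul] at this
  exact this.symm

theorem diag_zpow (t : Kˣ) (n : ℤ) : diag t ^ n = diag (t ^ n) := by
  let f : Kˣ →* SpecialLinearGroup (Fin 2) K :=
    { toFun := diag, map_one' := diag_one, map_mul' := diag_mul }
  exact (map_zpow f t n).symm

theorem SL2Action.polyPowers_upper (φ : SL2Action K A) [CharZero K] (s : K) :
    PolyPowers (φ.toHom (upper s)) := by
  intro a
  obtain ⟨P, hP, -⟩ := (φ.isInfinitesimalGenerator_upper).comp_mul s a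
  refine ⟨P, fun n => ?_⟩
  rw [← map_zpow, upper_zpow, mul_comm]
  exact hP n

/-- A geometric sequence of ratio `μ ≠ 1` is polynomial only if it is zero: `q(n + 1) = μ q(n)`
contradicts the comparison of leading coefficients unless `q = 0`. -/
theorem eq_zero_of_pow_smul_eq_polynomial [CharZero K] {μ : K} (hμ : μ ≠ 1) {b : A}
    {Q : Polynomial A} (h : ∀ n : ℕ, μ ^ n • b = Q.eval (algebraMap K A n)) : b = 0 := by
  rw [← Module.forall_dual_apply_eq_zero_iff K]
  intro l
  have hq : ∀ n : ℕ, μ ^ n * l b = (coeffMap l Q).eval (n : K) := by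
    intro n
    have := eval_coeffMap l Q (n : K)
    rw [Algebra.algebraMap_self, RingHom.id_apply] at this
    rw [this, ← h, map_smul, smul_eq_mul]
  set q := coeffMap l Q
  have hcomp : q.comp (Polynomial.X + Polynomial.C 1) = Polynomial.C μ * q := by
    refine polynomial_eq_of_eval_nat (K := K) fun n => ?_
    rw [Algebra.algebraMap_self, RingHom.id_apply, Polynomial.eval_comp, Polynomial.eval_mul,
      Polynomial.eval_C, ← hq]
    have := hq (n + 1)
    simp only [Polynomial.eval_add, Polynomial.eval_X, Polynomial.eval_C]
    push_cast at this
    rw [← this]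
    ring
  have hlc := congrArg Polynomial.leadingCoeff hcomp
  rw [Polynomial.leadingCoeff_comp (by rw [Polynomial.natDegree_X_add_C]; exact one_ne_zero),
    Polynomial.leadingCoeff_mul, Polynomial.leadingCoeff_X_add_C, one_pow, mul_one,
    Polynomial.leadingCoeff_C] at hlc
  have : (1 - μ) * q.leadingCoeff = 0 := by linear_combination hlc
  have hq0 : q = 0 := Polynomial.leadingCoeff_eq_zero.mp
    ((mul_eq_zero.mp this).resolve_left (sub_ne_zero.mpr hμ.symm))
  have := hq 0
  simpa [hq0] using this

/-! ### Automorphisms normalizing the image normalize the Lie algebra. -/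

theorem diag_conj_nilE (t : Kˣ) :
    (diag t).1 * nilE * ((diag t)⁻¹).1 = ((t : K) ^ 2) • nilE := by
  rw [conj_apply]
  ext i j
  fin_cases i <;> fin_cases j <;> simp [nilE, sq]

theorem diag_conj_nilF (t : Kˣ) :
    (diag t).1 * nilF * ((diag t)⁻¹).1 = (((t⁻¹ : Kˣ) : K) ^ 2) • nilF := by
  rw [conj_apply]
  ext i j
  fin_cases i <;> fin_cases j <;> simp [nilF, sq]

theorem nilE_bracket (X : Matrix (Fin 2) (Fin 2) K) :
    nilE * X - X * nilE = !![X 1 0, X 1 1 - X 0 0; 0, -X 1 0] := by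
  ext i j
  rw [Matrix.sub_apply, Matrix.mul_apply, Matrix.mul_apply, Fin.sum_univ_two, Fin.sum_univ_two]
  fin_cases i <;> fin_cases j <;> simp [nilE]

theorem nilE_bracket_nilF :
    (nilE * nilF - nilF * nilE : Matrix (Fin 2) (Fin 2) K) = !![1, 0; 0, -1] := by
  rw [nilE_bracket]
  simp [nilF]

namespace SL2Action

variable (φ : SL2Action K A) [CharZero K]

theorem conjEnd_differential (g : SpecialLinearGroup (Fin 2) K) {X : Matrix (Fin 2) (Fin 2) K}
    (hX : X 1 1 = -X 0 0) :
    conjEnd (φ.toHom g) (φ.differential X) = φ.differential (g.1 * X * (g⁻¹).1) :=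
  φ.differential_conj g hX

/-- A regular torus element with polynomial powers acts trivially, and so does `U₊`. -/
theorem differential_nilE_eq_zero_of_diag {t : Kˣ} (ht : (t : K) ^ 2 ≠ 1)
    (h : PolyPowers (φ.toHom (diag t))) : φ.differential nilE = 0 := by
  ext a
  choose P hP using h
  set E := φ.differential nilE with hE
  have hconj : ∀ n : ℤ, (φ.toHom (diag t) ^ n) (E ((φ.toHom (diag t) ^ (-n)) a)) =
      (((t ^ n : Kˣ) : K) ^ 2) • E a := by
    intro n
    have h1 := φ.conjEnd_differential (diag (t ^ n)) (X := nilE) isNilp_nilE.1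
    rw [diag_conj_nilE, map_smul] at h1
    have h2 := congrArg (fun D => D a) h1
    simp only [conjEnd_apply, LinearMap.smul_apply] at h2
    rw [← diag_zpow, map_zpow, ← _root_.zpow_neg] at h2
    exact h2
  -- Conjugation by the `n`-th power scales `E` by `t^(2n)`. The same operator, applied to `a`, is
  -- polynomial in `n`: the negative power acting on `a` contributes `(-X)^k`, and the positive
  -- power is expanded on each `E (coeff k)`.
  refine eq_zero_of_pow_smul_eq_polynomial (μ := (t : K) ^ 2) ht
    (Q := ∑ k ∈ (P a).support, (-Polynomial.X) ^ k * P (E ((P a).coeff k))) fun n => ?_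
  have h1 := hconj n
  rw [hP a, Polynomial.eval_eq_sum, Polynomial.sum_def] at h1
  rw [Polynomial.eval_finsetSum]
  have h2 : ((t : K) ^ 2) ^ n = (((t ^ (n : ℤ) : Kˣ) : K) ^ 2) := by
    rw [zpow_natCast, Units.val_pow_eq_pow_val]; ring
  rw [h2, ← h1, map_sum, map_sum]
  refine Finset.sum_congr rfl fun k _ => ?_
  rw [← map_pow, mul_comm, ← Algebra.smul_def, map_smul, map_smul, hP, Polynomial.eval_mul,
    Polynomial.eval_pow, Polynomial.eval_neg, Polynomial.eval_X, Algebra.smul_def, map_pow]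
  simp

/-- An automorphism normalizing the image of an action moves the differential of `U₊` into the
Lie algebra. -/
theorem exists_conjEnd_differential_nilE [IsAlgClosed K] (u : A ≃ₐ[K] A)
    (hu : ∀ g, ∃ g', u * φ.toHom g * u⁻¹ = φ.toHom g') :
    ∃ X : Matrix (Fin 2) (Fin 2) K, X 1 1 = -X 0 0 ∧
      conjEnd u (φ.differential nilE) = φ.differential X := by
  -- The automorphism `φ g` inherits polynomial powers from `upper 1`. If `g` is conjugate to a
  -- regular torus element, this forces `U₊` to act trivially; otherwise `g * g` is conjugate into
  -- `U₊`.
  obtain ⟨g, hg⟩ := hu (upper 1)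
  obtain ⟨h, ⟨t, ht, hgt⟩ | ⟨x, hx⟩⟩ := exists_conj_diag_or_upper g
  · have h1 : PolyPowers (φ.toHom (diag t)) := by
      have h2 := ((φ.polyPowers_upper 1).conj u).conj (φ.toHom h)⁻¹
      rw [hg, hgt] at h2
      have e : (φ.toHom h)⁻¹ * φ.toHom (h * diag t * h⁻¹) * (φ.toHom h)⁻¹⁻¹ =
          φ.toHom (diag t) := by
        rw [map_mul, map_mul, map_inv]; group
      rwa [e] at h2
    refine ⟨0, by simp, ?_⟩
    rw [φ.differential_nilE_eq_zero_of_diag ht h1, map_zero, map_zero]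
  -- Since `g * g` corresponds to `upper 2`, the groups compared have parameters `2s` and `x s`;
  -- they agree at natural `s`, hence their generators agree, which accounts for the factor `x / 2`.
  · refine ⟨(x / 2) • (h.1 * nilE * (h⁻¹).1), ?_, ?_⟩
    · have := (isNilp_nilE (K := K)).conj h
      simp only [Matrix.smul_apply, smul_eq_mul]
      rw [this.1]; ring
    · have g1 := ((φ.isInfinitesimalGenerator_upper).comp_mul 2).conj u
      have g2 := ((φ.isInfinitesimalGenerator_upper).comp_mul x).conj (φ.toHom h)
      have h3 := g1.unique g2 fun n => by
        have e1 : φ.toHom (upper (2 * (n : K))) = φ.toHom (upper 1) ^ (2 * n) := by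
          rw [← map_pow]
          congr 1
          have := upper_zpow (1 : K) (2 * n : ℕ)
          rw [zpow_natCast] at this
          rw [this]; push_cast; rw [mul_one]
        have e2 : φ.toHom (upper (x * (n : K))) = φ.toHom (upper x) ^ n := by
          rw [← map_pow]
          congr 1
          have := upper_zpow x n
          rw [zpow_natCast] at this
          rw [this]; push_cast; rw [mul_comm]
        rw [e1, e2, ← conj_pow, ← conj_pow, hg, pow_mul, sq, ← map_mul, hx, map_mul, map_mul,
          map_inv]
      have h4 : (2 : K) • conjEnd u (φ.differential nilE) =
          x • φ.differential (h.1 * nilE * (h⁻¹).1) := by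
        rw [← φ.conjEnd_differential h isNilp_nilE.1,
          ← LinearMap.map_smul (conjEnd u), ← LinearMap.map_smul (conjEnd (φ.toHom h))]
        exact h3
      have h2 : (2 : K) ≠ 0 := two_ne_zero
      rw [map_smul, div_eq_inv_mul, mul_smul, ← h4, smul_smul, inv_mul_cancel₀ h2, one_smul]

/-- An automorphism normalizing the image of an action normalizes the Lie algebra. -/
theorem exists_conjEnd_differential [IsAlgClosed K] (u : A ≃ₐ[K] A)
    (hu : ∀ g, ∃ g', u * φ.toHom g * u⁻¹ = φ.toHom g') {Y : Matrix (Fin 2) (Fin 2) K}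
    (hY : Y 1 1 = -Y 0 0) :
    ∃ X : Matrix (Fin 2) (Fin 2) K, X 1 1 = -X 0 0 ∧
      conjEnd u (φ.differential Y) = φ.differential X := by
  obtain ⟨X₀, hX₀, hX₀'⟩ := φ.exists_conjEnd_differential_nilE u hu
  -- Nonzero nilpotent matrices are conjugate to `nilE` inside `SL₂`, and `u` carries `φ g` to some
  -- `φ g'`; so the case of `nilE` gives all nilpotent matrices, and these span `𝔰𝔩₂`.
  have hconj : ∀ g : SpecialLinearGroup (Fin 2) K, ∃ X : Matrix (Fin 2) (Fin 2) K,
      X 1 1 = -X 0 0 ∧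
      conjEnd u (φ.differential (g.1 * nilE * (g⁻¹).1)) = φ.differential X := by
    intro g
    obtain ⟨g', hg'⟩ := hu g
    refine ⟨g'.1 * X₀ * (g'⁻¹).1, ?_, ?_⟩
    · rw [conj_apply]
      simp [hX₀]
      ring
    · rw [← φ.conjEnd_differential g isNilp_nilE.1, ← φ.conjEnd_differential g' hX₀, ← hX₀',
        ← conjEnd_mul, ← conjEnd_mul, ← hg', inv_mul_cancel_right]
  have hnil : ∀ Y : Matrix (Fin 2) (Fin 2) K, IsNilp Y → ∃ X : Matrix (Fin 2) (Fin 2) K,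
      X 1 1 = -X 0 0 ∧ conjEnd u (φ.differential Y) = φ.differential X := by
    intro Y hY
    by_cases hY0 : Y = 0
    · exact ⟨0, by simp, by rw [hY0]; simp⟩
    · obtain ⟨g, rfl⟩ := hY.exists_conj hY0
      exact hconj g
  obtain ⟨X₁, h1, h1'⟩ := hnil _ isNilp_nilE
  obtain ⟨X₂, h2, h2'⟩ := hnil _ isNilp_nilF
  obtain ⟨X₃, h3, h3'⟩ := hnil _ isNilp_nilG
  have hYd : Y = Y 0 1 • nilE + Y 1 0 • nilF + Y 0 0 • (nilG + nilE - nilF) := by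
    ext i j
    fin_cases i <;> fin_cases j <;> simp [nilE, nilF, nilG, hY]
  refine ⟨Y 0 1 • X₁ + Y 1 0 • X₂ + Y 0 0 • (X₃ + X₁ - X₂), ?_, ?_⟩
  · simp [h1, h2, h3]; ring
  · conv_lhs => rw [hYd]
    simp only [map_add, map_sub, map_smul, h1', h2', h3']

/-- A Weyl element carries `nilE` to `-nilF`, so the generators of `U₊` and `U₋` vanish together,
and these groups generate `SL₂`. -/
theorem eq_one_of_differential_nilE_eq_zero (h : φ.differential nilE = 0)
    (g : SpecialLinearGroup (Fin 2) K) : φ.toHom g = 1 := by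
  have hF : φ.differential nilF = 0 := by
    let w : SpecialLinearGroup (Fin 2) K := ⟨!![0, 1; -1, 0], by simp [Matrix.det_fin_two]⟩
    have e : nilF = -(w.1 * nilE * (w⁻¹).1) := by
      rw [conj_apply]
      ext i j
      fin_cases i <;> fin_cases j <;> simp [nilE, nilF, w]
    rw [e, map_neg, ← φ.conjEnd_differential w isNilp_nilE.1, h, map_zero, neg_zero]
  have htriv : IsInfinitesimalGenerator (fun _ : K => (1 : A ≃ₐ[K] A)) 0 := by
    rw [isInfinitesimalGenerator_iff]
    exact fun a => hasJet_const a
  have hu := φ.isInfinitesimalGenerator_upper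
  have hl := φ.isInfinitesimalGenerator_lower
  rw [h] at hu
  rw [hF] at hl
  have : φ.toHom = 1 := hom_ext_upper_lower
    (fun s => eq_of_generator_eq φ.toHom_upper_add (fun _ _ => (mul_one _).symm) hu htriv s)
    (fun s => eq_of_generator_eq φ.toHom_lower_add (fun _ _ => (mul_one _).symm) hl htriv s)
  rw [this]; rfl

/-- Simplicity of `𝔰𝔩₂` by hand: the kernel is stable under bracketing with `nilE`, and two brackets
bring any matrix to a multiple of `nilE`, whose coefficient must vanish; the remaining entries
follow in turn. -/
theorem eq_zero_of_differential_eq_zero (hE : φ.differential nilE ≠ 0)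
    {X : Matrix (Fin 2) (Fin 2) K} (hX : X 1 1 = -X 0 0) (h : φ.differential X = 0) : X = 0 := by
  have hbr : ∀ Y : Matrix (Fin 2) (Fin 2) K, Y 1 1 = -Y 0 0 → φ.differential Y = 0 →
      φ.differential (nilE * Y - Y * nilE) = 0 := by
    intro Y hY h
    rw [← φ.differential_bracket isNilp_nilE.1 hY, h, LinearMap.comp_zero, LinearMap.zero_comp,
      sub_zero]
  have e1 : nilE * X - X * nilE = !![X 1 0, -(2 * X 0 0); 0, -X 1 0] := by
    rw [nilE_bracket, hX, show -X 0 0 - X 0 0 = -(2 * X 0 0) by ring]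
  have h1 := hbr X hX h
  rw [e1] at h1
  have h2 := hbr _ (by simp) h1
  have e2 : nilE * !![X 1 0, -(2 * X 0 0); 0, -X 1 0] - !![X 1 0, -(2 * X 0 0); 0, -X 1 0] * nilE =
      (-(2 * X 1 0)) • nilE := by
    rw [nilE_bracket]
    ext i j
    fin_cases i <;> fin_cases j <;> simp [nilE]
    ring
  rw [e2, map_smul, smul_eq_zero] at h2
  have h10 : X 1 0 = 0 := by simpa using h2.resolve_right hE
  have e3 : !![X 1 0, -(2 * X 0 0); 0, -X 1 0] = (-(2 * X 0 0)) • nilE := by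
    ext i j
    fin_cases i <;> fin_cases j <;> simp [nilE, h10]
  rw [e3, map_smul, smul_eq_zero] at h1
  have h00 : X 0 0 = 0 := by simpa using h1.resolve_right hE
  have e4 : X = X 0 1 • nilE := by
    ext i j
    fin_cases i <;> fin_cases j <;> simp [nilE, h10, h00, hX]
  rw [e4, map_smul, smul_eq_zero] at h
  rw [e4, h.resolve_right hE, zero_smul]

theorem differential_injective (hE : φ.differential nilE ≠ 0)
    {X Y : Matrix (Fin 2) (Fin 2) K} (hX : X 1 1 = -X 0 0) (hY : Y 1 1 = -Y 0 0)
    (h : φ.differential X = φ.differential Y) : X = Y := by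
  rw [← sub_eq_zero]
  refine φ.eq_zero_of_differential_eq_zero hE ?_ ?_
  · simp [hX, hY]; ring
  · rw [map_sub, h, sub_self]

end SL2Action

end PolyPowers

/-- A family of operators on a finite-dimensional space which is diagonal with respect to a
separating family of functionals is simultaneously diagonalizable. -/
theorem le_span_eigenvectors {K U ι τ : Type*} [Field K] [AddCommGroup U] [Module K U]
    (V : Submodule K U) [FiniteDimensional K V] (T : τ → U →ₗ[K] U)
    (hV : ∀ t, ∀ D ∈ V, T t D ∈ V) (l : ι → U →ₗ[K] K) (w : ι → τ → K)
    (hl : ∀ i t D, l i (T t D) = w i t * l i D) (hsep : ∀ D, (∀ i, l i D = 0) → D = 0) :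
    V ≤ Submodule.span K {D | D ∈ V ∧ ∃ i, ∀ t, T t D = w i t • D} := by
  classical
  let l' : ι → Module.Dual K V := fun i => l i ∘ₗ V.subtype
  have hspan : Submodule.span K (Set.range l') = ⊤ := by
    apply Submodule.span_eq_top_of_ne_zero
    intro D hD
    by_contra hcon
    push Not at hcon
    exact hD (Subtype.ext (hsep _ fun i => hcon _ ⟨i, rfl⟩))
  -- The dual space has a basis made of the given functionals restricted to `V`. These are
  -- eigenvectors of the transposed operators, so the basis of `V` dual to them consists of
  -- eigenvectors.
  let b := Module.Basis.ofSpan (le_of_eq hspan.symm)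
  have hb : ∀ j, ∃ i, l' i = b j := fun j =>
    Module.Basis.ofSpan_subset (le_of_eq hspan.symm) ⟨j, rfl⟩
  choose p hp using hb
  have : Finite _ := Module.Finite.finite_basis b
  let c : Module.Basis _ K V := b.dualBasis.map (Module.evalEquiv K V).symm
  have hc : ∀ i j, l' (p i) (c j) = if i = j then 1 else 0 := by
    intro i j
    have h1 : Module.evalEquiv K V (c j) = b.dualBasis j := by simp [c]
    have h2 := congrArg (fun f => f (b i)) h1
    simp only [Module.Basis.dualBasis_apply_self] at h2
    rw [hp]
    exact h2
  intro D hD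
  have hmem : (⟨D, hD⟩ : V) ∈ Submodule.span K (Set.range c) := by
    rw [c.span_eq]; exact Submodule.mem_top
  have := Submodule.mem_map_of_mem (f := V.subtype) hmem
  rw [Submodule.map_span] at this
  refine Submodule.span_mono ?_ this
  rintro _ ⟨_, ⟨j, rfl⟩, rfl⟩
  refine ⟨(c j).2, p j, fun t => ?_⟩
  have key : (⟨T t (c j), hV t _ (c j).2⟩ : V) - w (p j) t • c j = 0 := by
    refine (Module.forall_dual_apply_eq_zero_iff K _).mp fun f => ?_
    have hf : f ∈ Submodule.span K (Set.range b) := by rw [b.span_eq]; exact Submodule.mem_top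
    induction hf using Submodule.span_induction with
    | mem f hf =>
      obtain ⟨i, rfl⟩ := hf
      have h1 : l' (p i) ⟨T t (c j), hV t _ (c j).2⟩ = w (p i) t * l' (p i) (c j) := hl _ _ _
      rw [← hp i, map_sub, map_smul, h1, hc]
      split_ifs with hij
      · rw [hij]; simp
      · simp
    | zero => simp
    | add f g _ _ hf hg => rw [LinearMap.add_apply, hf, hg, add_zero]
    | smul r f _ hf => rw [LinearMap.smul_apply, hf, smul_zero]
  exact congrArg Subtype.val (sub_eq_zero.mp key)

/-! ### Weights of the torus -/

section Weights

variable {K : Type*} [Field K] {M : Type*} [AddCommGroup M] {σ : PointedCone ℚ (RatDual M)}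

/-- The value of a torus element at a character, as a scalar. -/
def Torus.val (t : Torus K M) (m : M) : K := ((t (Multiplicative.ofAdd m) : Kˣ) : K)

theorem Torus.val_add (t : Torus K M) (m m' : M) : t.val (m + m') = t.val m * t.val m' := by
  simp [Torus.val]

theorem Torus.val_zero (t : Torus K M) : t.val 0 = 1 := by
  simp [Torus.val]

theorem Torus.val_ne_zero (t : Torus K M) (m : M) : t.val m ≠ 0 := Units.ne_zero _

theorem Torus.val_neg (t : Torus K M) (m : M) : t.val (-m) = (t.val m)⁻¹ := by
  simp [Torus.val]

theorem Torus.inv_val (t : Torus K M) (m : M) : (t⁻¹ : Torus K M).val m = (t.val m)⁻¹ := by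
  simp [Torus.val]

/-- The torus element `m ↦ c ^ ν(m)`. -/
def cocharacter (ν : M →ₗ[ℤ] ℤ) (c : Kˣ) : Torus K M where
  toFun m := c ^ ν m.toAdd
  map_one' := by simp
  map_mul' a b := by simp [_root_.zpow_add]

theorem cocharacter_val (ν : M →ₗ[ℤ] ℤ) (c : Kˣ) (m : M) :
    (cocharacter ν c).val m = ((c ^ ν m : Kˣ) : K) := rfl

theorem exists_dual_ne_zero [Module.Free ℤ M] {a : M} (ha : a ≠ 0) : ∃ ν : M →ₗ[ℤ] ℤ, ν a ≠ 0 := by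
  by_contra hcon
  push Not at hcon
  exact ha ((Module.forall_dual_apply_eq_zero_iff ℤ a).mp hcon)

theorem eq_one_of_two_zpow [CharZero K] {n : ℤ} (h : (2 : K) ^ n = 1) : n = 0 := by
  have key : ∀ n : ℕ, (2 : K) ^ n = 1 → n = 0 := by
    intro n h
    have : (2 : ℕ) ^ n = 1 := by exact_mod_cast h
    exact (Nat.pow_eq_one.mp this).resolve_left (by norm_num)
  rcases Int.eq_nat_or_neg n with ⟨k, rfl | rfl⟩
  · rw [zpow_natCast] at h
    simp [key k h]
  · rw [_root_.zpow_neg, zpow_natCast, inv_eq_one] at h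
    simp [key k h]

/-- The characters of the torus are separated by its elements. -/
theorem exists_torus_val_ne_one [CharZero K] [Module.Free ℤ M] {a : M} (ha : a ≠ 0) :
    ∃ t : Torus K M, t.val a ≠ 1 := by
  obtain ⟨ν, hν⟩ := exists_dual_ne_zero ha
  refine ⟨cocharacter ν (Units.mk0 2 two_ne_zero), fun h => hν (eq_one_of_two_zpow (K := K) ?_)⟩
  rw [cocharacter_val] at h
  simpa using h

theorem eq_of_torus_val_eq [CharZero K] [Module.Free ℤ M] {a b : M}
    (h : ∀ t : Torus K M, t.val a = t.val b) : a = b := by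
  by_contra hab
  obtain ⟨t, ht⟩ := exists_torus_val_ne_one (K := K) (sub_ne_zero.mpr hab)
  apply ht
  rw [sub_eq_add_neg, t.val_add, h, ← t.val_add, add_neg_cancel, t.val_zero]

theorem torusAction_chi (t : Torus K M) (m : dualMonoid σ) :
    torusAction K σ t (chi K m) = t.val m • chi K m := torusHom_chi σ t m

/-- Linear maps on the coordinate ring are determined by the monomials. -/
theorem linearMap_ext_chi {V : Type*} [AddCommGroup V] [Module K V]
    {f f' : CoordRing K σ →ₗ[K] V} (h : ∀ m, f (chi K m) = f' (chi K m)) : f = f' := by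
  refine AddMonoidAlgebra.lhom_ext' fun m => ?_
  ext
  exact h m

theorem algEquiv_ext_chi {u v : CoordRing K σ ≃ₐ[K] CoordRing K σ}
    (h : ∀ m, u (chi K m) = v (chi K m)) : u = v := by
  have : u.toLinearMap = v.toLinearMap := linearMap_ext_chi h
  ext1 a
  exact congrArg (fun f => f a) this

/-- The coefficient at a monomial. -/
noncomputable def coeffAt (m : dualMonoid σ) : CoordRing K σ →ₗ[K] K :=
  Finsupp.lapply m ∘ₗ (AddMonoidAlgebra.coeffLinearEquiv K).toLinearMap

theorem coeffAt_apply (m : dualMonoid σ) (a : CoordRing K σ) : coeffAt m a = a.coeff m := rfl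

theorem coeffAt_chi_self (m : dualMonoid σ) : coeffAt m (chi K m) = 1 := by
  simp [coeffAt_apply, chi]

theorem coeffAt_chi_of_ne {m m' : dualMonoid σ} (h : m ≠ m') : coeffAt m' (chi K m) = 0 := by
  simp [coeffAt_apply, chi, Finsupp.single_eq_of_ne h.symm]

theorem chi_ne_zero (m : dualMonoid σ) : chi K m ≠ 0 := by
  intro h
  have := coeffAt_chi_self (K := K) m
  rw [h, map_zero] at this
  exact zero_ne_one this

theorem chi_add (m m' : dualMonoid σ) : chi K (m + m') = chi K m * chi K m' := by
  simp [chi, AddMonoidAlgebra.single_mul_single]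

theorem ext_coeffAt {a b : CoordRing K σ} (h : ∀ m, coeffAt m a = coeffAt m b) : a = b := by
  apply AddMonoidAlgebra.ext
  ext m
  exact h m

theorem coeffAt_torusAction (t : Torus K M) (m : dualMonoid σ) (a : CoordRing K σ) :
    coeffAt m (torusAction K σ t a) = t.val m * coeffAt m a := by
  have : coeffAt m ∘ₗ (torusAction K σ t).toLinearMap = t.val m • coeffAt m := by
    refine linearMap_ext_chi fun m' => ?_
    simp only [LinearMap.comp_apply, AlgEquiv.toLinearMap_apply, LinearMap.smul_apply]
    rw [torusAction_chi, map_smul]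
    by_cases h : m' = m
    · rw [h]
    · rw [coeffAt_chi_of_ne h, smul_zero, smul_zero]
  exact congrArg (fun f => f a) this

/-- A linear endomorphism which is homogeneous of degree `a`. -/
def HasWeight (D : CoordRing K σ →ₗ[K] CoordRing K σ) (a : M) : Prop :=
  ∀ t : Torus K M, conjEnd (torusAction K σ t) D = t.val a • D

theorem HasWeight.smul {D : CoordRing K σ →ₗ[K] CoordRing K σ} {a : M} (h : HasWeight D a)
    (c : K) : HasWeight (c • D) a := fun t => by rw [map_smul, h, smul_comm]

theorem HasWeight.of_smul {D : CoordRing K σ →ₗ[K] CoordRing K σ} {a : M} {c : K} (hc : c ≠ 0)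
    (h : HasWeight (c • D) a) : HasWeight D a := by
  have := h.smul c⁻¹
  rwa [smul_smul, inv_mul_cancel₀ hc, one_smul] at this

theorem HasWeight.unique [CharZero K] [Module.Free ℤ M]
    {D : CoordRing K σ →ₗ[K] CoordRing K σ} {a b : M} (hD : D ≠ 0) (ha : HasWeight D a)
    (hb : HasWeight D b) : a = b := by
  refine eq_of_torus_val_eq (K := K) fun t => ?_
  have := (ha t).symm.trans (hb t)
  exact smul_left_injective K hD this

theorem HasWeight.bracket {D D' : CoordRing K σ →ₗ[K] CoordRing K σ} {a b : M}
    (h : HasWeight D a) (h' : HasWeight D' b) : HasWeight (D ∘ₗ D' - D' ∘ₗ D) (a + b) := by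
  intro t
  rw [map_sub, conjEnd_comp, conjEnd_comp, h, h', t.val_add]
  refine LinearMap.ext fun x => ?_
  change t.val a • D (t.val b • D' x) - t.val b • D' (t.val a • D x) =
    (t.val a * t.val b) • (D (D' x) - D' (D x))
  rw [map_smul, map_smul, smul_smul, smul_smul, mul_comm (t.val b), smul_sub]

/-- The matrix coefficients are simultaneous eigenfunctionals for the conjugation action and
separate the operators, as `le_span_eigenvectors` requires. -/
theorem coeffAt_conjEnd_torusAction (t : Torus K M) (D : CoordRing K σ →ₗ[K] CoordRing K σ)
    (m m' : dualMonoid σ) : coeffAt m' (conjEnd (torusAction K σ t) D (chi K m)) =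
      t.val ((m' : M) - m) * coeffAt m' (D (chi K m)) := by
  rw [conjEnd_apply, ← map_inv, torusAction_chi, map_smul, map_smul, map_smul,
    coeffAt_torusAction, t.inv_val, sub_eq_add_neg, t.val_add, t.val_neg, smul_eq_mul]
  ring

/-- An endomorphism on which the torus acts by scalars is homogeneous. -/
theorem exists_hasWeight_of_forall {D : CoordRing K σ →ₗ[K] CoordRing K σ}
    (h : ∀ t : Torus K M, ∃ c : K, conjEnd (torusAction K σ t) D = c • D) :
    ∃ a, HasWeight D a := by
  by_cases hD : D = 0
  · exact ⟨0, fun t => by rw [hD, map_zero, smul_zero]⟩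
  · obtain ⟨m, m', hne⟩ : ∃ m m', coeffAt m' (D (chi K m)) ≠ 0 := by
      by_contra hcon
      push Not at hcon
      refine hD (linearMap_ext_chi fun m => ext_coeffAt fun m' => ?_)
      rw [hcon, LinearMap.zero_apply, map_zero]
    refine ⟨(m' : M) - m, fun t => ?_⟩
    obtain ⟨c, hc⟩ := h t
    have := coeffAt_conjEnd_torusAction t D m m'
    rw [hc, LinearMap.smul_apply, map_smul, smul_eq_mul] at this
    rw [hc, mul_right_cancel₀ hne this]

/-- A finite-dimensional space of endomorphisms which is stable under the torus is spanned by
homogeneous endomorphisms. -/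
theorem le_span_hasWeight (V : Submodule K (CoordRing K σ →ₗ[K] CoordRing K σ))
    (hfin : FiniteDimensional K V)
    (hV : ∀ (t : Torus K M), ∀ D ∈ V, conjEnd (torusAction K σ t) D ∈ V) :
    V ≤ Submodule.span K {D | D ∈ V ∧ ∃ a, HasWeight D a} := by
  refine (le_span_eigenvectors V (fun t : Torus K M => conjEnd (torusAction K σ t)) hV
    (fun p : dualMonoid σ × dualMonoid σ => coeffAt p.2 ∘ₗ LinearMap.applyₗ (chi K p.1))
    (fun p t => t.val ((p.2 : M) - p.1)) (fun p t D => ?_) (fun D hD => ?_)).trans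
    (Submodule.span_mono ?_)
  · exact coeffAt_conjEnd_torusAction t D p.1 p.2
  · refine linearMap_ext_chi fun m => ext_coeffAt fun m' => ?_
    rw [LinearMap.zero_apply, map_zero]
    exact hD (m, m')
  · rintro D ⟨hD, p, hp⟩
    exact ⟨hD, _, hp⟩

end Weights

/-! ### Compatible actions -/

section Compatible

variable {K : Type*} [Field K] {M : Type*} [AddCommGroup M]
  {σ : PointedCone ℚ (RatDual M)}

theorem IsCompatible.exists_conj {φ : SL2Action K (CoordRing K σ)} (h : IsCompatible φ)
    (t : Torus K M) (g : SpecialLinearGroup (Fin 2) K) :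
    ∃ g', torusAction K σ t * φ.toHom g * (torusAction K σ t)⁻¹ = φ.toHom g' := by
  have h1 := h.1 ⟨t, rfl⟩
  rw [Subgroup.mem_normalizer_iff] at h1
  obtain ⟨g', hg'⟩ := (h1 (φ.toHom g)).mp ⟨g, rfl⟩
  exact ⟨g', hg'.symm⟩

/-- The torus acts on the one-parameter group of a homogeneous nilpotent matrix by scaling. -/
theorem torusAction_conj_unip [CharZero K] {φ : SL2Action K (CoordRing K σ)}
    {X : Matrix (Fin 2) (Fin 2) K} (hX : IsNilp X) {a : M} (h : HasWeight (φ.differential X) a)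
    (t : Torus K M) (s : K) :
    torusAction K σ t * φ.toHom (unip hX s) * (torusAction K σ t)⁻¹ =
      φ.toHom (unip hX (t.val a * s)) := by
  have h1 := (φ.isInfinitesimalGenerator_differential hX).conj (torusAction K σ t)
  have h2 := (φ.isInfinitesimalGenerator_differential hX).comp_mul (t.val a)
  rw [← h t] at h2
  refine eq_of_generator_eq (fun s s' => ?_) (fun s s' => ?_) h1 h2 s
  · rw [φ.toHom_unip_add]; group
  · rw [mul_add, φ.toHom_unip_add]

theorem torusAction_conj_upper [CharZero K] {φ : SL2Action K (CoordRing K σ)} {a : M}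
    (h : HasWeight (φ.differential nilE) a) (t : Torus K M) (s : K) :
    torusAction K σ t * φ.toHom (upper s) * (torusAction K σ t)⁻¹ =
      φ.toHom (upper (t.val a * s)) := by
  simpa only [unip_nilE] using torusAction_conj_unip isNilp_nilE h t s

theorem torusAction_conj_lower [CharZero K] {φ : SL2Action K (CoordRing K σ)} {a : M}
    (h : HasWeight (φ.differential nilF) a) (t : Torus K M) (s : K) :
    torusAction K σ t * φ.toHom (lower s) * (torusAction K σ t)⁻¹ =
      φ.toHom (lower (t.val a * s)) := by
  simpa only [unip_nilF] using torusAction_conj_unip isNilp_nilF h t s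

/-- With `w(x) = upper x * lower (-x⁻¹) * upper x` one has `diag l = w(l) w(1)⁻¹`. Conjugation by
`t` rescales `U₊` by `c` and `U₋` by `c⁻¹`, so the result is `w(cl) w(c)⁻¹ = diag (cl) * diag c⁻¹ =
diag l`. -/
theorem torusAction_commute_diag [CharZero K] {φ : SL2Action K (CoordRing K σ)} {a : M}
    (hE : HasWeight (φ.differential nilE) a) (hF : HasWeight (φ.differential nilF) (-a))
    (t : Torus K M) (l : Kˣ) :
    torusAction K σ t * φ.toHom (diag l) * (torusAction K σ t)⁻¹ = φ.toHom (diag l) := by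
  set c : Kˣ := Units.mk0 (t.val a) (t.val_ne_zero a)
  have hc : t.val a = c := rfl
  have hc' : t.val (-a) = ((c⁻¹ : Kˣ) : K) := by rw [t.val_neg, Units.val_inv_eq_inv_val, hc]
  have h1 : diag l = diag (c * l) * diag c⁻¹ := by rw [← diag_mul]; congr 1; simp
  have h2 : diag c = upper ((c : K) * 1) * lower (((c⁻¹ : Kˣ) : K) * -1) * upper ((c : K) * 1) *
      (upper (-1) * lower 1 * upper (-1)) := by
    rw [diag_eq, mul_one, mul_neg_one]
  have h3 := diag_eq l
  have h5 : diag (c * l) = upper ((c : K) * l) * lower (((c⁻¹ : Kˣ) : K) * -((l⁻¹ : Kˣ) : K)) *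
      upper ((c : K) * l) * (upper (-1) * lower 1 * upper (-1)) := by
    rw [diag_eq, mul_neg, _root_.mul_inv_rev, Units.val_mul, Units.val_mul,
      mul_comm ((l⁻¹ : Kˣ) : K)]
  have h4 : (upper (-1) * lower 1 * upper (-1) : SpecialLinearGroup (Fin 2) K) =
      (upper 1 * lower (-1) * upper 1)⁻¹ := by
    rw [upper_neg, lower_neg]; group
  have hu := torusAction_conj_upper hE t
  have hl := torusAction_conj_lower hF t
  rw [hc] at hu
  rw [hc'] at hl
  have hw : ∀ x y, torusAction K σ t * φ.toHom (upper x * lower y * upper x) *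
      (torusAction K σ t)⁻¹ =
        φ.toHom (upper ((c : K) * x) * lower (((c⁻¹ : Kˣ) : K) * y) * upper ((c : K) * x)) := by
    intro x y
    rw [map_mul, map_mul, map_mul, map_mul, ← hu, ← hl]
    group
  have hw' : torusAction K σ t * φ.toHom (upper 1 * lower (-1) * upper 1)⁻¹ *
      (torusAction K σ t)⁻¹ =
        φ.toHom (upper ((c : K) * 1) * lower (((c⁻¹ : Kˣ) : K) * -1) * upper ((c : K) * 1))⁻¹ := by
    rw [map_inv, map_inv, ← hw]
    group
  have e : torusAction K σ t * φ.toHom (diag l) * (torusAction K σ t)⁻¹ =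
      (torusAction K σ t * φ.toHom (upper (l : K) * lower (-((l⁻¹ : Kˣ) : K)) * upper (l : K)) *
        (torusAction K σ t)⁻¹) *
      (torusAction K σ t * φ.toHom (upper 1 * lower (-1) * upper 1)⁻¹ *
        (torusAction K σ t)⁻¹) := by
    rw [h3, h4, map_mul]
    group
  rw [e, hw, hw', ← map_mul]
  congr 1
  rw [h1, h5, diag_inv, h2, h4]
  group

/-- An automorphism which commutes with the torus belongs to the torus. -/
theorem mem_range_torusAction_of_commute [CharZero K] [Module.Free ℤ M] (hfg : Submodule.FG σ)
    (hpointed : ∀ v ∈ σ, -v ∈ σ → v = 0) (u : CoordRing K σ ≃ₐ[K] CoordRing K σ)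
    (hu : ∀ t : Torus K M, torusAction K σ t * u * (torusAction K σ t)⁻¹ = u) :
    u ∈ (torusAction K σ).range := by
  have h1 : ∀ m m', m ≠ m' → coeffAt m' (u (chi K m)) = 0 := by
    intro m m' hne
    by_contra hcon
    apply hne
    ext
    refine (eq_of_torus_val_eq (K := K) fun t => ?_)
    have h2 := congrArg (fun v => coeffAt m' (v (torusAction K σ t (chi K m)))) (hu t)
    simp only [AlgEquiv.mul_apply] at h2
    rw [show (torusAction K σ t)⁻¹ (torusAction K σ t (chi K m)) = chi K m from
      (torusAction K σ t).symm_apply_apply _, coeffAt_torusAction, torusAction_chi, map_smul,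
      map_smul, smul_eq_mul] at h2
    exact (mul_right_cancel₀ hcon h2).symm
  set c : dualMonoid σ → K := fun m => coeffAt m (u (chi K m)) with hc
  have huc : ∀ m, u (chi K m) = c m • chi K m := by
    intro m
    refine ext_coeffAt fun m' => ?_
    rw [map_smul]
    by_cases h : m = m'
    · rw [← h, coeffAt_chi_self, smul_eq_mul, mul_one]
    · rw [h1 m m' h, coeffAt_chi_of_ne h, smul_zero]
  have hc0 : ∀ m, c m ≠ 0 := by
    intro m h
    have := huc m
    rw [h, zero_smul] at this
    exact chi_ne_zero m ((map_eq_zero_iff u u.injective).mp this)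
  have hadd : ∀ m m', c (m + m') = c m * c m' := by
    intro m m'
    have h2 := huc (m + m')
    rw [chi_add, map_mul, huc, huc, smul_mul_smul_comm, ← chi_add] at h2
    exact (smul_left_injective K (chi_ne_zero _) h2).symm
  -- Having no coefficients between distinct characters, `u` scales each `χ^m`. The scalars are
  -- multiplicative and nonzero, so they extend from the dual monoid to a character of `M`, that is,
  -- to a torus element.
  let f : dualMonoid σ →+ Additive Kˣ := AddMonoidHom.mk'
    (fun m => Additive.ofMul (Units.mk0 (c m) (hc0 m))) fun m m' => by
      rw [← ofMul_mul]
      congr 1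
      ext
      exact hadd m m'
  obtain ⟨F, hF⟩ := exists_extension hfg hpointed f
  refine ⟨AddMonoidHom.toMultiplicativeLeft F, algEquiv_ext_chi fun m => ?_⟩
  rw [torusAction_chi, huc]
  congr 1
  have := hF m
  simp only [f, AddMonoidHom.mk'_apply] at this
  have h2 : (AddMonoidHom.toMultiplicativeLeft F) (Multiplicative.ofAdd (m : M)) =
      Units.mk0 (c m) (hc0 m) := by
    rw [AddMonoidHom.coe_toMultiplicativeLeft]
    simp [this]
  rw [Torus.val, h2, Units.val_mk0]

end Compatible

/-! ### Every compatible action is conjugate to an adapted one -/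

section Conjugation

variable {K : Type*} [Field K]

theorem SL2Action.conj_conj {A : Type*} [CommRing A] [Algebra K A]
    (φ : SL2Action K A) (h h' : SpecialLinearGroup (Fin 2) K) :
    (φ.conj h).conj h' = φ.conj (h * h') := by
  apply SL2Action.ext
  ext1 g
  rw [SL2Action.conj_toHom, SL2Action.conj_toHom, SL2Action.conj_toHom]
  congr 1
  group

theorem SL2Action.range_conj {A : Type*} [CommRing A] [Algebra K A]
    (φ : SL2Action K A) (h : SpecialLinearGroup (Fin 2) K) :
    (φ.conj h).toHom.range = φ.toHom.range := by
  ext u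
  constructor
  · rintro ⟨g, rfl⟩
    exact ⟨_, rfl⟩
  · rintro ⟨g, rfl⟩
    refine ⟨h⁻¹ * g * h, ?_⟩
    rw [SL2Action.conj_toHom]
    congr 1
    group

variable {M : Type*} [AddCommGroup M] {σ : PointedCone ℚ (RatDual M)}

theorem IsCompatible.conj {φ : SL2Action K (CoordRing K σ)} (hφ : IsCompatible φ)
    (h : SpecialLinearGroup (Fin 2) K) : IsCompatible (φ.conj h) := by
  rw [IsCompatible, SL2Action.range_conj]
  exact hφ

variable [CharZero K]

theorem SL2Action.differential_conj_action {A : Type*} [CommRing A] [Algebra K A]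
    (φ : SL2Action K A) (h : SpecialLinearGroup (Fin 2) K) {X : Matrix (Fin 2) (Fin 2) K}
    (hX : X 1 1 = -X 0 0) :
    (φ.conj h).differential X = φ.differential (h.1 * X * (h⁻¹).1) := by
  let f' : Matrix (Fin 2) (Fin 2) K →ₗ[K] (A →ₗ[K] A) := φ.differential ∘ₗ
    LinearMap.mulRight K (h⁻¹).1 ∘ₗ LinearMap.mulLeft K h.1
  refine linear_ext_nilp (f := (φ.conj h).differential) (f' := f') (fun X hX => ?_) hX
  refine ((φ.conj h).isInfinitesimalGenerator_differential hX).unique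
    (φ.isInfinitesimalGenerator_differential (hX.conj h)) fun n => ?_
  rw [unip_conj]
  rfl

/-- The differential depends on the trace zero part only. -/
theorem SL2Action.exists_traceless {A : Type*} [CommRing A] [Algebra K A] (φ : SL2Action K A)
    (X : Matrix (Fin 2) (Fin 2) K) :
    ∃ Y : Matrix (Fin 2) (Fin 2) K, Y 1 1 = -Y 0 0 ∧ φ.differential X = φ.differential Y := by
  refine ⟨!![X 0 0, X 0 1; X 1 0, -X 0 0], by simp, ?_⟩
  simp [SL2Action.differential]

theorem IsCompatible.differential_nilE_ne_zero {φ : SL2Action K (CoordRing K σ)}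
    (h : IsCompatible φ) : φ.differential nilE ≠ 0 := by
  intro hE
  apply h.2
  intro u _
  rw [Subgroup.mem_centralizer_iff]
  rintro _ ⟨g, rfl⟩
  rw [φ.eq_one_of_differential_nilE_eq_zero hE, one_mul, mul_one]

/-- The Lie algebra of a compatible action is spanned by homogeneous elements. -/
theorem IsCompatible.range_differential_le [IsAlgClosed K] {φ : SL2Action K (CoordRing K σ)}
    (h : IsCompatible φ) {W : Submodule K (CoordRing K σ →ₗ[K] CoordRing K σ)}
    (hW : ∀ (X : Matrix (Fin 2) (Fin 2) K) (a : M), X 1 1 = -X 0 0 →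
      HasWeight (φ.differential X) a → φ.differential X ∈ W) (X : Matrix (Fin 2) (Fin 2) K) :
    φ.differential X ∈ W := by
  have hfin : FiniteDimensional K (LinearMap.range φ.differential) :=
    LinearMap.finiteDimensional_range _
  have hle := le_span_hasWeight (LinearMap.range φ.differential) hfin (by
    rintro t _ ⟨Y, rfl⟩
    obtain ⟨Y', hY', hYY'⟩ := φ.exists_traceless Y
    obtain ⟨Z, -, hZ⟩ := φ.exists_conjEnd_differential (torusAction K σ t) (h.exists_conj t) hY'
    rw [hYY', hZ]
    exact ⟨Z, rfl⟩)
  refine Submodule.span_le.mpr ?_ (hle ⟨X, rfl⟩)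
  rintro _ ⟨⟨Y, rfl⟩, a, ha⟩
  obtain ⟨Y', hY', hYY'⟩ := φ.exists_traceless Y
  rw [hYY'] at ha ⊢
  exact hW Y' a hY' ha

/-- If `U₊` and `U₋` are fixed by the torus, then the action is centralized by it. -/
theorem le_centralizer_of_hasWeight_zero {φ : SL2Action K (CoordRing K σ)}
    (hE : HasWeight (φ.differential nilE) 0) (hF : HasWeight (φ.differential nilF) 0) :
    (torusAction K σ).range ≤ Subgroup.centralizer (φ.toHom.range : Set _) := by
  rintro _ ⟨t, rfl⟩
  rw [Subgroup.mem_centralizer_iff]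
  rintro _ ⟨g, rfl⟩
  have hg : g ∈ (Subgroup.centralizer {torusAction K σ t}).comap φ.toHom := by
    refine mem_of_upper_lower (fun s => ?_) (fun s => ?_) g
    · rw [Subgroup.mem_comap, Subgroup.mem_centralizer_singleton_iff]
      have := torusAction_conj_upper hE t s
      rw [t.val_zero, one_mul] at this
      exact (mul_inv_eq_iff_eq_mul.mp this).symm
    · rw [Subgroup.mem_comap, Subgroup.mem_centralizer_singleton_iff]
      have := torusAction_conj_lower hF t s
      rw [t.val_zero, one_mul] at this
      exact (mul_inv_eq_iff_eq_mul.mp this).symm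
  rw [Subgroup.mem_comap, Subgroup.mem_centralizer_singleton_iff] at hg
  exact hg

variable [Module.Free ℤ M]

/-- Homogeneous elements of nonzero degree in the Lie algebra are nilpotent. -/
theorem IsCompatible.isNilp_of_hasWeight [IsAlgClosed K] {φ : SL2Action K (CoordRing K σ)}
    (h : IsCompatible φ) {X : Matrix (Fin 2) (Fin 2) K} {a : M} (hX : X 1 1 = -X 0 0)
    (ha : a ≠ 0) (hXa : HasWeight (φ.differential X) a) : IsNilp X := by
  have hE0 := h.differential_nilE_ne_zero
  by_cases hX0 : X = 0
  · rw [hX0]; simp [IsNilp]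
  -- a homogeneous element of the Lie algebra which does not commute with `X`
  obtain ⟨Y, b, hY, hYb, hXY⟩ : ∃ (Y : Matrix (Fin 2) (Fin 2) K) (b : M), Y 1 1 = -Y 0 0 ∧
      HasWeight (φ.differential Y) b ∧ φ.differential (X * Y - Y * X) ≠ 0 := by
    by_contra hcon
    push Not at hcon
    apply hX0
    -- The operators commuting with `φ.differential X`. If all homogeneous elements belong to it, so
    -- does the whole Lie algebra, and `X` is central in `𝔰𝔩₂`.
    let W : Submodule K (CoordRing K σ →ₗ[K] CoordRing K σ) :=
      LinearMap.ker (LinearMap.mulLeft K (A := Module.End K (CoordRing K σ)) (φ.differential X) -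
        LinearMap.mulRight K (A := Module.End K (CoordRing K σ)) (φ.differential X))
    have hmem : ∀ D, D ∈ W ↔ φ.differential X ∘ₗ D - D ∘ₗ φ.differential X = 0 := fun D => Iff.rfl
    have hW := h.range_differential_le (W := W) (fun Y b hY hYb => by
      rw [hmem, φ.differential_bracket hX hY]
      exact hcon Y b hY hYb)
    have h1 := (hmem _).mp (hW nilE)
    have h2 := (hmem _).mp (hW nilF)
    rw [φ.differential_bracket hX isNilp_nilE.1] at h1
    rw [φ.differential_bracket hX isNilp_nilF.1] at h2
    have e1 : X * nilE - nilE * X = !![-X 1 0, X 0 0 - X 1 1; 0, X 1 0] := by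
      rw [← neg_sub, nilE_bracket]
      ext i j
      fin_cases i <;> fin_cases j <;> simp
    have e2 : X * nilF - nilF * X = !![X 0 1, 0; X 1 1 - X 0 0, -X 0 1] := by
      ext i j
      rw [Matrix.sub_apply, Matrix.mul_apply, Matrix.mul_apply, Fin.sum_univ_two,
        Fin.sum_univ_two]
      fin_cases i <;> fin_cases j <;> simp [nilF]
    have h1' := φ.eq_zero_of_differential_eq_zero hE0 (by rw [e1]; simp) h1
    have h2' := φ.eq_zero_of_differential_eq_zero hE0 (by rw [e2]; simp) h2
    rw [e1] at h1'
    rw [e2] at h2'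
    have f1 : X 1 0 = 0 := by simpa using congrFun (congrFun h1' 1) 1
    have f2 : X 0 0 - X 1 1 = 0 := by simpa using congrFun (congrFun h1' 0) 1
    have f3 : X 0 1 = 0 := by simpa using congrFun (congrFun h2' 0) 0
    have f4 : X 0 0 = 0 := by
      rw [hX, sub_neg_eq_add, ← two_mul] at f2
      simpa using f2
    ext i j
    fin_cases i <;> fin_cases j <;> simp [f1, f3, f4, hX]
  refine ⟨hX, ?_⟩
  -- Here `X * X = d`, whence `ad(X)³ = 4d ad(X)`. For `d ≠ 0` the nonzero element `[X, Y]` would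
  -- have both weights `a + b` and `3a + b`, forcing `2a = 0`.
  by_contra hdet
  set d : K := X 0 0 * X 0 0 + X 0 1 * X 1 0 with hd
  have hsq : X * X = d • (1 : Matrix (Fin 2) (Fin 2) K) := by
    ext i j
    rw [Matrix.mul_apply, Fin.sum_univ_two]
    fin_cases i <;> fin_cases j <;> simp [hX, hd] <;> ring
  have htr : ∀ Z : Matrix (Fin 2) (Fin 2) K, (X * Z - Z * X) 1 1 = -(X * Z - Z * X) 0 0 := by
    intro Z
    simp only [Matrix.sub_apply, Matrix.mul_apply, Fin.sum_univ_two]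
    ring
  have hw : ∀ (Z : Matrix (Fin 2) (Fin 2) K) (c : M), Z 1 1 = -Z 0 0 →
      HasWeight (φ.differential Z) c → HasWeight (φ.differential (X * Z - Z * X)) (a + c) := by
    intro Z c hZ hZc
    rw [← φ.differential_bracket hX hZ]
    exact hXa.bracket hZc
  have w1 := hw Y b hY hYb
  have w3 := hw _ _ (htr _) (hw _ _ (htr Y) w1)
  have hcube : X * (X * (X * Y - Y * X) - (X * Y - Y * X) * X) -
      (X * (X * Y - Y * X) - (X * Y - Y * X) * X) * X = (4 * d) • (X * Y - Y * X) := by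
    have e1 : X * (X * (X * Y - Y * X) - (X * Y - Y * X) * X) -
      (X * (X * Y - Y * X) - (X * Y - Y * X) * X) * X =
      (X * X) * (X * Y) - 3 • ((X * X) * (Y * X)) + 3 • ((X * Y) * (X * X)) - (Y * X) * (X * X) := by
      noncomm_ring
    rw [e1, hsq]
    simp only [Matrix.smul_mul, Matrix.mul_smul, one_mul, mul_one]
    module
  rw [hcube, map_smul] at w3
  have h4d : 4 * d ≠ 0 := mul_ne_zero (by norm_num) hdet
  have heq := HasWeight.unique hXY w1 (w3.of_smul h4d)
  have h2a : (2 : ℤ) • a = 0 := by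
    have : a + (a + (a + b)) - (a + b) = (2 : ℤ) • a := by module
    rw [← this, ← heq, sub_self]
  obtain ⟨ν, hν⟩ := exists_dual_ne_zero ha
  have := congrArg ν h2a
  rw [map_zsmul, map_zero, smul_eq_zero] at this
  exact hν (this.resolve_left (by norm_num))

/-- If all homogeneous elements had weight zero, the torus would fix `U₊` and `U₋` and centralize
the action. One of nonzero weight is nilpotent, hence conjugate to `nilE`. -/
theorem IsCompatible.exists_hasWeight_nilE [IsAlgClosed K] {φ : SL2Action K (CoordRing K σ)}
    (h : IsCompatible φ) : ∃ (g : SpecialLinearGroup (Fin 2) K) (a : M), a ≠ 0 ∧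
      HasWeight ((φ.conj g).differential nilE) a := by
  obtain ⟨X, a, hX, ha, hX0, hXa⟩ : ∃ (X : Matrix (Fin 2) (Fin 2) K) (a : M), X 1 1 = -X 0 0 ∧
      a ≠ 0 ∧ φ.differential X ≠ 0 ∧ HasWeight (φ.differential X) a := by
    by_contra hcon
    push Not at hcon
    apply h.2
    let W : Submodule K (CoordRing K σ →ₗ[K] CoordRing K σ) :=
      { carrier := {D | HasWeight D (0 : M)}
        zero_mem' := fun t => by rw [map_zero, smul_zero]
        add_mem' := fun {D D'} h h' t => by rw [map_add, h, h', smul_add]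
        smul_mem' := fun c D h => h.smul c }
    have hW := h.range_differential_le (W := W) (fun Y b hY hYb => by
      by_cases hb : b = 0
      · rw [hb] at hYb; exact hYb
      · by_cases hY0 : φ.differential Y = 0
        · rw [hY0]; exact zero_mem W
        · exact absurd hYb (hcon Y b hY hb hY0))
    exact le_centralizer_of_hasWeight_zero (hW nilE) (hW nilF)
  have hnil := h.isNilp_of_hasWeight hX ha hXa
  have hX0' : X ≠ 0 := by
    rintro rfl
    exact hX0 (map_zero _)
  obtain ⟨g, rfl⟩ := hnil.exists_conj hX0'
  exact ⟨g, a, ha, by rwa [φ.differential_conj_action g isNilp_nilE.1]⟩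

/-- Some homogeneous `Y` has nonzero lower left entry. Bracketing it twice with `nilE` gives a
nonzero multiple of `nilE`, so `Y` has weight `-a` and is nilpotent. Conjugation in `U₊`, which
fixes `nilE`, turns it into a multiple of `nilF`. -/
theorem IsCompatible.exists_hasWeight_nilF [IsAlgClosed K] {φ : SL2Action K (CoordRing K σ)}
    (h : IsCompatible φ) {a : M} (ha : a ≠ 0) (hE : HasWeight (φ.differential nilE) a) :
    ∃ g : SpecialLinearGroup (Fin 2) K, HasWeight ((φ.conj g).differential nilE) a ∧
      HasWeight ((φ.conj g).differential nilF) (-a) := by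
  have hE0 := h.differential_nilE_ne_zero
  obtain ⟨Y, b, hY, hYb, hY10⟩ : ∃ (Y : Matrix (Fin 2) (Fin 2) K) (b : M), Y 1 1 = -Y 0 0 ∧
      HasWeight (φ.differential Y) b ∧ Y 1 0 ≠ 0 := by
    by_contra hcon
    push Not at hcon
    let U : Submodule K (Matrix (Fin 2) (Fin 2) K) :=
      { carrier := {X | X 1 1 = -X 0 0 ∧ X 1 0 = 0}
        zero_mem' := by simp
        add_mem' := fun {X Y} hX hY => by
          refine ⟨?_, ?_⟩
          · simp [hX.1, hY.1]; ring
          · simp [hX.2, hY.2]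
        smul_mem' := fun c X hX => by
          refine ⟨?_, ?_⟩
          · simp [hX.1]
          · simp [hX.2] }
    obtain ⟨X, hX, hXF⟩ := h.range_differential_le (W := U.map φ.differential)
      (fun Y b hY hYb => ⟨Y, ⟨hY, hcon Y b hY hYb⟩, rfl⟩) nilF
    have := φ.differential_injective hE0 hX.1 isNilp_nilF.1 hXF
    have h10 := hX.2
    rw [this] at h10
    simp [nilF] at h10
  have w1 : HasWeight (φ.differential (nilE * Y - Y * nilE)) (a + b) := by
    rw [← φ.differential_bracket isNilp_nilE.1 hY]
    exact hE.bracket hYb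
  have w2 : HasWeight (φ.differential (nilE * (nilE * Y - Y * nilE) -
      (nilE * Y - Y * nilE) * nilE)) (a + (a + b)) := by
    rw [← φ.differential_bracket isNilp_nilE.1 (by rw [nilE_bracket]; simp)]
    exact hE.bracket w1
  have e2 : nilE * (nilE * Y - Y * nilE) - (nilE * Y - Y * nilE) * nilE =
      (-(2 * Y 1 0)) • nilE := by
    rw [nilE_bracket, nilE_bracket]
    ext i j
    fin_cases i <;> fin_cases j <;> simp [nilE]
    ring
  rw [e2, map_smul] at w2
  have hb : b = -a := by
    have := HasWeight.unique hE0 (w2.of_smul (neg_ne_zero.mpr (mul_ne_zero two_ne_zero hY10))) hE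
    have h3 : b + a = 0 := by
      have h4 : a + (a + b) - a = b + a := by abel
      rw [← h4, this, sub_self]
    exact eq_neg_of_add_eq_zero_left h3
  rw [hb] at hYb
  have hnil := h.isNilp_of_hasWeight hY (neg_ne_zero.mpr ha) hYb
  set c : K := Y 0 0 / Y 1 0 with hc
  have hcY : Y 0 0 = c * Y 1 0 := by rw [hc, div_mul_cancel₀ _ hY10]
  have hY01 : Y 0 1 = -(c * c * Y 1 0) := by
    have := hnil.2
    rw [hcY] at this
    apply mul_right_cancel₀ hY10
    linear_combination this
  refine ⟨upper c, ?_, ?_⟩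
  · rw [φ.differential_conj_action _ isNilp_nilE.1]
    have : (upper c).1 * nilE * ((upper c)⁻¹).1 = nilE := by
      rw [conj_apply]
      ext i j
      fin_cases i <;> fin_cases j <;> simp [nilE]
    rwa [this]
  · rw [φ.differential_conj_action _ isNilp_nilF.1]
    have : Y = Y 1 0 • ((upper c).1 * nilF * ((upper c)⁻¹).1) := by
      rw [conj_apply]
      ext i j
      fin_cases i <;> fin_cases j <;> simp [nilF]
      · rw [hcY]; ring
      · rw [hY01]; ring
      · rw [hY, hcY]; ring
    rw [this, map_smul] at hYb
    exact hYb.of_smul hY10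

theorem isAdapted_of_hasWeight (hfg : Submodule.FG σ) (hpointed : ∀ v ∈ σ, -v ∈ σ → v = 0)
    {φ : SL2Action K (CoordRing K σ)} {a : M} (hE : HasWeight (φ.differential nilE) a)
    (hF : HasWeight (φ.differential nilF) (-a)) : IsAdapted φ := fun l =>
  mem_range_torusAction_of_commute hfg hpointed _ fun t => torusAction_commute_diag hE hF t l

theorem IsCompatible.exists_conj_adapted [IsAlgClosed K] (hfg : Submodule.FG σ)
    (hpointed : ∀ v ∈ σ, -v ∈ σ → v = 0) {φ : SL2Action K (CoordRing K σ)}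
    (h : IsCompatible φ) : ∃ g : SpecialLinearGroup (Fin 2) K,
      IsCompatible (φ.conj g) ∧ IsAdapted (φ.conj g) := by
  obtain ⟨g, a, ha, hE⟩ := h.exists_hasWeight_nilE
  obtain ⟨g', hE', hF'⟩ := (h.conj g).exists_hasWeight_nilF ha hE
  rw [SL2Action.conj_conj] at hE' hF'
  exact ⟨g * g', h.conj _, isAdapted_of_hasWeight hfg hpointed hE' hF'⟩

end Conjugation

/-! ### The action of a pair of opposite roots -/

section Construction

variable {M : Type*} [AddCommGroup M] {σ : PointedCone ℚ (RatDual M)}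

/-- The properties of the distinguished rays of an `SL₂`-root needed to build the action. -/
structure IsSL2Pair (σ : PointedCone ℚ (RatDual M)) (e : M) (ρ ρ' : DualLattice M) : Prop where
  nonneg : ∀ m ∈ dualMonoid σ, 0 ≤ ρ m
  nonneg' : ∀ m ∈ dualMonoid σ, 0 ≤ ρ' m
  apply_root : ρ e = -1
  apply_root' : ρ' e = 1
  mem : ∀ m ∈ dualMonoid σ, ∀ k : ℤ, 0 ≤ ρ m - k → 0 ≤ ρ' m + k → m + k • e ∈ dualMonoid σ

theorem IsRoot.ray_spec {e : M} (he : IsRoot σ e) : IsDistinguishedRay σ e he.ray :=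
  he.choose_spec

theorem IsRay.nonneg {ρ : DualLattice M} (h : IsRay σ ρ) {m : M} (hm : m ∈ dualMonoid σ) :
    0 ≤ ρ m := by
  have := hm _ h.mem
  rw [toRat_apply] at this
  exact_mod_cast this

/-- A ray `τ` other than the two distinguished ones is nonnegative on both `e` and `-e`, hence zero
on `e`. Moving `m` along `e` thus changes only two of the inequalities defining the dual monoid. -/
theorem isSL2Pair [Module.Finite ℤ M] (hfg : Submodule.FG σ)
    (hpointed : ∀ v ∈ σ, -v ∈ σ → v = 0) (e : SL2Roots σ) :
    IsSL2Pair σ (e : M) e.2.1.ray e.2.2.ray := by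
  obtain ⟨h1, h2, h3⟩ := e.2.1.ray_spec
  obtain ⟨h1', h2', h3'⟩ := e.2.2.ray_spec
  set ρ := e.2.1.ray
  set ρ' := e.2.2.ray
  rw [map_neg] at h2'
  refine ⟨fun m hm => h1.nonneg hm, fun m hm => h1'.nonneg hm, h2, by omega, ?_⟩
  intro m hm k hk hk'
  refine mem_dualMonoid_of_rays hfg hpointed fun τ hτ => ?_
  rw [map_add, map_zsmul, smul_eq_mul]
  by_cases hτρ : τ = ρ
  · rw [hτρ, h2]; omega
  by_cases hτρ' : τ = ρ'
  · rw [hτρ', show ρ' e = 1 by omega]; omega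
  have e1 := h3 τ hτ hτρ
  have e2 := h3' τ hτ hτρ'
  rw [map_neg] at e2
  rw [show τ e = 0 by omega, mul_zero, add_zero]
  exact hτ.nonneg hm

variable (K : Type*) [Field K]

/-- The ring `K[x, y] ⊗ K[M]`. -/
abbrev BigRing (K : Type*) [Field K] (M : Type*) [AddCommGroup M] : Type _ :=
  AddMonoidAlgebra K (ℕ × ℕ × M)

/-- The variable `x`. -/
noncomputable def varX (K : Type*) [Field K] (M : Type*) [AddCommGroup M] : BigRing K M := AddMonoidAlgebra.single (1, 0, 0) 1

/-- The variable `y`. -/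
noncomputable def varY (K : Type*) [Field K] (M : Type*) [AddCommGroup M] : BigRing K M := AddMonoidAlgebra.single (0, 1, 0) 1

/-- The monomial of a lattice vector. -/
noncomputable def monZ (u : M) : BigRing K M := AddMonoidAlgebra.single (0, 0, u) 1

theorem monZ_add (u v : M) : monZ K (u + v) = monZ K u * monZ K v := by
  simp [monZ, AddMonoidAlgebra.single_mul_single]

theorem monZ_zero : monZ K (0 : M) = 1 := rfl

theorem single_eq_mul (i j : ℕ) (u : M) :
    (AddMonoidAlgebra.single (i, j, u) 1 : BigRing K M) = varX K M ^ i * varY K M ^ j * monZ K u := by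
  simp [varX, varY, monZ, AddMonoidAlgebra.single_pow, AddMonoidAlgebra.single_mul_single]

variable {K}

/-- The linear action of `SL₂` on `K[x, y]`, extended trivially to `K[M]`. -/
noncomputable def bigAct (g : SpecialLinearGroup (Fin 2) K) : BigRing K M →ₐ[K] BigRing K M :=
  AddMonoidAlgebra.lift K (BigRing K M) (ℕ × ℕ × M)
    -- The pair `y, x`, in this order, is the standard basis of the two-dimensional representation.
    -- So `U₊` sends `x` to `x + s y`, lowering the exponent `⟨m, ρ_e⟩` as `∂_e` does.
    { toFun := fun w => (g.1 1 1 • varX K M + g.1 0 1 • varY K M) ^ w.toAdd.1 *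
        (g.1 1 0 • varX K M + g.1 0 0 • varY K M) ^ w.toAdd.2.1 * monZ K w.toAdd.2.2
      map_one' := by simp [monZ_zero]
      map_mul' := fun w w' => by
        simp only [toAdd_mul, Prod.fst_add, Prod.snd_add, pow_add, monZ_add]
        ring }

theorem bigAct_single (g : SpecialLinearGroup (Fin 2) K) (i j : ℕ) (u : M) :
    bigAct g (AddMonoidAlgebra.single (i, j, u) 1) =
      (g.1 1 1 • varX K M + g.1 0 1 • varY K M) ^ i *
        (g.1 1 0 • varX K M + g.1 0 0 • varY K M) ^ j * monZ K u := by
  simp [bigAct]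

theorem bigAct_varX (g : SpecialLinearGroup (Fin 2) K) :
    bigAct g (varX K M) = g.1 1 1 • varX K M + g.1 0 1 • varY K M := by
  rw [varX, bigAct_single]; simp [monZ_zero, varX]

theorem bigAct_varY (g : SpecialLinearGroup (Fin 2) K) :
    bigAct g (varY K M) = g.1 1 0 • varX K M + g.1 0 0 • varY K M := by
  rw [varY, bigAct_single]; simp [monZ_zero, varY]

theorem bigAct_monZ (g : SpecialLinearGroup (Fin 2) K) (u : M) :
    bigAct g (monZ K u) = monZ K u := by
  rw [monZ, bigAct_single]; simp [monZ]

theorem bigRing_algHom_ext {B : Type*} [CommRing B] [Algebra K B] {f f' : BigRing K M →ₐ[K] B}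
    (hX : f (varX K M) = f' (varX K M)) (hY : f (varY K M) = f' (varY K M))
    (hZ : ∀ u, f (monZ K u) = f' (monZ K u)) : f = f' := by
  apply (AddMonoidAlgebra.lift K B (ℕ × ℕ × M)).symm.injective
  refine MonoidHom.ext fun w => ?_
  induction w using Multiplicative.rec with | _ w
  obtain ⟨i, j, u⟩ := w
  simp only [AddMonoidAlgebra.lift_symm_apply, toAdd_ofAdd]
  rw [single_eq_mul]
  simp only [map_mul, map_pow, hX, hY, hZ]

theorem bigAct_one : bigAct (1 : SpecialLinearGroup (Fin 2) K) = AlgHom.id K (BigRing K M) := by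
  refine bigRing_algHom_ext ?_ ?_ fun u => ?_
  · rw [bigAct_varX]; simp
  · rw [bigAct_varY]; simp
  · rw [bigAct_monZ]; rfl

theorem bigAct_mul (g h : SpecialLinearGroup (Fin 2) K) :
    bigAct (M := M) (g * h) = (bigAct g).comp (bigAct h) := by
  refine bigRing_algHom_ext ?_ ?_ fun u => ?_
  · rw [AlgHom.comp_apply, bigAct_varX, bigAct_varX, map_add, map_smul, map_smul, bigAct_varX,
      bigAct_varY, mul_val_apply, mul_val_apply]
    module
  · rw [AlgHom.comp_apply, bigAct_varY, bigAct_varY, map_add, map_smul, map_smul, bigAct_varX,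
      bigAct_varY, mul_val_apply, mul_val_apply]
    module
  · rw [AlgHom.comp_apply, bigAct_monZ, bigAct_monZ, bigAct_monZ]

/-- The forms of degree `n` in `x` and `y`. -/
noncomputable def forms (K : Type*) [Field K] (M : Type*) [AddCommGroup M] (n : ℕ) : Submodule K (BigRing K M) :=
  Submodule.span K {f | ∃ i j, i + j = n ∧ f = varX K M ^ i * varY K M ^ j}

theorem mul_mem_forms {n n' : ℕ} {f f' : BigRing K M} (hf : f ∈ forms K M n)
    (hf' : f' ∈ forms K M n') : f * f' ∈ forms K M (n + n') := by
  have := Submodule.mul_mem_mul hf hf'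
  rw [forms, forms, Submodule.span_mul_span] at this
  refine Submodule.span_mono ?_ this
  rintro _ ⟨_, ⟨i, j, rfl, rfl⟩, _, ⟨i', j', rfl, rfl⟩, rfl⟩
  exact ⟨i + i', j + j', by omega, by ring⟩

theorem linear_mem_forms (a b : K) : a • varX K M + b • varY K M ∈ forms K M 1 :=
  add_mem (Submodule.smul_mem _ _ (Submodule.subset_span ⟨1, 0, rfl, by simp⟩))
    (Submodule.smul_mem _ _ (Submodule.subset_span ⟨0, 1, rfl, by simp⟩))

theorem linear_pow_mem_forms (a b : K) (n : ℕ) :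
    (a • varX K M + b • varY K M) ^ n ∈ forms K M n := by
  induction n with
  | zero => exact Submodule.subset_span ⟨0, 0, rfl, by simp⟩
  | succ n ih => rw [pow_succ]; exact mul_mem_forms ih (linear_mem_forms a b)

namespace IsSL2Pair

variable {e : M} {ρ ρ' : DualLattice M} (hp : IsSL2Pair σ e ρ ρ')

/-- The exponents of a monomial. -/
def exponents : dualMonoid σ →+ ℕ × ℕ × M where
  -- Since `ρ e = -1` and `ρ' e = 1`, the last component and the total degree of the first two are
  -- constant along `m + ℤe`. Truncation to `ℕ` loses nothing, as both values are nonnegative.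
  toFun m := ((ρ m).toNat, (ρ' m).toNat, (m : M) + ρ m • e)
  map_zero' := by simp
  map_add' m m' := by
    have h1 := hp.nonneg m m.2
    have h2 := hp.nonneg m' m'.2
    have h3 := hp.nonneg' m m.2
    have h4 := hp.nonneg' m' m'.2
    simp only [AddSubmonoid.coe_add, map_add, Int.toNat_add h1 h2, Int.toNat_add h3 h4, add_smul,
      Prod.mk_add_mk]
    congr 2
    abel

theorem exponents_injective : Function.Injective hp.exponents := by
  intro m m' h
  simp only [exponents, AddMonoidHom.coe_mk, ZeroHom.coe_mk, Prod.mk.injEq] at h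
  have h1 := hp.nonneg m m.2
  have h2 := hp.nonneg m' m'.2
  have h3 : ρ m = ρ m' := by omega
  have h4 := h.2.2
  rw [h3] at h4
  exact Subtype.ext (add_right_cancel h4)

variable (K) in
/-- The embedding of the coordinate ring. -/
noncomputable def embed : CoordRing K σ →ₐ[K] BigRing K M :=
  AddMonoidAlgebra.mapDomainAlgHom K K hp.exponents

theorem embed_chi (m : dualMonoid σ) : hp.embed K (chi K m) =
    varX K M ^ (ρ m).toNat * varY K M ^ (ρ' m).toNat * monZ K ((m : M) + ρ m • e) := by
  rw [← single_eq_mul, embed, chi]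
  exact AddMonoidAlgebra.mapDomain_single

theorem embed_injective : Function.Injective (hp.embed K) :=
  AddMonoidAlgebra.mapDomain_injective hp.exponents_injective

theorem bigAct_embed_chi (g : SpecialLinearGroup (Fin 2) K) (m : dualMonoid σ) :
    bigAct g (hp.embed K (chi K m)) =
      (g.1 1 1 • varX K M + g.1 0 1 • varY K M) ^ (ρ m).toNat *
        (g.1 1 0 • varX K M + g.1 0 0 • varY K M) ^ (ρ' m).toNat *
        monZ K ((m : M) + ρ m • e) := by
  rw [embed_chi, map_mul, map_mul, map_pow, map_pow, bigAct_varX, bigAct_varY, bigAct_monZ]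

/-- Redistributing the degree between `x` and `y` means moving along the string `m + ℤe`, which
stays in the dual monoid by `mem` as long as both exponents are nonnegative. -/
theorem monomial_mem_range (m : dualMonoid σ) {i j : ℕ}
    (hij : i + j = (ρ m).toNat + (ρ' m).toNat) :
    ∃ m' : dualMonoid σ, (m' : M) = m + (ρ m - i) • e ∧
      hp.embed K (chi K m') = varX K M ^ i * varY K M ^ j * monZ K ((m : M) + ρ m • e) := by
  have h1 := hp.nonneg m m.2
  have h3 := hp.nonneg' m m.2
  refine ⟨⟨(m : M) + (ρ m - i) • e, hp.mem m m.2 _ (by omega) (by omega)⟩, rfl, ?_⟩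
  have e1 : ρ ((m : M) + (ρ m - i) • e) = i := by
    rw [map_add, map_zsmul, hp.apply_root, smul_eq_mul]; ring
  have e2 : ρ' ((m : M) + (ρ m - i) • e) = j := by
    rw [map_add, map_zsmul, hp.apply_root', smul_eq_mul]; omega
  rw [embed_chi]
  simp only [e1, e2, Int.toNat_natCast]
  congr 2
  module

/-- Linear substitutions preserve the degree in `x, y` and the lattice part, and by
`monomial_mem_range` all monomials with these data lie in the image. -/
theorem bigAct_embed_mem (g : SpecialLinearGroup (Fin 2) K) (a : CoordRing K σ) :
    bigAct g (hp.embed K a) ∈ (hp.embed K).range := by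
  induction a using AddMonoidAlgebra.induction_linear with
  | zero => rw [map_zero, map_zero]; exact zero_mem _
  | add a b ha hb => rw [map_add, map_add]; exact add_mem ha hb
  | single m c =>
    have : (AddMonoidAlgebra.single m c : CoordRing K σ) = c • chi K m := by simp [chi]
    rw [this, map_smul, map_smul]
    refine Subalgebra.smul_mem _ ?_ c
    rw [bigAct_embed_chi]
    have hf := mul_mem_forms
      (linear_pow_mem_forms (M := M) (g.1 1 1) (g.1 0 1) (ρ m).toNat)
      (linear_pow_mem_forms (M := M) (g.1 1 0) (g.1 0 0) (ρ' m).toNat)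
    generalize (g.1 1 1 • varX K M + g.1 0 1 • varY K M) ^ (ρ m).toNat *
        (g.1 1 0 • varX K M + g.1 0 0 • varY K M) ^ (ρ' m).toNat = f at hf
    induction hf using Submodule.span_induction with
    | mem f hf =>
      obtain ⟨i, j, hij, rfl⟩ := hf
      obtain ⟨m', -, hm'⟩ := hp.monomial_mem_range (K := K) m hij
      exact ⟨_, hm'⟩
    | zero => rw [zero_mul]; exact zero_mem _
    | add f f' _ _ hf hf' => rw [add_mul]; exact add_mem hf hf'
    | smul c f _ hf => rw [smul_mul_assoc]; exact Subalgebra.smul_mem _ hf c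

/-- The action on the coordinate ring, as an algebra homomorphism. -/
noncomputable def actHom (g : SpecialLinearGroup (Fin 2) K) : CoordRing K σ →ₐ[K] CoordRing K σ :=
  ((AlgEquiv.ofInjective (hp.embed K) hp.embed_injective).symm : _ →ₐ[K] CoordRing K σ).comp
    (((bigAct g).comp (hp.embed K)).codRestrict (hp.embed K).range (hp.bigAct_embed_mem g))

theorem embed_actHom (g : SpecialLinearGroup (Fin 2) K) (a : CoordRing K σ) :
    hp.embed K (hp.actHom g a) = bigAct g (hp.embed K a) := by
  have := (AlgEquiv.ofInjective (hp.embed K) hp.embed_injective).apply_symm_apply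
    (((bigAct g).comp (hp.embed K)).codRestrict (hp.embed K).range (hp.bigAct_embed_mem g) a)
  exact congrArg Subtype.val this

theorem actHom_one : hp.actHom (1 : SpecialLinearGroup (Fin 2) K) = AlgHom.id K _ := by
  refine AlgHom.ext fun a => hp.embed_injective ?_
  rw [embed_actHom, bigAct_one]
  rfl

theorem actHom_mul (g h : SpecialLinearGroup (Fin 2) K) :
    hp.actHom (g * h) = (hp.actHom g).comp (hp.actHom h) := by
  refine AlgHom.ext fun a => hp.embed_injective ?_
  rw [embed_actHom, bigAct_mul, AlgHom.comp_apply, AlgHom.comp_apply, embed_actHom, embed_actHom]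

/-- Regularity is evident in the big ring and is brought back by a left inverse of `embed`. A merely
linear left inverse suffices, because regular maps are defined for vector spaces. -/
theorem actHom_regular (a : CoordRing K σ) :
    (fun g : SpecialLinearGroup (Fin 2) K => hp.actHom g a) ∈ regularMaps K (CoordRing K σ) := by
  have h1 : (fun g : SpecialLinearGroup (Fin 2) K => bigAct g (hp.embed K a)) ∈
      regularMaps K (BigRing K M) := by
    induction a using AddMonoidAlgebra.induction_linear with
    | zero =>
      simp only [map_zero]
      exact const_mem_regularMaps _
    | add a b ha hb =>
      simp only [map_add]
      exact add_mem_regularMaps ha hb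
    | single m c =>
      have : (AddMonoidAlgebra.single m c : CoordRing K σ) = c • chi K m := by simp [chi]
      simp only [this, map_smul]
      refine const_smul_mem_regularMaps ?_ c
      simp only [bigAct_embed_chi]
      have hlin : ∀ i j k l : Fin 2, (fun g : SpecialLinearGroup (Fin 2) K =>
          g.1 i j • varX K M + g.1 k l • varY K M) ∈ regularMaps K (BigRing K M) :=
        fun i j k l => add_mem_regularMaps
          (smul_mem_regularMaps (entry_mem_regularFunctions i j) _)
          (smul_mem_regularMaps (entry_mem_regularFunctions k l) _)
      exact mul_mem_regularMaps (mul_mem_regularMaps (pow_mem_regularMaps (hlin 1 1 0 1) _)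
        (pow_mem_regularMaps (hlin 1 0 0 0) _)) (const_mem_regularMaps _)
  obtain ⟨r, hr⟩ := (hp.embed K).toLinearMap.exists_leftInverse_of_injective
    (LinearMap.ker_eq_bot.mpr hp.embed_injective)
  have h2 := map_mem_regularMaps h1 r
  have h3 : ∀ g : SpecialLinearGroup (Fin 2) K, r (bigAct g (hp.embed K a)) = hp.actHom g a := by
    intro g
    rw [← embed_actHom]
    exact congrArg (fun f => f (hp.actHom g a)) hr
  simpa only [h3] using h2

variable (K) in
/-- The action of `SL₂` defined by a pair of opposite roots. -/
noncomputable def action : SL2Action K (CoordRing K σ) where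
  toHom :=
    { toFun := fun g => AlgEquiv.ofAlgHom (hp.actHom g) (hp.actHom g⁻¹)
        (by rw [← actHom_mul, mul_inv_cancel, actHom_one])
        (by rw [← actHom_mul, inv_mul_cancel, actHom_one])
      map_one' := by
        ext1 a
        exact congrArg (fun f => f a) hp.actHom_one
      map_mul' := fun g h => by
        ext1 a
        exact congrArg (fun f => f a) (hp.actHom_mul g h) }
  rational := fun a => mem_regularMaps_iff.mp (hp.actHom_regular a)

theorem embed_action (g : SpecialLinearGroup (Fin 2) K) (a : CoordRing K σ) :
    hp.embed K ((hp.action K).toHom g a) = bigAct g (hp.embed K a) := hp.embed_actHom g a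

theorem action_diag (t : Kˣ) (m : dualMonoid σ) :
    (hp.action K).toHom (diag t) (chi K m) = ((t ^ (ρ' m - ρ m) : Kˣ) : K) • chi K m := by
  apply hp.embed_injective (K := K)
  rw [embed_action, bigAct_embed_chi, map_smul, embed_chi]
  obtain ⟨i, hi⟩ := Int.eq_ofNat_of_zero_le (hp.nonneg m m.2)
  obtain ⟨j, hj⟩ := Int.eq_ofNat_of_zero_le (hp.nonneg' m m.2)
  rw [hi, hj, Int.toNat_natCast, Int.toNat_natCast, _root_.zpow_sub, zpow_natCast, zpow_natCast]
  simp only [diag_val, Matrix.of_apply, Matrix.cons_val', Matrix.cons_val_zero,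
    Matrix.cons_val_one, zero_smul, add_zero, zero_add, smul_pow, smul_mul_assoc,
    mul_smul_comm, smul_smul]
  congr 1

end IsSL2Pair

/-! ### Infinitesimal generators of the constructed action. -/

theorem HasJet.pow {K A : Type*} [Field K] [CommRing A] [Algebra K A] {f : K → A} {v₀ v₁ : A}
    (h : HasJet f v₀ v₁) (n : ℕ) :
    HasJet (fun s => f s ^ n) (v₀ ^ n) (n • (v₀ ^ (n - 1) * v₁)) := by
  induction n with
  | zero => simpa using hasJet_const (K := K) (1 : A)
  | succ n ih =>
    have := ih.mul h
    simp only [← pow_succ] at this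
    convert this using 1
    rcases n with _ | n
    · simp
    · simp only [Nat.add_sub_cancel, nsmul_eq_mul]
      push_cast
      ring

theorem isInfinitesimalGenerator_of_chi {γ : K → (CoordRing K σ ≃ₐ[K] CoordRing K σ)}
    (h0 : γ 0 = 1) {D : CoordRing K σ →ₗ[K] CoordRing K σ}
    (h : ∀ m, HasJet (fun s => γ s (chi K m)) (chi K m) (D (chi K m))) :
    IsInfinitesimalGenerator γ D := by
  rw [isInfinitesimalGenerator_iff, h0]
  intro a
  rw [AlgEquiv.one_apply]
  induction a using AddMonoidAlgebra.induction_linear with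
  | zero => simpa using hasJet_const (K := K) (0 : CoordRing K σ)
  | add a b ha hb =>
    simp only [map_add]
    exact ha.add hb
  | single m c =>
    have : (AddMonoidAlgebra.single m c : CoordRing K σ) = c • chi K m := by simp [chi]
    rw [this]
    simp only [map_smul]
    exact (h m).map (LinearMap.lsmul K (CoordRing K σ) c)

theorem rootDerivation_chi_eq_zero {e : M} (he : IsRoot σ e) {m : dualMonoid σ}
    (hm : he.ray (m : M) = 0) : rootDerivation K he (chi K m) = 0 := by
  simp [rootDerivation, chi, hm]

namespace IsSL2Pair

variable {e : M} {ρ ρ' : DualLattice M} (hp : IsSL2Pair σ e ρ ρ')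

theorem hasJet_of_embed {f : K → CoordRing K σ} {v₀ v₁ : CoordRing K σ}
    (h : HasJet (fun s => hp.embed K (f s)) (hp.embed K v₀) (hp.embed K v₁)) : HasJet f v₀ v₁ := by
  obtain ⟨r, hr⟩ := (hp.embed K).toLinearMap.exists_leftInverse_of_injective
    (LinearMap.ker_eq_bot.mpr hp.embed_injective)
  have hr' : ∀ a, r (hp.embed K a) = a := fun a => congrArg (fun f => f a) hr
  have := h.map r
  simpa only [hr'] using this

theorem isInfinitesimalGenerator_upper (he : IsRoot σ e) (hρ : he.ray = ρ) :
    IsInfinitesimalGenerator (fun s => (hp.action K).toHom (upper s)) (rootDerivation K he) := by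
  refine isInfinitesimalGenerator_of_chi (by simp only [upper_zero, map_one]) fun m => ?_
  apply hp.hasJet_of_embed
  simp only [embed_action, embed_chi]
  have h1 := ((hasJet_affine (K := K) (varX K M) (varY K M)).pow (ρ m).toNat).mul
    (hasJet_const (K := K) (varY K M ^ (ρ' m).toNat * monZ K ((m : M) + ρ m • e)))
  simp only [mul_zero, zero_add, ← mul_assoc] at h1
  have h2 : hp.embed K (rootDerivation K he (chi K m)) =
      (ρ m).toNat • (varX K M ^ ((ρ m).toNat - 1) * varY K M) * varY K M ^ (ρ' m).toNat *
        monZ K ((m : M) + ρ m • e) := by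
    have hnn := hp.nonneg m m.2
    -- When `ρ m = 0`, the vector `m + e` is outside the dual monoid and both sides vanish;
    -- otherwise the monomial with one `x` replaced by `y` is `χ^(m + e)`.
    rcases eq_or_ne (ρ m) 0 with h0 | h0
    · rw [rootDerivation_chi_eq_zero he (by rw [hρ]; exact h0), h0]
      simp
    · obtain ⟨n, hn⟩ := Int.eq_succ_of_zero_lt (lt_of_le_of_ne hnn h0.symm)
      have hn' : (ρ m).toNat = n + 1 := by omega
      obtain ⟨m', hm', hm''⟩ := hp.monomial_mem_range (K := K) m (i := n) (j := (ρ' m).toNat + 1)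
        (by omega)
      have hme : (m : M) + e = m' := by
        rw [hm', show ρ m - n = 1 by omega, one_smul]
      have hmem : (m : M) + e ∈ dualMonoid σ := hme ▸ m'.2
      rw [rootDerivation_chi he m hmem, hρ, map_smul,
        show (⟨(m : M) + e, hmem⟩ : dualMonoid σ) = m' from Subtype.ext hme, hm'', hn',
        Nat.add_sub_cancel, ← Nat.cast_smul_eq_nsmul K]
      rw [show ((ρ m : ℤ) : K) = ((n + 1 : ℕ) : K) by rw [show ρ m = ((n + 1 : ℕ) : ℤ) by omega]; simp]
      simp only [smul_mul_assoc]
      congr 1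
      ring
  rw [h2]
  refine h1.congr fun s => ?_
  simp [bigAct_varX, bigAct_varY, bigAct_monZ]

theorem isInfinitesimalGenerator_lower (he : IsRoot σ (-e)) (hρ : he.ray = ρ') :
    IsInfinitesimalGenerator (fun s => (hp.action K).toHom (lower s)) (rootDerivation K he) := by
  refine isInfinitesimalGenerator_of_chi (by simp only [lower_zero, map_one]) fun m => ?_
  apply hp.hasJet_of_embed
  simp only [embed_action, embed_chi]
  have h1 := ((hasJet_affine (K := K) (varY K M) (varX K M)).pow (ρ' m).toNat).mul
    (hasJet_const (K := K) (varX K M ^ (ρ m).toNat * monZ K ((m : M) + ρ m • e)))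
  simp only [mul_zero, zero_add, ← mul_assoc] at h1
  have h2 : hp.embed K (rootDerivation K he (chi K m)) =
      (ρ' m).toNat • (varY K M ^ ((ρ' m).toNat - 1) * varX K M) * varX K M ^ (ρ m).toNat *
        monZ K ((m : M) + ρ m • e) := by
    have hnn := hp.nonneg' m m.2
    have hnn' := hp.nonneg m m.2
    rcases eq_or_ne (ρ' m) 0 with h0 | h0
    · rw [rootDerivation_chi_eq_zero he (by rw [hρ]; exact h0), h0]
      simp
    · obtain ⟨n, hn⟩ := Int.eq_succ_of_zero_lt (lt_of_le_of_ne hnn h0.symm)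
      have hn' : (ρ' m).toNat = n + 1 := by omega
      obtain ⟨m', hm', hm''⟩ := hp.monomial_mem_range (K := K) m (i := (ρ m).toNat + 1) (j := n)
        (by omega)
      have hme : (m : M) + -e = m' := by
        rw [hm', show ρ m - ((ρ m).toNat + 1 : ℕ) = -1 by omega, neg_smul, one_smul]
      have hmem : (m : M) + -e ∈ dualMonoid σ := hme ▸ m'.2
      rw [rootDerivation_chi he m hmem, hρ, map_smul,
        show (⟨(m : M) + -e, hmem⟩ : dualMonoid σ) = m' from Subtype.ext hme, hm'', hn',
        Nat.add_sub_cancel, ← Nat.cast_smul_eq_nsmul K]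
      rw [show ((ρ' m : ℤ) : K) = ((n + 1 : ℕ) : K) by rw [show ρ' m = ((n + 1 : ℕ) : ℤ) by omega]; simp]
      simp only [smul_mul_assoc]
      congr 1
      ring
  rw [h2]
  have h3 : varY K M ^ (ρ' m).toNat * varX K M ^ (ρ m).toNat * monZ K ((m : M) + ρ m • e) =
      varX K M ^ (ρ m).toNat * varY K M ^ (ρ' m).toNat * monZ K ((m : M) + ρ m • e) := by ring
  rw [h3] at h1
  refine h1.congr fun s => ?_
  simp only [map_mul, map_pow, bigAct_varX, bigAct_varY, bigAct_monZ, lower_val, Matrix.of_apply,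
    Matrix.cons_val', Matrix.cons_val_zero, Matrix.cons_val_one, zero_smul, add_zero, one_smul]
  ring

end IsSL2Pair

end Construction

/-! ### Homogeneous locally nilpotent derivations and roots -/

section Roots

variable {M : Type*} [AddCommGroup M] {σ : PointedCone ℚ (RatDual M)}

/-- Iterating the step gives `m + ρ(m) a ∈ σ^∨`; dually, `v ↦ v + v(a) ρ` maps `σ` into itself. It
is the projection along `ρ` onto the hyperplane where `a` vanishes, and by pointedness its kernel in
`σ` is the half-line of `ρ`, which is therefore a face. A ray `τ` with `τ(a) < 0` is the sum of its
projection and of `-τ(a) ρ`, both in `σ`, so the face property makes it proportional, hence equal,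
to `ρ`. -/
theorem isDistinguishedRay_of_step (hfg : Submodule.FG σ) (hpointed : ∀ v ∈ σ, -v ∈ σ → v = 0)
    {ρ : DualLattice M} {a : M} (hnonneg : ∀ m ∈ dualMonoid σ, 0 ≤ ρ m) (ha : ρ a = -1)
    (hstep : ∀ m ∈ dualMonoid σ, 0 < ρ m → m + a ∈ dualMonoid σ) :
    IsDistinguishedRay σ a ρ := by
  have hρσ : toRat ρ ∈ σ := mem_of_nonneg_on_dualMonoid hfg _ fun m hm => by
    rw [toRat_apply]
    exact_mod_cast hnonneg m hm
  have hρa : toRat ρ a = -1 := by rw [toRat_apply, ha]; norm_num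
  have hshift : ∀ n : ℕ, ∀ m ∈ dualMonoid σ, ρ m = n → m + n • a ∈ dualMonoid σ := by
    intro n
    induction n with
    | zero => intro m hm _; simpa using hm
    | succ n ih =>
      intro m hm hmn
      have := ih (m + a) (hstep m hm (by omega)) (by rw [map_add, ha]; omega)
      rwa [succ_nsmul', ← add_assoc]
  have hproj : ∀ v ∈ σ, v + v a • toRat ρ ∈ σ := by
    intro v hv
    refine mem_of_nonneg_on_dualMonoid hfg _ fun m hm => ?_
    obtain ⟨n, hn⟩ := Int.eq_ofNat_of_zero_le (hnonneg m hm)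
    have h := hshift n m hm hn v hv
    rw [map_add, map_nsmul, nsmul_eq_mul] at h
    rw [LinearMap.add_apply, LinearMap.smul_apply, toRat_apply, hn, smul_eq_mul]
    push_cast
    linarith
  have hray : ∀ v ∈ σ, v + v a • toRat ρ = 0 → v ∈ PointedCone.hull ℚ {toRat ρ} := by
    intro v hv h
    rw [mem_hull_singleton_iff]
    refine ⟨-v a, ?_, ?_⟩
    · by_contra hneg
      have hva : 0 < v a := by linarith
      have : -v ∈ σ := by
        rw [← eq_neg_iff_add_eq_zero.mpr ((add_comm _ _).trans h)]
        exact σ.smul_mem hva.le hρσ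
      rw [hpointed v hv this] at hva
      simp at hva
    · rw [neg_smul]
      exact eq_neg_of_add_eq_zero_left h
  refine ⟨⟨isPrimitive_of_apply_eq_neg_one ha, ?_⟩, ha, ?_⟩
  · refine ⟨?_, ?_⟩
    · rw [PointedCone.hull, Submodule.span_le, Set.singleton_subset_iff]
      exact hρσ
    · intro x y c hx hy hc hxy
      refine hray x hx ?_
      obtain ⟨s, hs, hxys⟩ := mem_hull_singleton_iff.mp hxy
      have hsum : c • (x + x a • toRat ρ) + (y + y a • toRat ρ) = 0 := by
        have h1 : c * x a + y a = -s := by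
          have := congrArg (fun f => f a) hxys
          simp only [LinearMap.add_apply, LinearMap.smul_apply, hρa, smul_eq_mul] at this
          linarith
        have h2 : c • (x + x a • toRat ρ) + (y + y a • toRat ρ) =
            (c • x + y) + (c * x a + y a) • toRat ρ := by module
        rw [h2, h1, hxys]
        module
      refine hpointed _ (hproj x hx) ?_
      have h3 : -(x + x a • toRat ρ) = c⁻¹ • (y + y a • toRat ρ) := by
        rw [eq_neg_of_add_eq_zero_right hsum, smul_neg, smul_smul, inv_mul_cancel₀ hc.ne', one_smul]
      rw [h3]
      exact σ.smul_mem (inv_pos.mpr hc).le (hproj y hy)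
  · intro τ hτ hne
    by_contra hneg
    push Not at hneg
    apply hne
    obtain ⟨k, hk⟩ := Int.eq_ofNat_of_zero_le (a := -τ a) (by omega)
    have hk0 : (0 : ℚ) < k := by
      have : 0 < k := by omega
      exact_mod_cast this
    have hτa : toRat τ a = -(k : ℚ) := by
      rw [toRat_apply, show τ a = -(k : ℤ) by omega]
      push_cast
      rfl
    have hmem : (k : ℚ) • toRat ρ + (toRat τ + toRat τ a • toRat ρ) ∈
        PointedCone.hull ℚ {toRat τ} := by
      rw [hτa, show (k : ℚ) • toRat ρ + (toRat τ + (-(k : ℚ)) • toRat ρ) = toRat τ by module]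
      exact Submodule.mem_span_singleton_self _
    obtain ⟨c, -, hc⟩ := mem_hull_singleton_iff.mp
      (hτ.2.mem_of_smul_add_mem hρσ (hproj _ hτ.mem) hk0 hmem)
    have hck : c * k = 1 := by
      have := congrArg (fun f => f a) hc
      simp only [LinearMap.smul_apply, hρa, hτa, smul_eq_mul] at this
      linarith
    have hτρ : τ = (k : ℤ) • ρ := by
      apply toRat_injective
      have h1 : toRat ((k : ℤ) • ρ) = (k : ℚ) • toRat ρ := by
        ext m
        simp [toRat_apply]
      rw [h1, hc, smul_smul, mul_comm, hck, one_smul]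
    have hunit := hτ.1 _ _ hτρ
    rw [Int.isUnit_iff] at hunit
    rw [hτρ, hunit.resolve_right (by omega), one_smul]

variable {K : Type*} [Field K]

/-- The operator `D` is given by `χ^m ↦ f(m) χ^{m + a}`. -/
structure HasSymbol (D : CoordRing K σ →ₗ[K] CoordRing K σ) (a : M) (f : M →+ K) : Prop where
  apply : ∀ m m' : dualMonoid σ, (m' : M) = m + a → D (chi K m) = f m • chi K m'
  eq_zero : ∀ m : dualMonoid σ, (m : M) + a ∉ dualMonoid σ → f m = 0
  apply_eq_zero : ∀ m : dualMonoid σ, (m : M) + a ∉ dualMonoid σ → D (chi K m) = 0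

theorem HasSymbol.hasWeight {D : CoordRing K σ →ₗ[K] CoordRing K σ} {a : M} {f : M →+ K}
    (h : HasSymbol D a f) : HasWeight D a := by
  intro t
  refine linearMap_ext_chi fun m => ?_
  rw [conjEnd_apply, ← map_inv, torusAction_chi, map_smul, map_smul, LinearMap.smul_apply]
  by_cases hm : (m : M) + a ∈ dualMonoid σ
  · rw [h.apply m ⟨_, hm⟩ rfl, map_smul, torusAction_chi, t.inv_val, smul_smul, smul_smul,
      smul_smul, t.val_add]
    congr 1
    field_simp [t.val_ne_zero]
  · rw [h.apply_eq_zero m hm, map_zero, smul_zero, smul_zero]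

theorem HasSymbol.smul {D : CoordRing K σ →ₗ[K] CoordRing K σ} {a : M} {f : M →+ K}
    (h : HasSymbol D a f) (c : K) : HasSymbol (c • D) a ((AddMonoidHom.mulLeft c).comp f) where
  apply m m' hm := by
    rw [LinearMap.smul_apply, h.apply m m' hm, smul_smul]
    rfl
  eq_zero m hm := by
    rw [AddMonoidHom.comp_apply, h.eq_zero m hm, map_zero]
  apply_eq_zero m hm := by
    rw [LinearMap.smul_apply, h.apply_eq_zero m hm, smul_zero]

theorem HasSymbol.unique {D D' : CoordRing K σ →ₗ[K] CoordRing K σ} {a : M} {f : M →+ K}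
    (h : HasSymbol D a f) (h' : HasSymbol D' a f) : D = D' := by
  refine linearMap_ext_chi fun m => ?_
  by_cases hm : (m : M) + a ∈ dualMonoid σ
  · rw [h.apply m ⟨_, hm⟩ rfl, h'.apply m ⟨_, hm⟩ rfl]
  · rw [h.apply_eq_zero m hm, h'.apply_eq_zero m hm]

theorem HasSymbol.exists_ne_zero {D : CoordRing K σ →ₗ[K] CoordRing K σ} {a : M} {f : M →+ K}
    (h : HasSymbol D a f) (hD : D ≠ 0) :
    ∃ m m' : dualMonoid σ, (m' : M) = m + a ∧ f m ≠ 0 := by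
  by_contra hcon
  push Not at hcon
  refine hD (linearMap_ext_chi fun m => ?_)
  rw [LinearMap.zero_apply]
  by_cases hm : (m : M) + a ∈ dualMonoid σ
  · rw [h.apply m ⟨_, hm⟩ rfl, hcon m ⟨_, hm⟩ rfl, zero_smul]
  · exact h.apply_eq_zero m hm

/-- Composition of operators of opposite degrees. -/
theorem HasSymbol.comp_apply {D D' : CoordRing K σ →ₗ[K] CoordRing K σ} {a b : M} {f g : M →+ K}
    (h : HasSymbol D a f) (h' : HasSymbol D' b g) (hab : a + b = 0) (m : dualMonoid σ) :
    D (D' (chi K m)) = (g m * (f m + f b)) • chi K m := by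
  by_cases hm : (m : M) + b ∈ dualMonoid σ
  · rw [h'.apply m ⟨_, hm⟩ rfl, map_smul, h.apply ⟨_, hm⟩ m (by
      change (m : M) = (m : M) + b + a
      rw [add_assoc, add_comm b, hab, add_zero]), smul_smul]
    congr 2
    exact map_add f _ _
  · rw [h'.apply_eq_zero m hm, h'.eq_zero m hm, map_zero, zero_mul, zero_smul]

/-- Homogeneity leaves one coefficient for each `m`, and the Leibniz rule on `χ^m χ^n` makes it
additive. If `m + n + a` is outside the dual monoid, so are `m + a` and `n + a`, and all three
coefficients vanish. Additive functions extend to `M`. -/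
theorem HasWeight.exists_symbol [CharZero K] [Module.Free ℤ M] (hfg : Submodule.FG σ)
    (hpointed : ∀ v ∈ σ, -v ∈ σ → v = 0) {D : CoordRing K σ →ₗ[K] CoordRing K σ} {a : M}
    (h : HasWeight D a) (hD : ∀ x y, D (x * y) = x * D y + D x * y) :
    ∃ f : M →+ K, HasSymbol D a f := by
  classical
  have hcoeff : ∀ m m' : dualMonoid σ, (m' : M) ≠ m + a → coeffAt m' (D (chi K m)) = 0 := by
    intro m m' hne
    by_contra hcon
    apply hne
    have : (m' : M) - m = a := eq_of_torus_val_eq (K := K) fun t => by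
      have := coeffAt_conjEnd_torusAction t D m m'
      rw [h t, LinearMap.smul_apply, map_smul, smul_eq_mul] at this
      exact (mul_right_cancel₀ hcon this).symm
    rw [← this]
    abel
  let f₀ : dualMonoid σ → K := fun m =>
    if hm : (m : M) + a ∈ dualMonoid σ then coeffAt ⟨_, hm⟩ (D (chi K m)) else 0
  have hf₀ : ∀ m m' : dualMonoid σ, (m' : M) = m + a → D (chi K m) = f₀ m • chi K m' := by
    intro m m' hmm'
    have hm : (m : M) + a ∈ dualMonoid σ := hmm' ▸ m'.2
    obtain rfl : m' = ⟨_, hm⟩ := Subtype.ext hmm'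
    refine ext_coeffAt fun n => ?_
    rw [map_smul]
    by_cases hn : (⟨_, hm⟩ : dualMonoid σ) = n
    · subst hn
      rw [coeffAt_chi_self, smul_eq_mul, mul_one]
      simp only [f₀, dif_pos hm]
    · rw [coeffAt_chi_of_ne hn, smul_zero]
      exact hcoeff m n fun h => hn (Subtype.ext h.symm)
  have hzero : ∀ m : dualMonoid σ, (m : M) + a ∉ dualMonoid σ → D (chi K m) = 0 := by
    intro m hm
    refine ext_coeffAt fun n => ?_
    rw [map_zero]
    exact hcoeff m n fun h => hm (h ▸ n.2)
  have hf₀' : ∀ m : dualMonoid σ, (m : M) + a ∉ dualMonoid σ → f₀ m = 0 := fun m hm => dif_neg hm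
  have hmul : ∀ m n l : dualMonoid σ, (l : M) = (m + n : dualMonoid σ) + a →
      chi K m * D (chi K n) = f₀ n • chi K l := by
    intro m n l hl
    by_cases hn : (n : M) + a ∈ dualMonoid σ
    · rw [hf₀ n ⟨_, hn⟩ rfl, mul_smul_comm, ← chi_add]
      congr 2
      refine Subtype.ext ?_
      rw [hl]
      simp [add_assoc]
    · rw [hzero n hn, hf₀' n hn, mul_zero, zero_smul]
  have hadd : ∀ m n, f₀ (m + n) = f₀ m + f₀ n := by
    intro m n
    by_cases hmn : ((m + n : dualMonoid σ) : M) + a ∈ dualMonoid σ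
    · have h1 := hD (chi K m) (chi K n)
      rw [← chi_add, hf₀ (m + n) ⟨_, hmn⟩ rfl, hmul m n ⟨_, hmn⟩ rfl, mul_comm,
        hmul n m ⟨_, hmn⟩ (by rw [add_comm n m]), ← add_smul] at h1
      rw [smul_left_injective K (chi_ne_zero _) h1, add_comm]
    · rw [hf₀' _ hmn, hf₀' m, hf₀' n, add_zero]
      · intro hn
        apply hmn
        rw [AddSubmonoid.coe_add, add_assoc]
        exact add_mem m.2 hn
      · intro hm
        apply hmn
        rw [AddSubmonoid.coe_add, add_right_comm]
        exact add_mem hm n.2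
  obtain ⟨f, hf⟩ := exists_extension hfg hpointed (AddMonoidHom.mk' f₀ hadd)
  have hf' : ∀ m : dualMonoid σ, f m = f₀ m := hf
  refine ⟨f, fun m m' hm => ?_, fun m hm => ?_, hzero⟩
  · rw [hf', hf₀ m m' hm]
  · rw [hf', hf₀' m hm]

/-- The symbol of a normalized locally nilpotent derivation is a lattice vector. -/
theorem HasSymbol.exists_dual [CharZero K] (hfg : Submodule.FG σ)
    (hpointed : ∀ v ∈ σ, -v ∈ σ → v = 0) {D : Module.End K (CoordRing K σ)} {a : M}
    {f : M →+ K} (h : HasSymbol D a f) (ha : f a = -1) (hD : ∀ x, ∃ n, (D ^ n) x = 0) :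
    ∃ ρ : DualLattice M, (∀ m, f m = ((ρ m : ℤ) : K)) ∧ ∀ m ∈ dualMonoid σ, 0 ≤ ρ m := by
  -- Each application of `D` lowers the value of `f` by one, and the iterates of `χ^m` can die only
  -- when that value reaches zero; so `f m` is a natural number.
  have key : ∀ (n : ℕ) (m : dualMonoid σ), (D ^ n) (chi K m) = 0 → ∃ j : ℕ, f m = j := by
    intro n
    induction n with
    | zero => intro m hm; exact absurd hm (chi_ne_zero m)
    | succ n ih =>
      intro m hm
      by_cases hfm : f m = 0
      · exact ⟨0, by rw [hfm, Nat.cast_zero]⟩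
      · have hma : (m : M) + a ∈ dualMonoid σ := by
          by_contra hma
          exact hfm (h.eq_zero m hma)
        rw [pow_succ, Module.End.mul_apply, h.apply m ⟨_, hma⟩ rfl, map_smul, smul_eq_zero] at hm
        obtain ⟨j, hj⟩ := ih _ (hm.resolve_left hfm)
        refine ⟨j + 1, ?_⟩
        change f ((m : M) + a) = j at hj
        rw [map_add, ha] at hj
        push_cast
        rw [← hj]
        ring
  have key' : ∀ m : dualMonoid σ, ∃ j : ℕ, f m = j := fun m =>
    (hD (chi K m)).elim fun n hn => key n m hn
  choose j hj using key'
  have hadd : ∀ m n, (j (m + n) : ℤ) = j m + j n := by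
    intro m n
    have : (j (m + n) : K) = j m + j n := by
      rw [← hj, ← hj, ← hj, AddSubmonoid.coe_add, map_add]
    exact_mod_cast this
  obtain ⟨F, hF⟩ := exists_extension hfg hpointed (AddMonoidHom.mk' (fun m => (j m : ℤ)) hadd)
  have hF' : ∀ m : dualMonoid σ, F m = j m := hF
  have hfF : f = (Int.castAddHom K).comp F := by
    refine addMonoidHom_ext_of_dualMonoid hfg hpointed fun m => ?_
    rw [AddMonoidHom.comp_apply, hF', hj]
    simp
  refine ⟨F.toIntLinearMap, fun m => by rw [hfF]; rfl, fun m hm => ?_⟩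
  have := hF' ⟨m, hm⟩
  rw [AddMonoidHom.coe_toIntLinearMap, this]
  positivity

theorem IsRoot.add_mem_dualMonoid [Module.Finite ℤ M] (hfg : Submodule.FG σ)
    (hpointed : ∀ v ∈ σ, -v ∈ σ → v = 0) {e : M} (he : IsRoot σ e) {m : M}
    (hm : m ∈ dualMonoid σ) (hpos : 0 < he.ray m) : m + e ∈ dualMonoid σ := by
  refine mem_dualMonoid_of_rays hfg hpointed fun τ hτ => ?_
  rw [map_add]
  by_cases hτe : τ = he.ray
  · rw [hτe, he.ray_spec.2.1]
    omega
  · exact add_nonneg (hτ.nonneg hm) (he.ray_spec.2.2 τ hτ hτe)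

theorem rootDerivation_hasSymbol [Module.Finite ℤ M] (hfg : Submodule.FG σ)
    (hpointed : ∀ v ∈ σ, -v ∈ σ → v = 0) {e : M} (he : IsRoot σ e) :
    HasSymbol (rootDerivation K he) e ((Int.castAddHom K).comp he.ray.toAddMonoidHom) where
  apply m m' hm := by
    have hme : (m : M) + e ∈ dualMonoid σ := hm ▸ m'.2
    obtain rfl : m' = ⟨_, hme⟩ := Subtype.ext hm
    exact rootDerivation_chi he m hme
  eq_zero m hm := by
    have hnn := he.ray_spec.1.nonneg m.2
    have : he.ray (m : M) = 0 := by
      by_contra hne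
      exact hm (he.add_mem_dualMonoid hfg hpointed m.2 (by omega))
    simp [this]
  apply_eq_zero m hm := by
    simp [rootDerivation, chi, hm]

theorem rootDerivation_ne_zero [CharZero K] [Module.Finite ℤ M] (hfg : Submodule.FG σ)
    (hpointed : ∀ v ∈ σ, -v ∈ σ → v = 0) {e : M} (he : IsRoot σ e) : rootDerivation K he ≠ 0 := by
  intro h0
  have hray := he.ray_spec.1
  obtain ⟨m, hm, hpos⟩ := exists_pos_of_mem hfg hpointed hray.mem (fun h =>
    hray.1.ne_zero (toRat_injective (h.trans (by ext; simp [toRat_apply]))))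
  rw [toRat_apply] at hpos
  have hpos' : 0 < he.ray m := by exact_mod_cast hpos
  have hme := he.add_mem_dualMonoid hfg hpointed hm hpos'
  have h1 := rootDerivation_chi (K := K) he ⟨m, hm⟩ hme
  rw [h0, LinearMap.zero_apply, eq_comm, smul_eq_zero] at h1
  rcases h1 with h1 | h1
  · have : he.ray m = 0 := by exact_mod_cast h1
    omega
  · exact chi_ne_zero _ h1

/-- A normalized homogeneous locally nilpotent derivation comes from a root. -/
theorem HasSymbol.exists_isRoot [CharZero K] [Module.Finite ℤ M] (hfg : Submodule.FG σ)
    (hpointed : ∀ v ∈ σ, -v ∈ σ → v = 0) {D : Module.End K (CoordRing K σ)} {a : M}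
    {f : M →+ K} (h : HasSymbol D a f) (ha : f a = -1) (hD : ∀ x, ∃ n, (D ^ n) x = 0) :
    ∃ he : IsRoot σ a, D = rootDerivation K he := by
  obtain ⟨ρ, hρ, hnonneg⟩ := h.exists_dual hfg hpointed ha hD
  have hdist : IsDistinguishedRay σ a ρ := by
    refine isDistinguishedRay_of_step hfg hpointed hnonneg ?_ fun m hm hpos => ?_
    · have := hρ a
      rw [ha] at this
      exact_mod_cast this.symm
    · by_contra hma
      have := h.eq_zero ⟨m, hm⟩ hma
      rw [hρ] at this
      have : ρ m = 0 := by exact_mod_cast this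
      omega
  have he : IsRoot σ a := ⟨ρ, hdist⟩
  have hray : he.ray = ρ := he.ray_spec.unique hdist
  refine ⟨he, h.unique ?_⟩
  convert rootDerivation_hasSymbol (K := K) hfg hpointed he using 1
  ext m
  rw [hρ, ← hray]
  rfl

end Roots

/-! ### Classification of the adapted compatible actions -/

section Classification

variable {K : Type*} [Field K] [CharZero K]

theorem hom_ext_of_generator {A : Type*} [CommRing A] [Algebra K A]
    {f f' : SpecialLinearGroup (Fin 2) K →* (A ≃ₐ[K] A)} {D D' : A →ₗ[K] A}
    (hu : IsInfinitesimalGenerator (fun s => f (upper s)) D)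
    (hu' : IsInfinitesimalGenerator (fun s => f' (upper s)) D)
    (hl : IsInfinitesimalGenerator (fun s => f (lower s)) D')
    (hl' : IsInfinitesimalGenerator (fun s => f' (lower s)) D') : f = f' := by
  refine hom_ext_upper_lower (fun s => ?_) fun s => ?_
  · exact eq_of_generator_eq (fun s t => by rw [upper_add, map_mul])
      (fun s t => by rw [upper_add, map_mul]) hu hu' s
  · exact eq_of_generator_eq (fun s t => by rw [lower_add, map_mul])
      (fun s t => by rw [lower_add, map_mul]) hl hl' s

variable {M : Type*} [AddCommGroup M] [Module.Free ℤ M] {σ : PointedCone ℚ (RatDual M)}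

/-- The torus rescales `U₊` and `U₋`, so it normalizes the group they generate; an element with
`t.val a ≠ 1` moves `U₊`. -/
theorem isCompatible_of_hasWeight {φ : SL2Action K (CoordRing K σ)} {a : M}
    (hE : HasWeight (φ.differential nilE) a) (hF : HasWeight (φ.differential nilF) (-a))
    (ha : a ≠ 0) (hE0 : φ.differential nilE ≠ 0) : IsCompatible φ := by
  have hconj : ∀ (t : Torus K M) (g : SpecialLinearGroup (Fin 2) K),
      torusAction K σ t * φ.toHom g * (torusAction K σ t)⁻¹ ∈ φ.toHom.range := by
    intro t g
    refine mem_of_upper_lower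
      (H := φ.toHom.range.comap ((MulAut.conj (torusAction K σ t)).toMonoidHom.comp φ.toHom))
      (fun s => ?_) (fun s => ?_) g
    · exact ⟨_, (torusAction_conj_upper hE t s).symm⟩
    · exact ⟨_, (torusAction_conj_lower hF t s).symm⟩
  refine ⟨?_, fun hcent => ?_⟩
  · rintro _ ⟨t, rfl⟩
    rw [Subgroup.mem_normalizer_iff]
    refine fun u => ⟨?_, fun hu => ?_⟩
    · rintro ⟨g, rfl⟩
      exact hconj t g
    · obtain ⟨g, hg⟩ := hu
      have := hconj t⁻¹ g
      rw [hg, show torusAction K σ t⁻¹ = (torusAction K σ t)⁻¹ from map_inv (torusAction K σ) t]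
        at this
      have e : (torusAction K σ t)⁻¹ * (torusAction K σ t * u * (torusAction K σ t)⁻¹) *
          (torusAction K σ t)⁻¹⁻¹ = u := by group
      rwa [e] at this
  · obtain ⟨t, ht⟩ := exists_torus_val_ne_one (K := K) ha
    have h1 : conjEnd (torusAction K σ t) (φ.differential nilE) = φ.differential nilE := by
      refine (φ.isInfinitesimalGenerator_upper.conj (torusAction K σ t)).unique
        φ.isInfinitesimalGenerator_upper fun n => ?_
      have := (Subgroup.mem_centralizer_iff.mp (hcent ⟨t, rfl⟩)) _ ⟨upper (n : K), rfl⟩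
      rw [← this, mul_inv_cancel_right]
    rw [hE t] at h1
    apply ht
    refine smul_left_injective K hE0 ?_
    change t.val a • _ = (1 : K) • _
    rw [h1, one_smul]

theorem SL2Root.ne_zero (e : SL2Roots σ) : (e : M) ≠ 0 := by
  intro h
  have h1 := e.2.1.ray_spec.2.1
  have h2 := map_zero e.2.1.ray
  rw [← h] at h2
  omega

variable [Module.Finite ℤ M]

variable (K) in
/-- The action defined by an `SL₂`-root. -/
noncomputable def rootAction (hfg : Submodule.FG σ) (hpointed : ∀ v ∈ σ, -v ∈ σ → v = 0)
    (e : SL2Roots σ) : SL2Action K (CoordRing K σ) :=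
  (isSL2Pair hfg hpointed e).action K

section RootAction

variable (hfg : Submodule.FG σ) (hpointed : ∀ v ∈ σ, -v ∈ σ → v = 0) (e : SL2Roots σ)

theorem rootAction_upper :
    IsInfinitesimalGenerator (fun s => (rootAction K hfg hpointed e).toHom (upper s))
      (rootDerivation K e.2.1) :=
  (isSL2Pair hfg hpointed e).isInfinitesimalGenerator_upper e.2.1 rfl

theorem rootAction_lower :
    IsInfinitesimalGenerator (fun s => (rootAction K hfg hpointed e).toHom (lower s))
      (rootDerivation K e.2.2) :=
  (isSL2Pair hfg hpointed e).isInfinitesimalGenerator_lower e.2.2 rfl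

theorem rootAction_differential_nilE :
    (rootAction K hfg hpointed e).differential nilE = rootDerivation K e.2.1 :=
  (rootAction K hfg hpointed e).isInfinitesimalGenerator_upper.unique
    (rootAction_upper hfg hpointed e) fun _ => rfl

theorem rootAction_differential_nilF :
    (rootAction K hfg hpointed e).differential nilF = rootDerivation K e.2.2 :=
  (rootAction K hfg hpointed e).isInfinitesimalGenerator_lower.unique
    (rootAction_lower hfg hpointed e) fun _ => rfl

theorem rootAction_hasWeight_nilE :
    HasWeight ((rootAction K hfg hpointed e).differential nilE) (e : M) := by
  rw [rootAction_differential_nilE]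
  exact (rootDerivation_hasSymbol hfg hpointed e.2.1).hasWeight

theorem rootAction_hasWeight_nilF :
    HasWeight ((rootAction K hfg hpointed e).differential nilF) (-(e : M)) := by
  rw [rootAction_differential_nilF]
  exact (rootDerivation_hasSymbol hfg hpointed e.2.2).hasWeight

theorem rootAction_differential_nilE_ne_zero :
    (rootAction K hfg hpointed e).differential nilE ≠ 0 := by
  rw [rootAction_differential_nilE]
  exact rootDerivation_ne_zero hfg hpointed e.2.1

theorem rootAction_isCompatible : IsCompatible (rootAction K hfg hpointed e) :=
  isCompatible_of_hasWeight (rootAction_hasWeight_nilE hfg hpointed e)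
    (rootAction_hasWeight_nilF hfg hpointed e) (SL2Root.ne_zero e)
    (rootAction_differential_nilE_ne_zero hfg hpointed e)

theorem rootAction_isAdapted : IsAdapted (rootAction K hfg hpointed e) :=
  isAdapted_of_hasWeight hfg hpointed (rootAction_hasWeight_nilE hfg hpointed e)
    (rootAction_hasWeight_nilF hfg hpointed e)

theorem generators_iff_eq_rootAction (ψ : SL2Action K (CoordRing K σ)) :
    (IsInfinitesimalGenerator (fun s => ψ.toHom (upper s)) (rootDerivation K e.2.1) ∧
      IsInfinitesimalGenerator (fun s => ψ.toHom (lower s)) (rootDerivation K e.2.2)) ↔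
      ψ = rootAction K hfg hpointed e := by
  constructor
  · rintro ⟨hu, hl⟩
    exact SL2Action.ext (hom_ext_of_generator hu (rootAction_upper hfg hpointed e) hl
      (rootAction_lower hfg hpointed e))
  · rintro rfl
    exact ⟨rootAction_upper hfg hpointed e, rootAction_lower hfg hpointed e⟩

theorem rootAction_diag (t : Kˣ) (m : dualMonoid σ) :
    (rootAction K hfg hpointed e).toHom (diag t) (chi K m) =
      ((t ^ (rayDiff e (m : M)) : Kˣ) : K) • chi K m :=
  (isSL2Pair hfg hpointed e).action_diag t m

/-- The root is determined by the conjugacy class of the action. -/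
theorem eq_of_rootAction_conj {e e' : SL2Roots σ} {t : Torus K M}
    (h : ∀ g, (rootAction K hfg hpointed e').toHom g =
      torusAction K σ t * (rootAction K hfg hpointed e).toHom g * (torusAction K σ t)⁻¹) :
    e = e' := by
  have h1 : conjEnd (torusAction K σ t) (rootDerivation K e.2.1) = rootDerivation K e'.2.1 :=
    ((rootAction_upper hfg hpointed e).conj (torusAction K σ t)).unique
      (rootAction_upper hfg hpointed e') fun n => (h _).symm
  have hw := (rootDerivation_hasSymbol (K := K) hfg hpointed e.2.1).hasWeight
  rw [hw t] at h1
  have hw' := hw.smul (t.val (e : M))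
  rw [h1] at hw'
  exact Subtype.ext (HasWeight.unique (rootDerivation_ne_zero hfg hpointed e'.2.1) hw'
    (rootDerivation_hasSymbol hfg hpointed e'.2.1).hasWeight)

end RootAction

theorem conjEnd_torusAction_comm (s t : Torus K M) (D : CoordRing K σ →ₗ[K] CoordRing K σ) :
    conjEnd (torusAction K σ s) (conjEnd (torusAction K σ t) D) =
      conjEnd (torusAction K σ t) (conjEnd (torusAction K σ s) D) := by
  rw [← conjEnd_mul, ← conjEnd_mul, ← map_mul, ← map_mul, show s * t = t * s from mul_comm s t]

/-- The torus scales an eigenvector of `diag(2, 1/2)` in `𝔰𝔩₂` with one-dimensional eigenspace. -/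
theorem exists_hasWeight_of_eigen [IsAlgClosed K] {φ : SL2Action K (CoordRing K σ)}
    (h : IsCompatible φ) (hφ : IsAdapted φ) {X : Matrix (Fin 2) (Fin 2) K} (hX : X 1 1 = -X 0 0)
    {l : Kˣ} {c : K} (hXc : (diag l).1 * X * ((diag l)⁻¹).1 = c • X)
    (hc : ∀ Y : Matrix (Fin 2) (Fin 2) K, Y 1 1 = -Y 0 0 →
      (diag l).1 * Y * ((diag l)⁻¹).1 = c • Y → ∃ d : K, Y = d • X) :
    ∃ a, HasWeight (φ.differential X) a := by
  refine exists_hasWeight_of_forall fun t => ?_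
  obtain ⟨Y, hY, hYt⟩ := φ.exists_conjEnd_differential (torusAction K σ t) (h.exists_conj t) hX
  obtain ⟨s, hs⟩ := hφ l
  -- As `diag l` acts through the commutative group `𝕋`, conjugation by `t` preserves its
  -- eigenspaces in the Lie algebra.
  have h1 : φ.differential ((diag l).1 * Y * ((diag l)⁻¹).1) = φ.differential (c • Y) := by
    rw [← φ.conjEnd_differential _ hY, ← hYt, ← hs, conjEnd_torusAction_comm, hs,
      φ.conjEnd_differential _ hX, hXc, map_smul, map_smul, map_smul, hYt]
  have htr : ((diag l).1 * Y * ((diag l)⁻¹).1) 1 1 = -((diag l).1 * Y * ((diag l)⁻¹).1) 0 0 := by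
    rw [conj_apply]
    simp [hY]
    ring
  have h2 := φ.differential_injective h.differential_nilE_ne_zero htr (by simp [hY]) h1
  obtain ⟨d, rfl⟩ := hc Y hY h2
  exact ⟨d, by rw [hYt, map_smul]⟩

/-- The element `diag(2, 1/2)` has the distinct eigenvalues `4, 1, 1/4` on `𝔰𝔩₂`, so the lines of
`nilE` and `nilF` are eigenspaces and are preserved by `𝕋`. Their weights are opposite because `[E,
[E, F]] = -2E`. -/
theorem exists_hasWeight_of_isAdapted [IsAlgClosed K] {φ : SL2Action K (CoordRing K σ)}
    (h : IsCompatible φ) (hφ : IsAdapted φ) :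
    ∃ a : M, HasWeight (φ.differential nilE) a ∧ HasWeight (φ.differential nilF) (-a) := by
  set l : Kˣ := Units.mk0 2 two_ne_zero with hl
  obtain ⟨a, ha⟩ := exists_hasWeight_of_eigen h hφ isNilp_nilE.1 (diag_conj_nilE l)
    (fun Y hY hYl => by
      rw [conj_apply] at hYl
      have h0 := congrFun (congrFun hYl 0) 0
      have h1 := congrFun (congrFun hYl 1) 0
      simp [hl] at h0 h1
      have e0 : Y 0 0 = 0 := by linear_combination (-1 / 3) * h0
      have e1 : Y 1 0 = 0 := by linear_combination (-4 / 15) * h1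
      refine ⟨Y 0 1, ?_⟩
      ext i j
      fin_cases i <;> fin_cases j <;> simp [nilE, hY, e0, e1])
  obtain ⟨b, hb⟩ := exists_hasWeight_of_eigen h hφ isNilp_nilF.1 (diag_conj_nilF l)
    (fun Y hY hYl => by
      rw [conj_apply] at hYl
      have h0 := congrFun (congrFun hYl 0) 0
      have h1 := congrFun (congrFun hYl 0) 1
      simp [hl] at h0 h1
      have e0 : Y 0 0 = 0 := by linear_combination (4 / 3) * h0
      have e1 : Y 0 1 = 0 := by linear_combination (4 / 15) * h1
      refine ⟨Y 1 0, ?_⟩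
      ext i j
      fin_cases i <;> fin_cases j <;> simp [nilF, hY, e0, e1])
  have hbr := ha.bracket hb
  rw [φ.differential_bracket isNilp_nilE.1 isNilp_nilF.1] at hbr
  have hbr2 := ha.bracket hbr
  rw [φ.differential_bracket isNilp_nilE.1 (by rw [nilE_bracket_nilF]; simp), nilE_bracket_nilF,
    nilE_bracket, show (!![!![(1 : K), 0; 0, -1] 1 0, !![(1 : K), 0; 0, -1] 1 1 -
      !![(1 : K), 0; 0, -1] 0 0; 0, -!![(1 : K), 0; 0, -1] 1 0]) = (-2 : K) • nilE by
      ext i j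
      fin_cases i <;> fin_cases j <;> norm_num [nilE], map_smul] at hbr2
  have hab := HasWeight.unique h.differential_nilE_ne_zero (hbr2.of_smul (by norm_num)) ha
  have hb' : b = -a := by
    have h0 : a + b = 0 := by simpa using hab
    exact eq_neg_of_add_eq_zero_right h0
  exact ⟨a, ha, hb' ▸ hb⟩

/-- The element `[E, F]` acts on `χ^m` by `-(f(a) g(m) + g(a) f(m))`. Evaluating `[E, [E, F]] = -2E`
at some `m` with `f(m) ≠ 0` gives `2 f(m) (f(a) g(a) + 1) = 0`. This is what permits normalizing `E`
and `F` by inverse scalars. -/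
theorem mul_eq_neg_one_of_symbols {φ : SL2Action K (CoordRing K σ)} {a : M} {f g : M →+ K}
    (hE : HasSymbol (φ.differential nilE) a f) (hF : HasSymbol (φ.differential nilF) (-a) g)
    (hE0 : φ.differential nilE ≠ 0) : f a * g a = -1 := by
  have hH : ∀ m : dualMonoid σ, φ.differential !![1, 0; 0, -1] (chi K m) =
      (-(f a * g m + g a * f m)) • chi K m := by
    intro m
    rw [← nilE_bracket_nilF, ← φ.differential_bracket isNilp_nilE.1 isNilp_nilF.1,
      LinearMap.sub_apply, LinearMap.comp_apply, LinearMap.comp_apply,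
      hE.comp_apply hF (add_neg_cancel a), hF.comp_apply hE (neg_add_cancel a), ← sub_smul,
      map_neg]
    congr 1
    ring
  obtain ⟨m, m', hm, hfm⟩ := hE.exists_ne_zero hE0
  have hbr := φ.differential_bracket (X := nilE) (Y := !![1, 0; 0, -1]) isNilp_nilE.1 (by simp)
  rw [nilE_bracket, show (!![!![(1 : K), 0; 0, -1] 1 0, !![(1 : K), 0; 0, -1] 1 1 -
      !![(1 : K), 0; 0, -1] 0 0; 0, -!![(1 : K), 0; 0, -1] 1 0]) = (-2 : K) • nilE by
      ext i j
      fin_cases i <;> fin_cases j <;> norm_num [nilE], map_smul] at hbr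
  have h1 := congrArg (fun D => D (chi K m)) hbr
  simp only [LinearMap.sub_apply, LinearMap.comp_apply, LinearMap.smul_apply, hH, map_smul,
    hE.apply m m' hm, smul_smul, ← sub_smul] at h1
  have h2 := smul_left_injective K (chi_ne_zero _) h1
  rw [hm, map_add, map_add] at h2
  have h3 : (2 * f m) * (f a * g a + 1) = 0 := by linear_combination h2
  have h4 := (mul_eq_zero.mp h3).resolve_left (mul_ne_zero two_ne_zero hfm)
  exact eq_neg_of_add_eq_zero_left h4

/-- Every adapted compatible action comes from an `SL₂`-root, up to conjugation. -/
theorem exists_rootAction_conj [IsAlgClosed K] (hfg : Submodule.FG σ)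
    (hpointed : ∀ v ∈ σ, -v ∈ σ → v = 0) {φ : SL2Action K (CoordRing K σ)}
    (h : IsCompatible φ) (hφ : IsAdapted φ) : ∃ (e : SL2Roots σ) (t : Torus K M),
      ∀ g, φ.toHom g =
        torusAction K σ t * (rootAction K hfg hpointed e).toHom g * (torusAction K σ t)⁻¹ := by
  obtain ⟨a, hEa, hFa⟩ := exists_hasWeight_of_isAdapted h hφ
  have hgE := φ.isInfinitesimalGenerator_upper
  have hgF := φ.isInfinitesimalGenerator_lower
  obtain ⟨f, hf⟩ := hEa.exists_symbol hfg hpointed (hgE.leibniz (by simp only [upper_zero, map_one]))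
  obtain ⟨g, hg⟩ := hFa.exists_symbol hfg hpointed (hgF.leibniz (by simp only [lower_zero, map_one]))
  have hfg' := mul_eq_neg_one_of_symbols hf hg h.differential_nilE_ne_zero
  have hfa : f a ≠ 0 := left_ne_zero_of_mul (hfg' ▸ neg_ne_zero.mpr one_ne_zero)
  have hc0 : -f a ≠ 0 := neg_ne_zero.mpr hfa
  -- By `f a * g a = -1`, scaling `E` by `(-f a)⁻¹` and `F` by `-f a` gives both symbols the value
  -- `-1` at their own degrees `a` and `-a`. Scaling a generator reparametrizes its group, so local
  -- nilpotency persists.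
  obtain ⟨he, hDe⟩ := (hf.smul (-f a)⁻¹).exists_isRoot hfg hpointed
    (by simp [inv_neg, hfa])
    (iterate_generator_eventually_zero (fun s t => by rw [mul_add, φ.toHom_upper_add])
      (hgE.comp_mul _))
  obtain ⟨he', hDe'⟩ := (hg.smul (-f a)).exists_isRoot hfg hpointed
    (by simp [hfg'])
    (iterate_generator_eventually_zero (fun s t => by rw [mul_add, φ.toHom_lower_add])
      (hgF.comp_mul _))
  set e : SL2Roots σ := ⟨a, he, he'⟩
  set c : Kˣ := Units.mk0 (-f a) hc0 with hc
  -- The ray takes the value `-1` at `a`, so the cocharacter at `c⁻¹` has value `c = -f a` there;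
  -- conjugation by it undoes the normalization of both generators.
  set t : Torus K M := cocharacter he.ray c⁻¹ with ht
  have hta : t.val a = -f a := by
    rw [ht, cocharacter_val, he.ray_spec.2.1]
    simp [hc]
  have hu := (rootAction_upper (K := K) hfg hpointed e).conj (torusAction K σ t)
  have hl := (rootAction_lower (K := K) hfg hpointed e).conj (torusAction K σ t)
  have hu' : conjEnd (torusAction K σ t) (rootDerivation K e.2.1) = φ.differential nilE := by
    rw [(rootDerivation_hasSymbol hfg hpointed e.2.1).hasWeight t, hta, ← hDe, smul_smul,
      mul_inv_cancel₀ hc0, one_smul]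
  have hl' : conjEnd (torusAction K σ t) (rootDerivation K e.2.2) = φ.differential nilF := by
    rw [(rootDerivation_hasSymbol hfg hpointed e.2.2).hasWeight t, t.val_neg, hta, ← hDe',
      smul_smul, inv_mul_cancel₀ hc0, one_smul]
  refine ⟨e, t, fun x => ?_⟩
  have := hom_ext_of_generator (f := φ.toHom)
    (f' := (MulAut.conj (torusAction K σ t)).toMonoidHom.comp (rootAction K hfg hpointed e).toHom)
    hgE (hu' ▸ hu) hgF (hl' ▸ hl)
  exact congrArg (fun F => F x) this

end Classification

/-! ### Effectiveness -/

section Effective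

variable {K : Type*} [Field K] [CharZero K]

/-- If `g` acts trivially, conjugation by it fixes the differential, and injectivity of the
differential makes `g` commute with `U₊` and `U₋` at parameter `1`. -/
theorem SL2Action.eq_one_or_neg_one_of_toHom_eq_one {A : Type*} [CommRing A] [Algebra K A]
    {φ : SL2Action K A} (hE : φ.differential nilE ≠ 0) {g : SpecialLinearGroup (Fin 2) K}
    (hg : φ.toHom g = 1) : g = 1 ∨ g = -1 := by
  have key : ∀ {X : Matrix (Fin 2) (Fin 2) K} (hX : IsNilp X),
      g * unip hX 1 = unip hX 1 * g := by
    intro X hX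
    have h1 := φ.conjEnd_differential g hX.1
    rw [hg, conjEnd_one] at h1
    have h2 := φ.differential_injective hE hX.1 (hX.conj g).1 h1
    have h3 : unip (hX.conj g) 1 = unip hX 1 := by
      apply Subtype.ext
      rw [unip_val, unip_val, ← h2]
    rw [unip_conj hX] at h3
    exact mul_inv_eq_iff_eq_mul.mp h3
  refine eq_one_or_neg_one_of_commute ?_ ?_
  · simpa only [unip_nilE] using key isNilp_nilE
  · simpa only [unip_nilF] using key isNilp_nilF

variable {M : Type*} [AddCommGroup M] {σ : PointedCone ℚ (RatDual M)}

theorem rayDiff_apply_root (e : SL2Roots σ) : rayDiff e (e : M) = 2 := by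
  have h1 := e.2.1.ray_spec.2.1
  have h2 := e.2.2.ray_spec.2.1
  rw [map_neg] at h2
  rw [rayDiff, LinearMap.sub_apply]
  omega

/-- The value at `e` is `2`, so the only possible obstruction to primitivity is divisibility by two.
-/
theorem isPrimitive_rayDiff_iff (e : SL2Roots σ) :
    IsPrimitive (rayDiff e) ↔ ¬ ∃ q : DualLattice M, rayDiff e = (2 : ℤ) • q := by
  constructor
  · rintro h ⟨q, hq⟩
    have := h 2 q hq
    rw [Int.isUnit_iff] at this
    omega
  · intro h k μ hk
    have h2 := rayDiff_apply_root e
    rw [hk, LinearMap.smul_apply, smul_eq_mul] at h2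
    by_contra hunit
    apply h
    rcases (Int.prime_two.irreducible.isUnit_or_isUnit h2.symm) with hu | hu
    · exact absurd hu hunit
    · rcases Int.isUnit_iff.mp hu with h1 | h1
      · refine ⟨μ, ?_⟩
        rw [hk, show k = 2 by rw [h1] at h2; omega]
      · refine ⟨-μ, ?_⟩
        rw [hk, show k = -2 by rw [h1] at h2; omega]
        simp

theorem exists_eq_two_smul {n : DualLattice M} (h : ∀ m, (2 : ℤ) ∣ n m) :
    ∃ q : DualLattice M, n = (2 : ℤ) • q := by
  choose q hq using h
  refine ⟨(AddMonoidHom.mk' q fun a b => ?_).toIntLinearMap, LinearMap.ext fun m => ?_⟩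
  · have := map_add n a b
    rw [hq, hq, hq] at this
    omega
  · rw [hq]
    rfl

variable [Module.Free ℤ M] [Module.Finite ℤ M] (hfg : Submodule.FG σ)
  (hpointed : ∀ v ∈ σ, -v ∈ σ → v = 0) (e : SL2Roots σ)

/-- The element `-1 = diag(-1)` acts on `χ^m` by the parity of `⟨m, ρ_{-e} - ρ_e⟩`. Evenness on the
dual monoid implies evenness on all of `M`, because homomorphisms to `ZMod 2` are determined there.
-/
theorem rootAction_neg_one_eq_one_iff :
    (rootAction K hfg hpointed e).toHom (-1) = 1 ↔ ¬ IsPrimitive (rayDiff e) := by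
  rw [isPrimitive_rayDiff_iff, not_not, neg_one_eq_diag]
  constructor
  · intro h
    have heven : ∀ m : dualMonoid σ, Even (rayDiff e (m : M)) := by
      intro m
      have h1 := rootAction_diag (K := K) hfg hpointed e (-1) m
      rw [h, AlgEquiv.one_apply] at h1
      by_contra hodd
      rw [Int.not_even_iff_odd] at hodd
      rw [hodd.neg_one_zpow] at h1
      have h2 : (1 : K) • chi K m = ((-1 : Kˣ) : K) • chi K m := by rw [one_smul]; exact h1
      have h3 := smul_left_injective K (chi_ne_zero _) h2
      norm_num at h3
    have hzero : (Int.castAddHom (ZMod 2)).comp (rayDiff e).toAddMonoidHom = 0 :=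
      addMonoidHom_ext_of_dualMonoid hfg hpointed fun m =>
        (ZMod.intCast_zmod_eq_zero_iff_dvd _ 2).mpr (heven m).two_dvd
    exact exists_eq_two_smul fun m =>
      (ZMod.intCast_zmod_eq_zero_iff_dvd _ 2).mp (congrArg (fun f => f m) hzero)
  · rintro ⟨q, hq⟩
    refine algEquiv_ext_chi fun m => ?_
    rw [rootAction_diag, hq, LinearMap.smul_apply, smul_eq_mul, (even_two_mul _).neg_one_zpow,
      Units.val_one, one_smul]
    rfl

theorem rootAction_injective_iff :
    Function.Injective (rootAction K hfg hpointed e).toHom ↔ IsPrimitive (rayDiff e) := by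
  have hiff := rootAction_neg_one_eq_one_iff (K := K) hfg hpointed e
  constructor
  · intro hinj
    by_contra hprim
    have h1 := hinj ((hiff.mpr hprim).trans (map_one _).symm)
    have h2 := congrArg (fun g : SpecialLinearGroup (Fin 2) K => g.1 0 0) h1
    norm_num at h2
  · intro hprim
    rw [injective_iff_map_eq_one]
    intro g hg
    rcases SL2Action.eq_one_or_neg_one_of_toHom_eq_one
      (rootAction_differential_nilE_ne_zero hfg hpointed e) hg with h | h
    · exact h
    · rw [h] at hg
      exact absurd hprim (hiff.mp hg)

theorem exists_eq_two_smul_isPrimitive (h : ¬ IsPrimitive (rayDiff e)) :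
    ∃ q : DualLattice M, rayDiff e = (2 : ℤ) • q ∧ IsPrimitive q := by
  rw [isPrimitive_rayDiff_iff, not_not] at h
  obtain ⟨q, hq⟩ := h
  refine ⟨q, hq, isPrimitive_of_apply_eq_one (m := (e : M)) ?_⟩
  have := rayDiff_apply_root e
  rw [hq, LinearMap.smul_apply, smul_eq_mul] at this
  omega

theorem exists_projective_rootAction (h : ¬ IsPrimitive (rayDiff e)) :
    ∃ φbar : ProjectiveSpecialLinearGroup (Fin 2) K →* (CoordRing K σ ≃ₐ[K] CoordRing K σ),
      Function.Injective φbar ∧ ∀ g : SpecialLinearGroup (Fin 2) K,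
        φbar (QuotientGroup.mk g) = (rootAction K hfg hpointed e).toHom g := by
  have hle : ∀ g ∈ Subgroup.center (SpecialLinearGroup (Fin 2) K),
      (rootAction K hfg hpointed e).toHom g = 1 := by
    intro g hg
    rcases mem_center_iff.mp hg with rfl | rfl
    · exact map_one _
    · exact (rootAction_neg_one_eq_one_iff hfg hpointed e).mpr h
  refine ⟨QuotientGroup.lift _ (rootAction K hfg hpointed e).toHom hle, ?_, fun g => rfl⟩
  rw [injective_iff_map_eq_one]
  intro x
  induction x using QuotientGroup.induction_on with | H g
  intro hg
  rw [QuotientGroup.eq_one_iff, mem_center_iff]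
  exact SL2Action.eq_one_or_neg_one_of_toHom_eq_one
    (rootAction_differential_nilE_ne_zero hfg hpointed e) hg

end Effective

end ToricSL2

/-! ### Assembly of the three statements. -/

theorem theorem2p10 {K : Type*} [Field K] [IsAlgClosed K] [CharZero K]
    {M : Type*} [AddCommGroup M] [Module.Free ℤ M] [Module.Finite ℤ M]
    (σ : PointedCone ℚ (ToricSL2.RatDual M)) (hfg : Submodule.FG σ)
    (hpointed : ∀ v ∈ σ, -v ∈ σ → v = 0) :
    -- every compatible action is, up to an inner automorphism of `SL₂`, an adapted one
    (∀ φ : ToricSL2.SL2Action K (ToricSL2.CoordRing K σ), ToricSL2.IsCompatible φ →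
      ∃ (ψ : ToricSL2.AdaptedAction K σ) (h : Matrix.SpecialLinearGroup (Fin 2) K),
        ∀ g, ψ.1.toHom g = φ.toHom (h * g * h⁻¹)) ∧
    ∃ Φ : ToricSL2.SL2Roots σ → ToricSL2.AdaptedAction K σ,
      -- `Φ e` is the one action whose `U₊` and `U₋` are generated by `∂_e` and `∂_{-e}`
      (∀ (e : ToricSL2.SL2Roots σ) (ψ : ToricSL2.SL2Action K (ToricSL2.CoordRing K σ)),
        (ToricSL2.IsInfinitesimalGenerator (fun s => ψ.toHom (ToricSL2.upper s))
            (ToricSL2.rootDerivation K e.2.1) ∧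
          ToricSL2.IsInfinitesimalGenerator (fun s => ψ.toHom (ToricSL2.lower s))
            (ToricSL2.rootDerivation K e.2.2)) ↔ ψ = (Φ e).1) ∧
      -- its maximal torus gives `χ^m` the degree `⟨m, ρ_{-e} - ρ_e⟩`
      (∀ (e : ToricSL2.SL2Roots σ) (t : Kˣ) (m : ToricSL2.dualMonoid σ),
        (Φ e).1.toHom (ToricSL2.diag t) (ToricSL2.chi K m) =
          ((t ^ (ToricSL2.rayDiff e (m : M)) : Kˣ) : K) • ToricSL2.chi K m) ∧
      -- the bijection
      Function.Bijective
        (fun e => (Quotient.mk (ToricSL2.torusConj K σ) (Φ e))) ∧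
      -- effectiveness
      (∀ e : ToricSL2.SL2Roots σ,
        (Function.Injective (Φ e).1.toHom ↔ ToricSL2.IsPrimitive (ToricSL2.rayDiff e)) ∧
        (¬ ToricSL2.IsPrimitive (ToricSL2.rayDiff e) →
          (∃ q : ToricSL2.DualLattice M,
            ToricSL2.rayDiff e = (2 : ℤ) • q ∧ ToricSL2.IsPrimitive q) ∧
          ∃ φbar : Matrix.ProjectiveSpecialLinearGroup (Fin 2) K →*
              (ToricSL2.CoordRing K σ ≃ₐ[K] ToricSL2.CoordRing K σ),
            Function.Injective φbar ∧
            ∀ g : Matrix.SpecialLinearGroup (Fin 2) K,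
              φbar (QuotientGroup.mk g) = (Φ e).1.toHom g)) := by
  refine ⟨fun φ hφ => ?_, fun e => ⟨ToricSL2.rootAction K hfg hpointed e,
    ToricSL2.rootAction_isCompatible hfg hpointed e,
    ToricSL2.rootAction_isAdapted hfg hpointed e⟩,
    fun e ψ => ToricSL2.generators_iff_eq_rootAction hfg hpointed e ψ,
    fun e t m => ToricSL2.rootAction_diag hfg hpointed e t m, ⟨?_, ?_⟩, fun e =>
    ⟨ToricSL2.rootAction_injective_iff hfg hpointed e, fun h =>
      ⟨ToricSL2.exists_eq_two_smul_isPrimitive e h,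
        ToricSL2.exists_projective_rootAction hfg hpointed e h⟩⟩⟩
  · obtain ⟨g, hg⟩ := hφ.exists_conj_adapted hfg hpointed
    exact ⟨⟨_, hg⟩, g, fun x => rfl⟩
  · intro e e' h
    obtain ⟨t, ht⟩ := Quotient.exact h
    exact ToricSL2.eq_of_rootAction_conj hfg hpointed ht
  · intro x
    induction x using Quotient.inductionOn with | h φ
    obtain ⟨e, t, ht⟩ := ToricSL2.exists_rootAction_conj hfg hpointed φ.2.1 φ.2.2
    exact ⟨e, Quotient.sound ⟨t, ht⟩⟩
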